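/- Suppose $f:[1,\infty)\to\mathbb R$ satisfies the following conditions: (a) $0<f(x)\le 1$ for all $x\ge 1$; (b) $f$ is continuous and strictly decreasing on $[1,\infty)$, and $\lim_{x\to\infty}f(x)=0$; (c) $f$ is twice continuously differentiable on $(1,\infty)$; (d) for every $c>0$, $\lim_{x\to\infty}e^{cx}f(x)=\infty$; (e) there is $w\in(1,\infty)$ such that $x\mapsto x f(x)$ is nonincreasing on $[w,\infty)$; (f) $x\mapsto\log f(x)$ is convex on $[1,\infty)$. Suppose $g:[1,\infty)\to[1,\infty)$ is a function with $\lim_{x\to\infty}g(x)=\infty$. Then there exists a real-valued, strictly stationary, countable-state, irreducible, aperiodic Markov chain $X=(X_k)_{k\in\mathbb Z}$ on some probability space $(\Omega,\mathcal F,P)$, reversible in the sense that $(X_{-k})_{k\in\mathbb Z}$ has the same distribution as $X$, with $E[X_0^2]<\infty$ and $E[X_0]=0$, such that all of the following hold. (1) With $Q_{|X_0|}(u):=\inf\{t\ge 0: P(|X_0|>t)\le u\}$ for $0<u<1$, the function $Q_{|X_0|}^2$ is integrable on $(0,1)$ and $$\int_0^{f(x)}Q_{|X_0|}^2(u)\,du=O\!\left(\frac{-f'(x)}{f(x)}\,g(x)\right)\quad\text{as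 }x\to\infty.$$ (2) $\alpha_X(n)\le\beta_X(n)\le f(n)$ for every integer $n\ge1$. Here $\alpha_X(n)=\sup|P(A\cap B)-P(A)P(B)|$ over $A\in\sigma(X_k,k\le0)$ and $B\in\sigma(X_k,k\ge n)$, and $\beta_X(n)=\sup\frac12\sum_{i}\sum_{j}|P(A_i\cap B_j)-P(A_i)P(B_j)|$ over all pairs of finite partitions $\{A_i\}$, $\{B_j\}$ of $\Omega$ with $A_i\in\sigma(X_k,k\le0)$ and $B_j\in\sigma(X_k,k\ge n)$ for all $i$, $j$. (3) $\lim_{n\to\infty}n^{-1}\operatorname{Var}\bigl(\sum_{k=1}^nX_k\bigr)=\infty$, and for every $c>0$, $$\lim_{n\to\infty}\Bigl[\sup_{r\in\mathbb R}P\Bigl(r-c<n^{-1/2}\sum_{k=1}^nX_k<r+c\Bigr)\Bigr]=0 .$$ (4) There are a strictly increasing sequence of positive integers $J(1),J(2),\dots$ and positive constants $b_1,b_2,\dots$ with $b_n\to\infty$ such that $b_n^{-1}\sum_{k=1}^{J(n)}X_k$ converges in distribution, as $n\to\infty$, to $\mu_{\mathrm{P1sL}}$, the law of $\sum_{k=1}^N\eta_k$,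 where $\eta_1,\eta_2,\dots$ are independent with the Laplace density $\frac12e^{-|x|}$ on $\mathbb R$, and $N$ is independent of $(\eta_k)_{k\ge1}$ and has the Poisson distribution with mean $1$ (the empty sum being $0$). -/

import Mathlib

open MeasureTheory ProbabilityTheory Set Filter Topology Asymptotics

namespace MarkovCLT

noncomputable section

/-! ### Measures of dependence -/

section Dependence

variable {Ω : Type*} [MeasurableSpace Ω]

/-- `α(𝒜, ℬ) = sup |P(A ∩ B) - P(A) P(B)|` over `A ∈ 𝒜`, `B ∈ ℬ`. For a probability measure the
set of values is nonempty and bounded, so the real supremum is the genuine one. -/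
def alphaCoeff (P : Measure Ω) (𝒜 ℬ : MeasurableSpace Ω) : ℝ :=
  sSup {r : ℝ | ∃ A B : Set Ω, MeasurableSet[𝒜] A ∧ MeasurableSet[ℬ] B ∧
    r = |P.real (A ∩ B) - P.real A * P.real B|}

/-- A finite partition of `Ω` into `n` sets belonging to the σ-field `𝒜`. -/
structure IsFinitePartition (𝒜 : MeasurableSpace Ω) {n : ℕ} (A : Fin n → Set Ω) : Prop where
  measurableSet : ∀ i, MeasurableSet[𝒜] (A i)
  pairwise_disjoint : Pairwise fun i j => Disjoint (A i) (A j)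
  iUnion_eq : ⋃ i, A i = univ

/-- `β(𝒜, ℬ) = sup (1/2) ∑ᵢ ∑ⱼ |P(Aᵢ ∩ Bⱼ) - P(Aᵢ) P(Bⱼ)|` over all pairs of finite partitions
`(Aᵢ)` of `Ω` in `𝒜` and `(Bⱼ)` of `Ω` in `ℬ`. For a probability measure and sub-σ-fields of the
ambient one, the set of values is nonempty and bounded by `1`. -/
def betaCoeff (P : Measure Ω) (𝒜 ℬ : MeasurableSpace Ω) : ℝ :=
  sSup {r : ℝ | ∃ (I J : ℕ) (A : Fin I → Set Ω) (B : Fin J → Set Ω),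
    IsFinitePartition 𝒜 A ∧ IsFinitePartition ℬ B ∧
    r = 1 / 2 * ∑ i, ∑ j, |P.real (A i ∩ B j) - P.real (A i) * P.real (B j)|}

/-- The σ-field generated by `X k`, `k ≤ j`. -/
@[reducible] def pastSigma (X : ℤ → Ω → ℝ) (j : ℤ) : MeasurableSpace Ω :=
  ⨆ k : ℤ, ⨆ _ : k ≤ j, MeasurableSpace.comap (X k) inferInstance

/-- The σ-field generated by `X k`, `k ≥ j`. -/
@[reducible] def futureSigma (X : ℤ → Ω → ℝ) (j : ℤ) : MeasurableSpace Ω :=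
  ⨆ k : ℤ, ⨆ _ : j ≤ k, MeasurableSpace.comap (X k) inferInstance

/-- The strong mixing coefficient `α_X(n)`. -/
def alphaMix (P : Measure Ω) (X : ℤ → Ω → ℝ) (n : ℕ) : ℝ :=
  alphaCoeff P (pastSigma X 0) (futureSigma X n)

/-- The absolute regularity coefficient `β_X(n)`. -/
def betaMix (P : Measure Ω) (X : ℤ → Ω → ℝ) (n : ℕ) : ℝ :=
  betaCoeff P (pastSigma X 0) (futureSigma X n)

/-! ### Stationary, reversible, countable-state Markov chains -/

/-- Strict stationarity: the law of `(X (k + m))_k` on `ℝ^ℤ` does not depend on `m`. -/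
def IsStrictlyStationary (P : Measure Ω) (X : ℤ → Ω → ℝ) : Prop :=
  ∀ m : ℤ, P.map (fun ω (k : ℤ) => X (k + m) ω) = P.map (fun ω (k : ℤ) => X k ω)

/-- Reversibility: the law of `(X (-k))_k` on `ℝ^ℤ` is that of `X`. -/
def IsTimeReversible (P : Measure Ω) (X : ℤ → Ω → ℝ) : Prop :=
  P.map (fun ω (k : ℤ) => X (-k) ω) = P.map (fun ω (k : ℤ) => X k ω)

/-- `X = (X k)_{k ∈ ℤ}` is a sequence of random variables with values in the countable set `S`
that satisfies the Markov property: given any history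
`X n = s 0, X (n - 1) = s 1, …, X (n - m) = s m` of positive probability, the conditional
probability of `X (n + 1) = t` depends on the history through `X n = s 0` only. -/
structure IsCountableMarkovChain (P : Measure Ω) (X : ℤ → Ω → ℝ) (S : Set ℝ) : Prop where
  measurable : ∀ k, Measurable (X k)
  countable : S.Countable
  mem_state : ∀ k ω, X k ω ∈ S
  markov : ∀ (n : ℤ) (m : ℕ) (s : ℕ → ℝ) (t : ℝ),
    P {ω | ∀ i : ℕ, i ≤ m → X (n - i) ω = s i} ≠ 0 →
    cond P {ω | ∀ i : ℕ, i ≤ m → X (n - i) ω = s i} {ω | X (n + 1) ω = t} =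
      cond P {ω | X n ω = s 0} {ω | X (n + 1) ω = t}

/-- The `n`-step transition probability `P(X n = t | X 0 = s)` (of a stationary chain). -/
def transProb (P : Measure Ω) (X : ℤ → Ω → ℝ) (n : ℕ) (s t : ℝ) : ENNReal :=
  cond P {ω | X 0 ω = s} {ω | X n ω = t}

/-- Irreducibility on the state space `S`. As `transProb P X n s t = 0` if `P(X 0 = s) = 0`, this
includes that every state has positive probability. -/
def IsIrreducibleOn (P : Measure Ω) (X : ℤ → Ω → ℝ) (S : Set ℝ) : Prop :=
  ∀ s ∈ S, ∀ t ∈ S, ∃ n : ℕ, 1 ≤ n ∧ 0 < transProb P X n s t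

/-- Aperiodicity on the state space `S`: for each state `s`, the greatest common divisor of the
possible return times `{n ≥ 1 | P(X n = s | X 0 = s) > 0}` is `1`. -/
def IsAperiodicOn (P : Measure Ω) (X : ℤ → Ω → ℝ) (S : Set ℝ) : Prop :=
  ∀ s ∈ S, ∀ d : ℕ, (∀ n : ℕ, 1 ≤ n → 0 < transProb P X n s s → d ∣ n) → d = 1

/-- The partial sum `X 1 + ⋯ + X n`. -/
def partialSum (X : ℤ → Ω → ℝ) (n : ℕ) (ω : Ω) : ℝ :=
  ∑ k ∈ Finset.Icc 1 n, X (k : ℤ) ω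

/-- The upper tail quantile function `Q_W(u) = inf {t ≥ 0 | P(W > t) ≤ u}`, `0 < u < 1`. -/
def upperQuantile (P : Measure Ω) (W : Ω → ℝ) (u : ℝ) : ℝ :=
  sInf {t : ℝ | 0 ≤ t ∧ P.real {ω | t < W ω} ≤ u}

/-- Complete dissipation of `n^{-1/2} (X 1 + ⋯ + X n)`: for every `c > 0`,
`sup_r P(r - c < n^{-1/2} (X 1 + ⋯ + X n) < r + c) → 0`. -/
def IsCompletelyDissipated (P : Measure Ω) (X : ℤ → Ω → ℝ) : Prop :=
  ∀ c : ℝ, 0 < c → Tendsto (fun n : ℕ => ⨆ r : ℝ,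
    P {ω | r - c < (√(n : ℝ))⁻¹ * partialSum X n ω ∧
      (√(n : ℝ))⁻¹ * partialSum X n ω < r + c}) atTop (𝓝 0)

end Dependence

/-! ### The law of a Poisson(1) random sum of Laplace random variables -/

/-- The Laplace distribution, with density `(1/2) e^{-|x|}`. -/
def laplaceMeasure : Measure ℝ :=
  volume.withDensity fun x => ENNReal.ofReal (1 / 2 * Real.exp (-|x|))

instance instIsProbabilityMeasureLaplace : IsProbabilityMeasure laplaceMeasure := by
  have h1 : ∫ x : ℝ, Real.exp (-|x|) = 2 := by
    rw [integral_comp_abs (f := fun x => Real.exp (-x)), integral_exp_neg_Ioi_zero, mul_one]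
  have h2 : Integrable fun x : ℝ => Real.exp (-|x|) := by
    by_contra h
    rw [integral_undef h] at h1
    norm_num at h1
  constructor
  rw [laplaceMeasure, withDensity_apply _ MeasurableSet.univ, Measure.restrict_univ,
    ← ofReal_integral_eq_lintegral_ofReal (h2.const_mul _)
      (Eventually.of_forall fun x => by positivity), integral_const_mul, h1]
  norm_num

/-- The law of `∑_{k < N} η_k`, where `N` is Poisson with mean `1` and independent of the
sequence `(η_k)` of independent Laplace random variables. -/
def muP1sL : Measure ℝ :=
  ((poissonMeasure 1).prod (Measure.infinitePi fun _ : ℕ => laplaceMeasure)).map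
    fun p : ℕ × (ℕ → ℝ) => ∑ k ∈ Finset.range p.1, p.2 k

instance instIsProbabilityMeasureMuP1sL : IsProbabilityMeasure muP1sL := by
  have h : Measurable fun p : ℕ × (ℕ → ℝ) => ∑ k ∈ Finset.range p.1, p.2 k := by
    refine measurable_from_prod_countable_right fun n => ?_
    change Measurable fun y : ℕ → ℝ => ∑ k ∈ Finset.range n, y k
    fun_prop
  exact Measure.isProbabilityMeasure_map h.aemeasurable

end

end MarkovCLT

open MarkovCLT

/-!
The chain is a weighted superposition `X k = ∑ j, a j * Y j k` of independent component chains `Y j`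
with values in `{0, 1, -1}`. In each step the component `j` keeps its state with probability
`θ j = exp (-h (x j))`, where `h = -f' / f`, and otherwise draws a fresh state from the symmetric law
that has mass `ε j` off `0`. The `ε j` are summable, so that at every time almost surely only finitely
many components are nonzero. All parameters are functions of locations `x j → ∞` and variance
multipliers `K j → ∞`, which are chosen recursively (`RateData.exists_params`).

*Structure.* Each component is stationary and reversible by detailed balance
(`map_twoSided_add_one`). The weights grow at least by the factor `5`, so that the weighted sum
determines the configuration of the components (`eq_of_weigh_eq`); hence `X` itself, and not only the
configuration, has the Markov property (`isCountableMarkovChain_proc`). Every transition is possible in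
one step (`transProb_proc_pos`), which gives irreducibility and aperiodicity.

*Mixing.* Two copies of a component driven by the same noise coalesce at the first resampling, and they
agree from the start if both are `0`. Thus `β(n) ≤ ∑ j, 2 * ε j * θ j ^ n` (`sum_partition_proc_le`). As
`log f` is convex, its graph lies above its tangent at `x j`; taking for `ε j` a small share of the
`height` of the exponential of this tangent makes the sum at most `f n`
(`RateData.height_mul_exp_le`).

*Partial sums.* The characteristic function of a sum of `n` states of a component is computed by the
powers of a transfer operator, which has an explicit approximate eigenvector with the eigenvalue
`1 - (1 - θ) * ε * q`, where `q` is `1` minus the characteristic function of a symmetrized geometric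
excursion sum (`norm_compChar_sub_pow_le`). Two regimes are used.
For a fixed component and `n → ∞` under the normalization `√n` one finds a Gaussian characteristic
function with a variance of the order `K j`. Since `K j → ∞`, smoothing by a Gaussian kernel
(`measure_interval_le_integral_charFun`) yields complete dissipation, and then Chebyshev's inequality
yields the superlinear growth of the variances.
At the time `J m ≈ 1 / (ε m * (1 - θ m))` and under the normalization `a m / (1 - θ m)`, the component
`m` leaves `0` a Poisson number of times, and each excursion is asymptotically Laplace distributed
(`tendsto_compChar_own_scale`). Components of smaller index have a much smaller variance and those of
larger index have with high probability been `0` all the time (`norm_charFun_sub_compChar_le`), so Lévy's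
continuity theorem gives the limit law `exp (1 / (1 + t ^ 2) - 1)`.

*Quantiles.* The size of `X 0` is dominated by its top nonzero component, so the squared quantile function
has an integral over `(0, f y)` of at most `4 * ∑ j, a j ^ 2 * min (ε j) (f y)`
(`integral_sq_upperQuantile_proc_le`). With `a j ^ 2 * ε j = h (x j) * K j`, the components located to the
left of `y` are bounded through `f y`, those to the right through their variances, and each group is
at most `h y * g y` (`Params.sum_weight_sq_mul_min_le`).
-/

namespace MarkovCLT

noncomputable section

/-! ### Component chains -/

instance instMeasurableSpaceSignType : MeasurableSpace SignType := ⊤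

instance instDiscreteMeasurableSpaceSignType : DiscreteMeasurableSpace SignType :=
  ⟨fun _ => trivial⟩

/-- The symmetric law on `{0, 1, -1}` with mass `ε` off the origin. -/
def stateLaw (ε : unitInterval) : Measure SignType :=
  ENNReal.ofReal (1 - ε) • Measure.dirac 0 +
    (ENNReal.ofReal (ε / 2) • Measure.dirac 1 + ENNReal.ofReal (ε / 2) • Measure.dirac (-1))

instance (ε : unitInterval) : IsProbabilityMeasure (stateLaw ε) := by
  constructor
  have h0 := ε.2.1
  have h1 := ε.2.2
  simp only [stateLaw, Measure.add_apply, Measure.smul_apply, measure_univ, smul_eq_mul, mul_one]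
  rw [← ENNReal.ofReal_add (by linarith) (by linarith),
    ← ENNReal.ofReal_add (by linarith) (by linarith)]
  simp

/-- The law of a coin showing `true` with probability `θ`. -/
def coinLaw (θ : unitInterval) : Measure Bool :=
  ENNReal.ofReal θ • Measure.dirac true + ENNReal.ofReal (1 - θ) • Measure.dirac false

instance (θ : unitInterval) : IsProbabilityMeasure (coinLaw θ) := by
  constructor
  have h0 := θ.2.1
  have h1 := θ.2.2
  simp only [coinLaw, Measure.add_apply, Measure.smul_apply, measure_univ, smul_eq_mul, mul_one]
  rw [← ENNReal.ofReal_add (by linarith) (by linarith)]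
  simp

/-- The noise driving one step of a component chain: a coin that decides whether the state is
kept, and the fresh state that is used otherwise. -/
abbrev Noise := Bool × SignType

/-- The law of the noise of one step: the coin and the fresh state are independent. -/
def noiseLaw (θ ε : unitInterval) : Measure Noise := (coinLaw θ).prod (stateLaw ε)

instance (θ ε : unitInterval) : IsProbabilityMeasure (noiseLaw θ ε) := by
  unfold noiseLaw; infer_instance

/-- One step of a component chain: keep the state if the coin shows `true`, else resample. -/
def step (s : SignType) (n : Noise) : SignType := if n.1 then s else n.2

/-- The transition kernel of a component chain. -/
lemma lintegral_step (θ ε : unitInterval) (s : SignType) (G : SignType → ENNReal) :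
    ∫⁻ n, G (step s n) ∂(noiseLaw θ ε) =
      ENNReal.ofReal θ * G s + ENNReal.ofReal (1 - θ) * ∫⁻ t, G t ∂(stateLaw ε) := by
  rw [noiseLaw, lintegral_prod _ (Measurable.of_discrete).aemeasurable]
  simp [coinLaw, step]

/-- Detailed balance of a component chain with respect to `stateLaw ε`. -/
lemma lintegral_step_comm (θ ε : unitInterval) (H : SignType → SignType → ENNReal) :
    ∫⁻ s, ∫⁻ n, H (step s n) s ∂(noiseLaw θ ε) ∂(stateLaw ε) =
      ∫⁻ s, ∫⁻ n, H s (step s n) ∂(noiseLaw θ ε) ∂(stateLaw ε) := by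
  have h1 : ∀ s, ∫⁻ n, H (step s n) s ∂(noiseLaw θ ε) = _ := fun s =>
    lintegral_step θ ε s (fun t => H t s)
  have h2 : ∀ s, ∫⁻ n, H s (step s n) ∂(noiseLaw θ ε) = _ := fun s =>
    lintegral_step θ ε s (fun t => H s t)
  simp only [h1, h2]
  rw [lintegral_add_left (Measurable.of_discrete), lintegral_add_left (Measurable.of_discrete),
    lintegral_const_mul _ (Measurable.of_discrete), lintegral_const_mul _ (Measurable.of_discrete),
    lintegral_lintegral_swap (Measurable.of_discrete).aemeasurable,
    lintegral_const_mul _ (Measurable.of_discrete)]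

/-- The trajectory started at `s` and driven by the noise `w`. -/
def run (s : SignType) (w : ℕ → Noise) : ℕ → SignType
  | 0 => s
  | k + 1 => step (run s w k) (w k)

/-- Prepending a value to a sequence. -/
def prepend {α : Type*} (x : α) (w : ℕ → α) : ℕ → α
  | 0 => x
  | k + 1 => w k

lemma measurable_prepend {α : Type*} [MeasurableSpace α] :
    Measurable fun p : α × (ℕ → α) => prepend p.1 p.2 := by
  refine measurable_pi_lambda _ fun k => ?_
  cases k with
  | zero => exact measurable_fst
  | succ k => exact (measurable_pi_apply k).comp measurable_snd

lemma measurable_step : Measurable fun p : SignType × Noise => step p.1 p.2 :=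
  Measurable.of_discrete

lemma measurable_run : Measurable fun p : SignType × (ℕ → Noise) => run p.1 p.2 := by
  refine measurable_pi_lambda _ fun k => ?_
  induction k with
  | zero => exact measurable_fst
  | succ k ih =>
    exact measurable_step.comp (ih.prodMk ((measurable_pi_apply k).comp measurable_snd))

/-- Markov property of a trajectory, at the level of the driving noise: what follows the first step
is the trajectory of the new state under the shifted noise. -/
lemma run_prepend (s : SignType) (n : Noise) (w : ℕ → Noise) :
    run s (prepend n w) = prepend s (run (step s n) w) := by
  have key : ∀ k, run s (prepend n w) (k + 1) = run (step s n) w k := by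
    intro k
    induction k with
    | zero => rfl
    | succ k ih => rw [run, ih]; rfl
  funext k
  cases k with
  | zero => rfl
  | succ k => exact key k

/-- Prepending an independent variable of law `ν` to a sequence of independent variables of law `ν`
yields such a sequence again. -/
lemma infinitePi_map_prepend {α : Type*} [MeasurableSpace α] (ν : Measure α)
    [IsProbabilityMeasure ν] :
    (ν.prod (Measure.infinitePi fun _ : ℕ => ν)).map (fun p => prepend p.1 p.2) =
      Measure.infinitePi fun _ : ℕ => ν := by
  classical
  refine Measure.eq_infinitePi _ fun s t ht => ?_
  rw [Measure.map_apply measurable_prepend (.pi s.countable_toSet fun _ _ => ht _)]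
  set t' : ℕ → Set α := fun i => if i ∈ s then t i else univ with ht'
  have hmt' : ∀ i, MeasurableSet (t' i) := by
    intro i; simp only [ht']; split_ifs; exacts [ht i, .univ]
  obtain ⟨N, hN⟩ : ∃ N, ∀ i ∈ s, i < N + 1 :=
    ⟨s.sup id, fun i hi => Nat.lt_succ_of_le (Finset.le_sup (f := id) hi)⟩
  have hpre : (fun p : α × (ℕ → α) => prepend p.1 p.2) ⁻¹' ((s : Set ℕ).pi t) =
      t' 0 ×ˢ ((Finset.range N : Set ℕ).pi fun i => t' (i + 1)) := by
    ext ⟨x, w⟩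
    simp only [mem_preimage, Set.mem_pi, mem_prod, Finset.mem_coe, ht', Finset.mem_range]
    constructor
    · intro h
      refine ⟨?_, fun i _ => ?_⟩
      · split_ifs with h0
        · exact h 0 h0
        · trivial
      · split_ifs with h0
        · exact h (i + 1) h0
        · trivial
    · rintro ⟨h0, h1⟩ i hi
      cases i with
      | zero => simpa [hi, prepend] using h0
      | succ i => simpa [hi, prepend] using h1 i (by have := hN _ hi; omega)
  rw [hpre, Measure.prod_prod, Measure.infinitePi_pi _ (fun i _ => hmt' _), mul_comm,
    ← Finset.prod_range_succ' (fun i => ν (t' i))]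
  have hsub : s ⊆ Finset.range (N + 1) := fun i hi => Finset.mem_range.2 (hN i hi)
  rw [← Finset.prod_subset hsub (f := fun i => ν (t' i))]
  · exact Finset.prod_congr rfl fun i hi => by simp [ht', hi]
  · intro i _ hi; simp [ht', hi]

lemma lintegral_infinitePi_prepend {α : Type*} [MeasurableSpace α] (ν : Measure α)
    [IsProbabilityMeasure ν] {G : (ℕ → α) → ENNReal} (hG : Measurable G) :
    ∫⁻ w, G w ∂(Measure.infinitePi fun _ : ℕ => ν) =
      ∫⁻ x, ∫⁻ w, G (prepend x w) ∂(Measure.infinitePi fun _ : ℕ => ν) ∂ν := by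
  conv_lhs => rw [← infinitePi_map_prepend ν]
  rw [lintegral_map hG measurable_prepend,
    lintegral_prod (fun p : α × (ℕ → α) => G (prepend p.1 p.2))
      (hG.comp measurable_prepend).aemeasurable]

/-- The two-sided path with forward part `u` and backward part `v`. -/
def glue {α : Type*} (u v : ℕ → α) (k : ℤ) : α := if 0 ≤ k then u k.toNat else v (-k).toNat

/-- Shifting a two-sided path moves one value from the forward to the backward part. -/
lemma glue_add_one {α : Type*} {u v : ℕ → α} (h : u 0 = v 0) (k : ℤ) :
    glue u v (k + 1) = glue (fun i => u (i + 1)) (prepend (u 1) v) k := by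
  unfold glue
  rcases lt_trichotomy k (-1) with hk | hk | hk
  · rw [if_neg (by omega), if_neg (by omega)]
    obtain ⟨i, hi⟩ : ∃ i : ℕ, (-k).toNat = i + 1 := ⟨(-k).toNat - 1, by omega⟩
    rw [hi, prepend]
    congr 1; omega
  · subst hk
    simp [prepend, h]
  · rw [if_pos (by omega), if_pos (by omega)]
    congr 1; omega

lemma glue_neg {α : Type*} {u v : ℕ → α} (h : u 0 = v 0) (k : ℤ) :
    glue u v (-k) = glue v u k := by
  unfold glue
  rcases lt_trichotomy k 0 with hk | hk | hk
  · rw [if_pos (by omega), if_neg (by omega)]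
  · subst hk; simp [h]
  · rw [if_neg (by omega), if_pos (by omega), neg_neg]

/-- Initial state, forward noise and backward noise of a component chain. -/
abbrev CompSpace := SignType × (ℕ → Noise) × (ℕ → Noise)

/-- The law of the data of a component chain: independent, with the initial state distributed
according to `stateLaw ε`. -/
def compLaw (θ ε : unitInterval) : Measure CompSpace :=
  (stateLaw ε).prod ((Measure.infinitePi fun _ : ℕ => noiseLaw θ ε).prod
    (Measure.infinitePi fun _ : ℕ => noiseLaw θ ε))

instance (θ ε : unitInterval) : IsProbabilityMeasure (compLaw θ ε) := by
  unfold compLaw; infer_instance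

/-- The two-sided component chain. -/
def twoSided (z : CompSpace) : ℤ → SignType := glue (run z.1 z.2.1) (run z.1 z.2.2)

lemma measurable_twoSided : Measurable twoSided := by
  refine measurable_pi_lambda _ fun k => ?_
  unfold twoSided glue
  split_ifs
  · exact (measurable_pi_apply _).comp (measurable_run.comp
      (measurable_fst.prodMk (measurable_fst.comp measurable_snd)))
  · exact (measurable_pi_apply _).comp (measurable_run.comp
      (measurable_fst.prodMk (measurable_snd.comp measurable_snd)))

lemma lintegral_compLaw (θ ε : unitInterval) {F : CompSpace → ENNReal} (hF : Measurable F) :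
    ∫⁻ z, F z ∂(compLaw θ ε) = ∫⁻ s, ∫⁻ w, ∫⁻ w', F (s, w, w')
      ∂(Measure.infinitePi fun _ : ℕ => noiseLaw θ ε)
      ∂(Measure.infinitePi fun _ : ℕ => noiseLaw θ ε) ∂(stateLaw ε) := by
  rw [compLaw, lintegral_prod _ hF.aemeasurable]
  refine lintegral_congr fun s => ?_
  rw [lintegral_prod (fun y => F (s, y)) (hF.comp measurable_prodMk_left).aemeasurable]

lemma measurable_glue {α : Type*} [MeasurableSpace α] :
    Measurable fun p : (ℕ → α) × (ℕ → α) => glue p.1 p.2 := by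
  refine measurable_pi_lambda _ fun k => ?_
  unfold glue
  split_ifs <;> fun_prop

/-- The law of a component chain is invariant under the shift. In the shifted path the first forward
step has become the last backward step; detailed balance says that this step has the same law in
both directions, and the remaining noise is independent of it. -/
lemma map_twoSided_add_one (θ ε : unitInterval) :
    (compLaw θ ε).map (fun z (k : ℤ) => twoSided z (k + 1)) = (compLaw θ ε).map twoSided := by
  have hm1 : Measurable fun (z : CompSpace) (k : ℤ) => twoSided z (k + 1) :=
    measurable_pi_lambda _ fun k => (measurable_pi_apply _).comp measurable_twoSided
  refine Measure.ext_of_lintegral _ fun F hF => ?_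
  rw [lintegral_map hF hm1, lintegral_map hF measurable_twoSided,
    lintegral_compLaw θ ε (F := fun z => F fun k => twoSided z (k + 1)) (hF.comp hm1),
    lintegral_compLaw θ ε (F := fun z => F (twoSided z)) (hF.comp measurable_twoSided)]
  set Nw := Measure.infinitePi fun _ : ℕ => noiseLaw θ ε
  set H : SignType → SignType → ENNReal := fun t s =>
    ∫⁻ w, ∫⁻ w', F (glue (run t w) (prepend t (run s w'))) ∂Nw ∂Nw with hH
  have hr : ∀ s, Measurable (run s) := fun s => measurable_run.comp measurable_prodMk_left
  have hpre : ∀ s : SignType, Measurable (fun u : ℕ → SignType => prepend s u) :=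
    fun s => measurable_prepend.comp measurable_prodMk_left
  -- the original path, conditioned on its state `t` at time `0`, with its first backward step
  -- singled out
  have hR : ∀ t, ∫⁻ w, ∫⁻ w', F (twoSided (t, w, w')) ∂Nw ∂Nw =
      ∫⁻ n, H t (step t n) ∂(noiseLaw θ ε) := by
    intro t
    have hjm : Measurable fun p : Noise × (ℕ → Noise) × (ℕ → Noise) =>
        F (glue (run t p.2.1) (prepend t (run (step t p.1) p.2.2))) := by
      refine hF.comp (measurable_glue.comp (((hr t).comp (by fun_prop)).prodMk
        ((hpre t).comp (measurable_run.comp (Measurable.prodMk ?_ (by fun_prop))))))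
      exact (Measurable.of_discrete : Measurable fun n : Noise => step t n).comp measurable_fst
    have h1 : ∀ w, ∫⁻ w', F (twoSided (t, w, w')) ∂Nw =
        ∫⁻ n, ∫⁻ w', F (glue (run t w) (prepend t (run (step t n) w'))) ∂Nw
          ∂(noiseLaw θ ε) := by
      intro w
      rw [lintegral_infinitePi_prepend (noiseLaw θ ε)
        (G := fun w' => F (twoSided (t, w, w')))
        (hF.comp (measurable_twoSided.comp (by fun_prop)))]
      simp only [twoSided, run_prepend]
      rfl
    simp only [h1]
    rw [lintegral_lintegral_swap]
    refine (Measurable.lintegral_prod_right' (f := fun q : ((ℕ → Noise) × Noise) × (ℕ → Noise) =>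
      F (glue (run t q.1.1) (prepend t (run (step t q.1.2) q.2)))) ?_).aemeasurable
    exact hjm.comp (g := fun p : Noise × (ℕ → Noise) × (ℕ → Noise) =>
        F (glue (run t p.2.1) (prepend t (run (step t p.1) p.2.2))))
        (f := fun q : ((ℕ → Noise) × Noise) × (ℕ → Noise) => (q.1.2, q.1.1, q.2)) (by fun_prop)
  -- the shifted path, conditioned on its state `s` at time `-1`, with the first forward step of
  -- the original path singled out
  have hL : ∀ s, ∫⁻ w, ∫⁻ w', F (fun k => twoSided (s, w, w') (k + 1)) ∂Nw ∂Nw =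
      ∫⁻ n, H (step s n) s ∂(noiseLaw θ ε) := by
    intro s
    rw [lintegral_infinitePi_prepend (noiseLaw θ ε)
        (G := fun w => ∫⁻ w', F (fun k => twoSided (s, w, w') (k + 1)) ∂Nw)
        (Measurable.lintegral_prod_right' (f := fun p : (ℕ → Noise) × (ℕ → Noise) =>
          F (fun k => twoSided (s, p.1, p.2) (k + 1))) (hF.comp (hm1.comp (by fun_prop))))]
    refine lintegral_congr fun n => lintegral_congr fun w => lintegral_congr fun w' => ?_
    congr 1
    funext k
    simp only [twoSided]
    rw [glue_add_one (u := run s (prepend n w)) (v := run s w') rfl, run_prepend]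
    rfl
  simp only [hR, hL]
  exact lintegral_step_comm θ ε H

/-! ### The process: stationarity and reversibility -/

/-- Pairing two independent sequences of independent variables coordinatewise gives a sequence of
independent pairs. -/
lemma infinitePi_prod_map_zip {ι : Type*} {α β : ι → Type*} [∀ i, MeasurableSpace (α i)]
    [∀ i, MeasurableSpace (β i)] (μ : ∀ i, Measure (α i)) (ν : ∀ i, Measure (β i))
    [∀ i, IsProbabilityMeasure (μ i)] [∀ i, IsProbabilityMeasure (ν i)] :
    ((Measure.infinitePi μ).prod (Measure.infinitePi ν)).map (fun p i => (p.1 i, p.2 i)) =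
      Measure.infinitePi fun i => (μ i).prod (ν i) := by
  refine Measure.eq_infinitePi _ fun s t ht => ?_
  have hm : Measurable fun (p : (∀ i, α i) × (∀ i, β i)) i => (p.1 i, p.2 i) := by fun_prop
  have hms : MeasurableSet ((s : Set ι).pi t) := .pi s.countable_toSet fun _ _ => ht _
  rw [Measure.map_apply hm hms, Measure.prod_apply (hm hms)]
  have h1 : ∀ x : ∀ i, α i, Measure.infinitePi ν
      (Prod.mk x ⁻¹' ((fun (p : (∀ i, α i) × (∀ i, β i)) i => (p.1 i, p.2 i)) ⁻¹'
        ((s : Set ι).pi t))) = ∏ i ∈ s, ν i (Prod.mk (x i) ⁻¹' t i) := by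
    intro x
    rw [← Measure.infinitePi_pi ν (fun i _ => measurable_prodMk_left (ht i))]
    congr 1
  simp only [h1]
  have hg : ∀ i, Measurable fun y : α i => ν i (Prod.mk y ⁻¹' t i) := fun i =>
    measurable_measure_prodMk_left (ht i)
  have hind := iIndepFun_infinitePi (P := μ) (X := fun i y => ν i (Prod.mk y ⁻¹' t i)) hg
  rw [lintegral_prod_eq_prod_lintegral_of_indepFun s
    (fun i (x : ∀ i, α i) => ν i (Prod.mk (x i) ⁻¹' t i)) hind
    (fun i => (hg i).comp (measurable_pi_apply i))]
  refine Finset.prod_congr rfl fun i _ => ?_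
  rw [Measure.prod_apply (ht i), ← Measure.infinitePi_map_eval μ i,
    lintegral_map (hg i) (measurable_pi_apply i)]

/-- Configurations: one state for each component. -/
abbrev Config := ℕ → SignType

/-- The one-sided noise of all components. -/
abbrev NoiseField := ℕ → ℕ → Noise

/-- The probability space: configuration at time `0` and backward noise, then an auxiliary
configuration and the forward noise. The auxiliary configuration does not enter the process; it
serves as an independent starting point of the forward motion. -/
abbrev PathSpace := (Config × NoiseField) × (Config × NoiseField)

/-- The law of the configuration at a fixed time: the components are independent. -/
def configLaw (ε : ℕ → unitInterval) : Measure Config :=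
  Measure.infinitePi fun j => stateLaw (ε j)

instance (ε : ℕ → unitInterval) : IsProbabilityMeasure (configLaw ε) := by
  unfold configLaw; infer_instance

/-- The law of the one-sided noise: independent over components and over time. -/
def fieldLaw (θ ε : ℕ → unitInterval) : Measure NoiseField :=
  Measure.infinitePi fun j => Measure.infinitePi fun _ : ℕ => noiseLaw (θ j) (ε j)

instance (θ ε : ℕ → unitInterval) : IsProbabilityMeasure (fieldLaw θ ε) := by
  unfold fieldLaw; infer_instance

/-- The law on the path space: all coordinates are independent. -/
def pathLaw (θ ε : ℕ → unitInterval) : Measure PathSpace :=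
  ((configLaw ε).prod (fieldLaw θ ε)).prod ((configLaw ε).prod (fieldLaw θ ε))

instance (θ ε : ℕ → unitInterval) : IsProbabilityMeasure (pathLaw θ ε) := by
  unfold pathLaw; infer_instance

/-- The data of the `j`-th component chain. -/
def compData (j : ℕ) (ω : PathSpace) : CompSpace := (ω.1.1 j, ω.2.2 j, ω.1.2 j)

lemma measurable_compData (j : ℕ) : Measurable (compData j) := by
  unfold compData; fun_prop

/-- The component chains are independent, the `j`-th one with the law `compLaw (θ j) (ε j)`. -/
lemma pathLaw_map_compData (θ ε : ℕ → unitInterval) :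
    (pathLaw θ ε).map (fun ω j => compData j ω) =
      Measure.infinitePi fun j => compLaw (θ j) (ε j) := by
  have h1 : MeasurePreserving (fun ω : PathSpace => (ω.1, ω.2.2)) (pathLaw θ ε)
      (((configLaw ε).prod (fieldLaw θ ε)).prod (fieldLaw θ ε)) :=
    (MeasurePreserving.id _).prod measurePreserving_snd
  have h2 : MeasurePreserving (fun ω : (Config × NoiseField) × NoiseField =>
      (ω.1.1, ω.2, ω.1.2)) (((configLaw ε).prod (fieldLaw θ ε)).prod (fieldLaw θ ε))
      ((configLaw ε).prod ((fieldLaw θ ε).prod (fieldLaw θ ε))) :=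
    ((MeasurePreserving.id _).prod Measure.measurePreserving_swap).comp
      (measurePreserving_prodAssoc _ _ _)
  have h3 := (h2.comp h1).map_eq
  have h4 : (fun ω j => compData j ω) =
      (fun (q : Config × (ℕ → (ℕ → Noise) × (ℕ → Noise))) j => (q.1 j, q.2 j)) ∘
      (Prod.map id fun (p : NoiseField × NoiseField) j => (p.1 j, p.2 j)) ∘
      ((fun ω : (Config × NoiseField) × NoiseField => (ω.1.1, ω.2, ω.1.2)) ∘
        fun ω : PathSpace => (ω.1, ω.2.2)) := rfl
  have hz : Measurable (fun (p : NoiseField × NoiseField) j => (p.1 j, p.2 j)) := by fun_prop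
  rw [h4, ← Measure.map_map (by fun_prop) ((measurable_id.prodMap hz).comp (h2.comp h1).measurable),
    ← Measure.map_map (measurable_id.prodMap hz) (h2.comp h1).measurable, h3,
    ← Measure.map_prod_map _ _ measurable_id hz, Measure.map_id, fieldLaw,
    infinitePi_prod_map_zip, configLaw, infinitePi_prod_map_zip]
  rfl

/-- The state of the `j`-th component at time `k`. -/
def comp (j : ℕ) (k : ℤ) (ω : PathSpace) : SignType := twoSided (compData j ω) k

lemma measurable_comp (j : ℕ) (k : ℤ) : Measurable (comp j k) :=
  (measurable_pi_apply k).comp (measurable_twoSided.comp (measurable_compData j))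

/-- The weighted sum of a configuration. If the weights are at least `1` and infinitely many
components are nonzero, the series diverges and this is the junk value `0`. -/
def weigh (a : ℕ → ℝ) (y : Config) : ℝ := ∑' j, a j * (y j : ℝ)

lemma measurable_weigh (a : ℕ → ℝ) : Measurable (weigh a) := by
  unfold weigh
  refine Measurable.tsum fun j => ?_
  exact (Measurable.of_discrete : Measurable fun s : SignType => a j * (s : ℝ)).comp
    (measurable_pi_apply j)

/-- The process: the weighted sum of the component chains. -/
def proc (a : ℕ → ℝ) (k : ℤ) (ω : PathSpace) : ℝ := weigh a fun j => comp j k ω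

lemma measurable_proc (a : ℕ → ℝ) (k : ℤ) : Measurable (proc a k) :=
  (measurable_weigh a).comp (measurable_pi_lambda _ fun j => measurable_comp j k)

/-- The one-sided weighted process started from `y`, with noise `w`. -/
def oneSided (a : ℕ → ℝ) (y : Config) (w : NoiseField) (k : ℕ) : ℝ :=
  weigh a fun j => run (y j) (w j) k

lemma measurable_oneSided (a : ℕ → ℝ) :
    Measurable fun p : Config × NoiseField => oneSided a p.1 p.2 := by
  refine measurable_pi_lambda _ fun k => (measurable_weigh a).comp
    (measurable_pi_lambda _ fun j => (measurable_pi_apply k).comp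
      (measurable_run.comp (f := fun p : Config × NoiseField => (p.1 j, p.2 j)) ?_))
  fun_prop

lemma proc_eq_glue (a : ℕ → ℝ) (k : ℤ) (ω : PathSpace) :
    proc a k ω = glue (oneSided a ω.1.1 ω.2.2) (oneSided a ω.1.1 ω.1.2) k := by
  unfold proc comp twoSided compData glue oneSided
  split_ifs <;> rfl

lemma proc_natCast (a : ℕ → ℝ) (k : ℕ) (ω : PathSpace) :
    proc a k ω = oneSided a ω.1.1 ω.2.2 k := by
  rw [proc_eq_glue]; simp [glue]

lemma proc_neg_natCast (a : ℕ → ℝ) (k : ℕ) (ω : PathSpace) :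
    proc a (-k) ω = oneSided a ω.1.1 ω.1.2 k := by
  rw [proc_eq_glue, glue_neg (u := oneSided a ω.1.1 ω.2.2) (v := oneSided a ω.1.1 ω.1.2) rfl]
  simp [glue]

lemma measurePreserving_swap_snd {α β : Type*} [MeasurableSpace α] [MeasurableSpace β]
    (μ : Measure α) (ν : Measure β) [SFinite μ] [SFinite ν] :
    MeasurePreserving (fun p : (α × β) × (α × β) => ((p.1.1, p.2.2), (p.2.1, p.1.2)))
      ((μ.prod ν).prod (μ.prod ν)) ((μ.prod ν).prod (μ.prod ν)) := by
  have hc : MeasurePreserving (fun p : β × (α × β) => (p.2.2, (p.2.1, p.1)))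
      (ν.prod (μ.prod ν)) (ν.prod (μ.prod ν)) :=
    ((measurePreserving_prodAssoc ν μ ν).comp
      (Measure.measurePreserving_swap.prod (MeasurePreserving.id ν))).comp
      Measure.measurePreserving_swap
  exact ((measurePreserving_prodAssoc μ ν (μ.prod ν)).symm.comp
    ((MeasurePreserving.id μ).prod hc)).comp (measurePreserving_prodAssoc μ ν (μ.prod ν))

/-- Exchanging backward and forward noise preserves the law; this is time reversal of the process. -/
lemma measurePreserving_swapNoise (θ ε : ℕ → unitInterval) :
    MeasurePreserving (fun ω : PathSpace => (((ω.1.1, ω.2.2), (ω.2.1, ω.1.2)) : PathSpace))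
      (pathLaw θ ε) (pathLaw θ ε) :=
  measurePreserving_swap_snd _ _

/-- Exchanging the initial configuration with the auxiliary one preserves the law. -/
lemma measurePreserving_swapConfig (θ ε : ℕ → unitInterval) :
    MeasurePreserving (fun ω : PathSpace => (((ω.2.1, ω.1.2), (ω.1.1, ω.2.2)) : PathSpace))
      (pathLaw θ ε) (pathLaw θ ε) :=
  (measurePreserving_swap_snd _ _).comp Measure.measurePreserving_swap

lemma isTimeReversible_proc (θ ε : ℕ → unitInterval) (a : ℕ → ℝ) :
    IsTimeReversible (pathLaw θ ε) (proc a) := by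
  unfold IsTimeReversible
  conv_rhs => rw [← (measurePreserving_swapNoise θ ε).map_eq]
  rw [Measure.map_map (measurable_pi_lambda _ fun k => measurable_proc a k) (by fun_prop)]
  congr 1
  funext ω k
  simp only [Function.comp, proc_eq_glue]
  exact glue_neg (u := oneSided a ω.1.1 ω.2.2) (v := oneSided a ω.1.1 ω.1.2) rfl k

/-- A process on `ℤ` whose law is invariant under the shift by `1` has a law that is invariant
under all shifts. -/
lemma map_add_eq_of_map_add_one {Ω α : Type*} [MeasurableSpace Ω] [MeasurableSpace α]
    {P : Measure Ω} {X : ℤ → Ω → α} (hX : ∀ k, Measurable (X k))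
    (h : P.map (fun ω (k : ℤ) => X (k + 1) ω) = P.map (fun ω (k : ℤ) => X k ω)) (m : ℤ) :
    P.map (fun ω (k : ℤ) => X (k + m) ω) = P.map (fun ω (k : ℤ) => X k ω) := by
  have hm : ∀ m : ℤ, Measurable fun ω (k : ℤ) => X (k + m) ω := fun m =>
    measurable_pi_lambda _ fun k => hX _
  have hsh : ∀ m : ℤ, Measurable fun (x : ℤ → α) (k : ℤ) => x (k + m) := fun m => by fun_prop
  have step : ∀ m : ℤ, P.map (fun ω (k : ℤ) => X (k + (m + 1)) ω) =
      P.map (fun ω (k : ℤ) => X (k + m) ω) := by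
    intro m
    have := congrArg (fun Q => Q.map fun (x : ℤ → α) (k : ℤ) => x (k + m)) h
    rw [Measure.map_map (hsh m) (hm 1),
      Measure.map_map (hsh m) (by simpa using hm 0)] at this
    simpa only [Function.comp_def, add_assoc] using this
  induction m using Int.induction_on with
  | zero => simp
  | succ i ih => rw [step, ih]
  | pred i ih => rw [← ih, ← step (-(i : ℤ) - 1)]; simp

lemma isStrictlyStationary_proc (θ ε : ℕ → unitInterval) (a : ℕ → ℝ) :
    IsStrictlyStationary (pathLaw θ ε) (proc a) := by
  refine fun m => map_add_eq_of_map_add_one (measurable_proc a) ?_ m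
  have hG : Measurable fun (u : ℕ → ℤ → SignType) (k : ℤ) => weigh a fun j => u j k :=
    measurable_pi_lambda _ fun k => (measurable_weigh a).comp (by fun_prop)
  have hd : Measurable fun (ω : PathSpace) j => compData j ω :=
    measurable_pi_lambda _ measurable_compData
  have hs : Measurable fun (z : CompSpace) (k : ℤ) => twoSided z (k + 1) :=
    measurable_pi_lambda _ fun k => (measurable_pi_apply _).comp measurable_twoSided
  have h1 : (fun ω (k : ℤ) => proc a (k + 1) ω) =
      (fun (u : ℕ → ℤ → SignType) (k : ℤ) => weigh a fun j => u j k) ∘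
      (fun (z : ℕ → CompSpace) j (k : ℤ) => twoSided (z j) (k + 1)) ∘
      fun (ω : PathSpace) j => compData j ω := rfl
  have h2 : (fun ω (k : ℤ) => proc a k ω) =
      (fun (u : ℕ → ℤ → SignType) (k : ℤ) => weigh a fun j => u j k) ∘
      (fun (z : ℕ → CompSpace) j => twoSided (z j)) ∘
      fun (ω : PathSpace) j => compData j ω := rfl
  have hs' : Measurable (fun (z : ℕ → CompSpace) j (k : ℤ) => twoSided (z j) (k + 1)) :=
    measurable_pi_lambda _ fun j => hs.comp (measurable_pi_apply j)
  have ht' : Measurable (fun (z : ℕ → CompSpace) j => twoSided (z j)) :=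
    measurable_pi_lambda _ fun j => measurable_twoSided.comp (measurable_pi_apply j)
  rw [h1, h2, ← Measure.map_map hG (hs'.comp hd), ← Measure.map_map hs' hd,
    ← Measure.map_map hG (ht'.comp hd), ← Measure.map_map ht' hd, pathLaw_map_compData,
    Measure.infinitePi_map_pi (f := fun _ z (k : ℤ) => twoSided z (k + 1)) _ (fun _ => hs),
    Measure.infinitePi_map_pi (f := fun _ => twoSided) _ (fun _ => measurable_twoSided)]
  simp only [map_twoSided_add_one]

/-- By stationarity, `stateLaw (ε j)` is the law of the `j`-th component at every time. -/
lemma pathLaw_map_comp (θ ε : ℕ → unitInterval) (j : ℕ) (k : ℤ) :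
    (pathLaw θ ε).map (comp j k) = stateLaw (ε j) := by
  have h0 : (pathLaw θ ε).map (compData j) = compLaw (θ j) (ε j) := by
    have h := congrArg (fun Q => Q.map fun z : ℕ → CompSpace => z j) (pathLaw_map_compData θ ε)
    rw [Measure.map_map (measurable_pi_apply j) (measurable_pi_lambda _ measurable_compData)] at h
    rw [Measure.infinitePi_map_eval] at h
    exact h
  have h1 := map_add_eq_of_map_add_one (P := compLaw (θ j) (ε j)) (X := fun k z => twoSided z k)
    (fun k => (measurable_pi_apply k).comp measurable_twoSided)
    (map_twoSided_add_one (θ j) (ε j)) k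
  have h2 := congrArg (fun Q => Q.map fun x : ℤ → SignType => x 0) h1
  have hm : ∀ m : ℤ, Measurable fun (z : CompSpace) (i : ℤ) => twoSided z (i + m) := fun m =>
    measurable_pi_lambda _ fun i => (measurable_pi_apply _).comp measurable_twoSided
  rw [Measure.map_map (measurable_pi_apply 0) (hm k),
    Measure.map_map (measurable_pi_apply 0) (by simpa using hm 0)] at h2
  have h3 : comp j k = (fun z => twoSided z k) ∘ compData j := rfl
  have hk : Measurable fun z => twoSided z k := (measurable_pi_apply k).comp measurable_twoSided
  rw [h3, ← Measure.map_map hk (measurable_compData j), h0]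
  simp only [Function.comp_def, zero_add] at h2
  rw [h2]
  exact (measurePreserving_fst (μ := stateLaw (ε j))
    (ν := (Measure.infinitePi fun _ : ℕ => noiseLaw (θ j) (ε j)).prod
      (Measure.infinitePi fun _ : ℕ => noiseLaw (θ j) (ε j)))).map_eq

/-! ### Absolute regularity by coupling -/

/-- Bound on the absolute regularity sums by coupling: if `V'` is a copy of `V` independent of `U`
and agrees with `V` off `G`, then partitions in terms of `U` and `V` are dependent by at most
the probability of `G`. -/
lemma sum_abs_sub_le_of_coupling {Ω α β : Type*} {𝒜 ℬ : MeasurableSpace Ω} [mΩ : MeasurableSpace Ω]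
    [mα : MeasurableSpace α] [mβ : MeasurableSpace β] {P : Measure Ω} [IsProbabilityMeasure P]
    {U : Ω → α} {V V' : Ω → β} (hU : Measurable U) (hV : Measurable V) (hV' : Measurable V')
    (h𝒜 : 𝒜 ≤ mα.comap U) (hℬ : ℬ ≤ mβ.comap V) (hind : IndepFun U V' P)
    (hlaw : P.map V' = P.map V) {G : Set Ω} (hG : MeasurableSet G)
    (heq : ∀ ω ∉ G, V ω = V' ω) {I J : ℕ} {A : Fin I → Set Ω} {B : Fin J → Set Ω}
    (hA : IsFinitePartition 𝒜 A) (hB : IsFinitePartition ℬ B) :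
    1 / 2 * ∑ i, ∑ j, |P.real (A i ∩ B j) - P.real (A i) * P.real (B j)| ≤ P.real G := by
  choose A' hA' hAA' using fun i => h𝒜 _ (hA.measurableSet i)
  choose B' hB' hBB' using fun j => hℬ _ (hB.measurableSet j)
  have mA : ∀ i, MeasurableSet (A i) := fun i => hAA' i ▸ hU (hA' i)
  have mB : ∀ j, MeasurableSet (B j) := fun j => hBB' j ▸ hV (hB' j)
  have mC : ∀ j, MeasurableSet (V' ⁻¹' B' j) := fun j => hV' (hB' j)
  -- a family of disjoint cells cannot have more than the mass of `G` within `G`; for the copy `V'`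
  -- of `V` the cells are disjoint up to null sets only
  have hsum : ∀ C : Fin J → Set Ω, (∀ j, MeasurableSet (C j)) →
      (Pairwise fun j k => P (C j ∩ C k) = 0) →
      ∑ i, ∑ j, P.real (A i ∩ C j ∩ G) ≤ P.real G := by
    intro C mC hC
    rw [← Finset.sum_product', ← measureReal_restrict_apply_univ]
    have h1 : ∀ p : Fin I × Fin J, P.real (A p.1 ∩ C p.2 ∩ G) =
        (P.restrict G).real (A p.1 ∩ C p.2) := fun p => by
      rw [measureReal_restrict_apply ((mA _).inter (mC _))]
    simp only [h1, measureReal_def]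
    rw [← ENNReal.toReal_sum (fun _ _ => measure_ne_top _ _)]
    refine ENNReal.toReal_mono (measure_ne_top _ _) (sum_measure_le_measure_univ
      (fun p _ => ((mA _).inter (mC _)).nullMeasurableSet) ?_)
    rintro ⟨i, j⟩ - ⟨k, l⟩ - hne
    change (P.restrict G) ((A i ∩ C j) ∩ (A k ∩ C l)) = 0
    by_cases hik : i = k
    · have hjl : j ≠ l := fun h => hne (by rw [hik, h])
      exact Measure.absolutelyContinuous_of_le Measure.restrict_le_self
        (measure_mono_null (by intro x hx; exact ⟨hx.1.2, hx.2.2⟩) (hC hjl))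
    · have := (hA.pairwise_disjoint hik)
      have he : (A i ∩ C j) ∩ (A k ∩ C l) = ∅ := by
        ext x
        simp only [mem_inter_iff, mem_empty_iff_false, iff_false]
        exact fun hx => Set.disjoint_left.1 this hx.1.1 hx.2.1
      rw [he, measure_empty]
  have hlaw' : ∀ S, MeasurableSet S → P (V' ⁻¹' S) = P (V ⁻¹' S) := fun S hS => by
    rw [← Measure.map_apply hV' hS, hlaw, Measure.map_apply hV hS]
  have hs1 := hsum B mB fun j k hjk => by
    beta_reduce
    rw [(hB.pairwise_disjoint hjk).inter_eq, measure_empty]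
  have hs2 := hsum (fun j => V' ⁻¹' B' j) mC fun j k hjk => by
    beta_reduce
    rw [← preimage_inter, hlaw' _ ((hB' j).inter (hB' k)), preimage_inter, hBB', hBB',
      (hB.pairwise_disjoint hjk).inter_eq, measure_empty]
  have hterm : ∀ i j, |P.real (A i ∩ B j) - P.real (A i) * P.real (B j)| ≤
      P.real (A i ∩ B j ∩ G) + P.real (A i ∩ V' ⁻¹' B' j ∩ G) := by
    intro i j
    have h1 : P.real (A i) * P.real (B j) = P.real (A i ∩ V' ⁻¹' B' j) := by
      have h2 := hind.measure_inter_preimage_eq_mul _ _ (hA' i) (hB' j)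
      rw [hAA', hlaw' _ (hB' j), hBB'] at h2
      rw [measureReal_def, measureReal_def, measureReal_def, h2, ENNReal.toReal_mul]
    -- the parts of the two cells outside `G` coincide and cancel
    have h3 : (A i ∩ B j) \ G = (A i ∩ V' ⁻¹' B' j) \ G := by
      ext ω
      simp only [Set.mem_sdiff, mem_inter_iff, ← hBB' j, mem_preimage]
      constructor <;> rintro ⟨⟨h, h'⟩, hg⟩ <;> refine ⟨⟨h, ?_⟩, hg⟩
      · rwa [← heq ω hg]
      · rwa [heq ω hg]
    have h4 := measureReal_inter_add_sdiff (μ := P) (s := (A i ∩ B j)) hG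
    have h5 := measureReal_inter_add_sdiff (μ := P) (s := (A i ∩ V' ⁻¹' B' j)) hG
    rw [h1, ← h4, ← h5, h3, add_sub_add_right_eq_sub]
    refine (abs_sub _ _).trans ?_
    rw [abs_of_nonneg measureReal_nonneg, abs_of_nonneg measureReal_nonneg]
  calc _ ≤ 1 / 2 * ∑ i, ∑ j, (P.real (A i ∩ B j ∩ G) + P.real (A i ∩ V' ⁻¹' B' j ∩ G)) := by
        gcongr with i _ j _; exact hterm i j
    _ = 1 / 2 * (∑ i, ∑ j, P.real (A i ∩ B j ∩ G) +
          ∑ i, ∑ j, P.real (A i ∩ V' ⁻¹' B' j ∩ G)) := by simp only [Finset.sum_add_distrib]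
    _ ≤ P.real G := by linarith

lemma betaCoeff_le {Ω : Type*} {𝒜 ℬ : MeasurableSpace Ω} [MeasurableSpace Ω] {P : Measure Ω}
    {r : ℝ} (hr : 0 ≤ r)
    (h : ∀ (I J : ℕ) (A : Fin I → Set Ω) (B : Fin J → Set Ω), IsFinitePartition 𝒜 A →
      IsFinitePartition ℬ B →
      1 / 2 * ∑ i, ∑ j, |P.real (A i ∩ B j) - P.real (A i) * P.real (B j)| ≤ r) :
    betaCoeff P 𝒜 ℬ ≤ r := by
  refine Real.sSup_le ?_ hr
  rintro _ ⟨I, J, A, B, hA, hB, rfl⟩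
  exact h I J A B hA hB

lemma isFinitePartition_compl {Ω : Type*} {𝒜 : MeasurableSpace Ω} {A : Set Ω}
    (hA : MeasurableSet[𝒜] A) : IsFinitePartition 𝒜 ![A, Aᶜ] where
  measurableSet i := by fin_cases i; exacts [hA, hA.compl]
  pairwise_disjoint i j hij := by
    fin_cases i <;> fin_cases j <;> simp_all [disjoint_compl_right, disjoint_compl_left]
  iUnion_eq := by
    ext x
    simp only [mem_iUnion, mem_univ, iff_true]
    by_cases hx : x ∈ A
    exacts [⟨0, hx⟩, ⟨1, hx⟩]

/-- The partitions `{A, Aᶜ}` and `{B, Bᶜ}` show `α ≤ β`. The bound `r` makes the supremum that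
defines `betaCoeff` a genuine one. -/
lemma alphaCoeff_le_betaCoeff {Ω : Type*} {𝒜 ℬ : MeasurableSpace Ω} [mΩ : MeasurableSpace Ω]
    {P : Measure Ω} [IsProbabilityMeasure P] {r : ℝ} (h𝒜 : 𝒜 ≤ mΩ) (hℬ : ℬ ≤ mΩ)
    (h : ∀ (I J : ℕ) (A : Fin I → Set Ω) (B : Fin J → Set Ω), IsFinitePartition 𝒜 A →
      IsFinitePartition ℬ B →
      1 / 2 * ∑ i, ∑ j, |P.real (A i ∩ B j) - P.real (A i) * P.real (B j)| ≤ r) :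
    alphaCoeff P 𝒜 ℬ ≤ betaCoeff P 𝒜 ℬ := by
  refine csSup_le ⟨_, ∅, ∅, @MeasurableSet.empty _ 𝒜, @MeasurableSet.empty _ ℬ, rfl⟩ ?_
  rintro _ ⟨A, B, hA, hB, rfl⟩
  have hbdd : BddAbove {r : ℝ | ∃ (I J : ℕ) (A : Fin I → Set Ω) (B : Fin J → Set Ω),
      IsFinitePartition 𝒜 A ∧ IsFinitePartition ℬ B ∧
      r = 1 / 2 * ∑ i, ∑ j, |P.real (A i ∩ B j) - P.real (A i) * P.real (B j)|} := by
    refine ⟨r, ?_⟩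
    rintro _ ⟨I, J, A, B, hA, hB, rfl⟩
    exact h I J A B hA hB
  refine le_trans ?_ (le_csSup hbdd ⟨2, 2, _, _, isFinitePartition_compl hA,
    isFinitePartition_compl hB, rfl⟩)
  have mA := h𝒜 _ hA
  have mB := hℬ _ hB
  -- the four cells of the two partitions carry the same absolute deviation
  have e1 := measureReal_inter_add_sdiff (μ := P) (s := A) mB
  have e2 := measureReal_inter_add_sdiff (μ := P) (s := Aᶜ) mB
  have e3 := measureReal_inter_add_sdiff (μ := P) (s := B) mA
  have e4 := probReal_compl_eq_one_sub (μ := P) mA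
  have e5 := probReal_compl_eq_one_sub (μ := P) mB
  simp only [sdiff_eq] at e1 e2 e3
  rw [inter_comm B A, inter_comm B Aᶜ] at e3
  simp only [Fin.sum_univ_two, Matrix.cons_val_zero, Matrix.cons_val_one]
  set p := P.real (A ∩ B)
  have f1 : P.real (A ∩ Bᶜ) - P.real A * P.real Bᶜ = -(p - P.real A * P.real B) := by
    rw [e5]; linarith
  have f2 : P.real (Aᶜ ∩ B) - P.real Aᶜ * P.real B = -(p - P.real A * P.real B) := by
    rw [e4]; linarith
  have f3 : P.real (Aᶜ ∩ Bᶜ) - P.real Aᶜ * P.real Bᶜ = p - P.real A * P.real B := by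
    have : P.real (Aᶜ ∩ Bᶜ) = 1 - P.real A - P.real B + p := by linarith
    rw [e4, e5, this]; ring
  rw [f1, f2, f3, abs_neg]
  have := abs_nonneg (p - P.real A * P.real B)
  linarith

lemma stateLaw_ne_zero (ε : unitInterval) : stateLaw ε {s | s ≠ 0} = ENNReal.ofReal ε := by
  have h0 := ε.2.1
  simp only [stateLaw, Measure.add_apply, Measure.smul_apply, smul_eq_mul]
  rw [Measure.dirac_apply' _ .of_discrete, Measure.dirac_apply' _ .of_discrete,
    Measure.dirac_apply' _ .of_discrete]
  simp only [indicator, mem_ofPred_eq, ne_eq, not_true_eq_false, if_false, mul_zero, zero_add]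
  rw [if_pos (by decide), if_pos (by decide)]
  simp only [Pi.one_apply, mul_one]
  rw [← ENNReal.ofReal_add (by linarith) (by linarith)]
  simp

/-- For one component, the initial state, the auxiliary state and the forward noise are independent. -/
lemma measurePreserving_forward (θ ε : ℕ → unitInterval) (j : ℕ) :
    MeasurePreserving (fun ω : PathSpace => (ω.1.1 j, ω.2.1 j, ω.2.2 j)) (pathLaw θ ε)
      ((stateLaw (ε j)).prod ((stateLaw (ε j)).prod
        (Measure.infinitePi fun _ : ℕ => noiseLaw (θ j) (ε j)))) :=
  ((measurePreserving_eval_infinitePi (fun j => stateLaw (ε j)) j).comp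
    measurePreserving_fst).prod
    ((measurePreserving_eval_infinitePi (fun j => stateLaw (ε j)) j).prod
      (measurePreserving_eval_infinitePi
        (fun j => Measure.infinitePi fun _ : ℕ => noiseLaw (θ j) (ε j)) j))

/-- Trajectories driven by the same noise coalesce at the first resampling. -/
lemma run_eq_of_exists_false {w : ℕ → Noise} {n : ℕ} (h : ∃ i < n, (w i).1 = false)
    (s t : SignType) : run s w n = run t w n := by
  induction n with
  | zero => obtain ⟨i, hi, _⟩ := h; omega
  | succ n ih =>
    by_cases hn : (w n).1
    · obtain ⟨i, hi, hw⟩ := h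
      have : i ≠ n := by rintro rfl; simp [hn] at hw
      rw [run, run, ih ⟨i, by omega, hw⟩]
    · simp [run, step, hn]

/-- For the trajectories of the initial and of the auxiliary state to differ at time `n`, one of
these states has to be nonzero and no resampling may have occurred. -/
lemma measure_run_ne_le (θ ε : ℕ → unitInterval) (j n : ℕ) :
    pathLaw θ ε {ω | run (ω.1.1 j) (ω.2.2 j) n ≠ run (ω.2.1 j) (ω.2.2 j) n} ≤
      ENNReal.ofReal (2 * ε j * (θ j : ℝ) ^ n) := by
  set S : Set (ℕ → Noise) := (Finset.range n : Set ℕ).pi fun _ => {m : Noise | m.1 = true} with hS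
  have hSm : MeasurableSet S := .pi (Finset.countable_toSet _) fun _ _ => .of_discrete
  have hc : noiseLaw (θ j) (ε j) {m : Noise | m.1 = true} = ENNReal.ofReal (θ j) := by
    have : {m : Noise | m.1 = true} = {true} ×ˢ univ := by ext ⟨a, b⟩; simp
    rw [this, noiseLaw, Measure.prod_prod]
    simp [coinLaw]
  have hSP : (Measure.infinitePi fun _ : ℕ => noiseLaw (θ j) (ε j)) S =
      ENNReal.ofReal ((θ j : ℝ) ^ n) := by
    rw [hS, Measure.infinitePi_pi _ (fun _ _ => .of_discrete)]
    simp only [hc, Finset.prod_const, Finset.card_range]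
    rw [ENNReal.ofReal_pow (θ j).2.1]
  have hsub : {ω : PathSpace | run (ω.1.1 j) (ω.2.2 j) n ≠ run (ω.2.1 j) (ω.2.2 j) n} ⊆
      (fun ω : PathSpace => (ω.1.1 j, ω.2.1 j, ω.2.2 j)) ⁻¹'
        ({s | s ≠ 0} ×ˢ (univ ×ˢ S) ∪ univ ×ˢ ({s | s ≠ 0} ×ˢ S)) := by
    intro ω hω
    have h1 : ω.2.2 j ∈ S := by
      intro i hi
      by_contra hcon
      exact hω (run_eq_of_exists_false ⟨i, by simpa using hi, by simpa using hcon⟩ _ _)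
    by_cases h2 : ω.1.1 j = 0
    · by_cases h3 : ω.2.1 j = 0
      · exact absurd (by rw [h2, h3]) hω
      · exact Or.inr ⟨trivial, h3, h1⟩
    · exact Or.inl ⟨h2, trivial, h1⟩
  refine (measure_mono hsub).trans ?_
  rw [(measurePreserving_forward θ ε j).measure_preimage
    (((MeasurableSet.of_discrete).prod (MeasurableSet.univ.prod hSm)).union
      (MeasurableSet.univ.prod ((MeasurableSet.of_discrete).prod hSm))).nullMeasurableSet]
  refine (measure_union_le _ _).trans ?_
  simp only [Measure.prod_prod, measure_univ, one_mul, stateLaw_ne_zero, hSP]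
  have h0 := (ε j).2.1
  have h1 := pow_nonneg (θ j).2.1 n
  rw [← ENNReal.ofReal_mul h0, ← ENNReal.ofReal_add (by positivity) (by positivity)]
  exact ENNReal.ofReal_le_ofReal (by linarith)

lemma run_eq_of_eq {w : ℕ → Noise} {n : ℕ} {s t : SignType} (h : run s w n = run t w n) (k : ℕ) :
    run s w (k + n) = run t w (k + n) := by
  induction k with
  | zero => simpa using h
  | succ k ih => rw [Nat.add_right_comm, run, run, ih]

/-- The mixing bound: the chain forgets its past as soon as every component that was nonzero has
been resampled. -/
lemma sum_partition_proc_le (θ ε : ℕ → unitInterval) (a : ℕ → ℝ) {n : ℕ} {r : ℝ}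
    (hr : ∀ N, ∑ j ∈ Finset.range N, 2 * ε j * (θ j : ℝ) ^ n ≤ r)
    (I J : ℕ) (A : Fin I → Set PathSpace) (B : Fin J → Set PathSpace)
    (hA : IsFinitePartition (pastSigma (proc a) 0) A)
    (hB : IsFinitePartition (futureSigma (proc a) n) B) :
    1 / 2 * ∑ i, ∑ j, |(pathLaw θ ε).real (A i ∩ B j) -
      (pathLaw θ ε).real (A i) * (pathLaw θ ε).real (B j)| ≤ r := by
  have hr0 : 0 ≤ r := by simpa using hr 0
  -- `G` is the event that the forward motions from the initial and from the auxiliary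
  -- configuration have not yet coalesced at time `n`
  set G : Set PathSpace :=
    ⋃ j, {ω | run (ω.1.1 j) (ω.2.2 j) n ≠ run (ω.2.1 j) (ω.2.2 j) n} with hGdef
  have hmr : ∀ j k, Measurable fun ω : PathSpace => run (ω.1.1 j) (ω.2.2 j) k := fun j k =>
    (measurable_pi_apply k).comp (measurable_run.comp
      (f := fun ω : PathSpace => (ω.1.1 j, ω.2.2 j)) (by fun_prop))
  have hmr' : ∀ j k, Measurable fun ω : PathSpace => run (ω.2.1 j) (ω.2.2 j) k := fun j k =>
    (measurable_pi_apply k).comp (measurable_run.comp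
      (f := fun ω : PathSpace => (ω.2.1 j, ω.2.2 j)) (by fun_prop))
  have hG : MeasurableSet G := MeasurableSet.iUnion fun j =>
    (measurableSet_eq_fun (hmr j n) (hmr' j n)).compl
  have hPG : (pathLaw θ ε).real G ≤ r := by
    refine ENNReal.toReal_le_of_le_ofReal hr0 ((measure_iUnion_le _).trans ?_)
    refine ENNReal.tsum_le_of_sum_range_le fun N => ?_
    refine (Finset.sum_le_sum fun j _ => measure_run_ne_le θ ε j n).trans ?_
    rw [← ENNReal.ofReal_sum_of_nonneg]
    · exact ENNReal.ofReal_le_ofReal (hr N)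
    · intro j _
      have h0 := (ε j).2.1
      have h1 := pow_nonneg (θ j).2.1 n
      positivity
  set V : PathSpace → ℕ → ℝ := fun ω k => oneSided a ω.1.1 ω.2.2 (k + n)
  set V' : PathSpace → ℕ → ℝ := fun ω k => oneSided a ω.2.1 ω.2.2 (k + n)
  have hsh : Measurable fun (u : ℕ → ℝ) k => u (k + n) := by fun_prop
  have hV' : Measurable V' := hsh.comp ((measurable_oneSided a).comp measurable_snd)
  have hV : Measurable V := hsh.comp ((measurable_oneSided a).comp
    (f := fun ω : PathSpace => (ω.1.1, ω.2.2)) (by fun_prop))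
  refine le_trans (sum_abs_sub_le_of_coupling (U := Prod.fst) (V := V) (V' := V')
    measurable_fst hV hV' ?_ ?_ ?_ ?_ hG ?_ hA hB) hPG
  · refine iSup₂_le fun k hk => ?_
    obtain ⟨i, rfl⟩ : ∃ i : ℕ, k = -(i : ℤ) := ⟨k.natAbs, by omega⟩
    have : proc a (-(i : ℤ)) = (fun p : Config × NoiseField => oneSided a p.1 p.2 i) ∘ Prod.fst :=
      funext fun ω => proc_neg_natCast a i ω
    rw [this, ← MeasurableSpace.comap_comp]
    exact MeasurableSpace.comap_mono
      ((measurable_pi_apply i).comp (measurable_oneSided a)).comap_le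
  · refine iSup₂_le fun k hk => ?_
    obtain ⟨i, rfl⟩ : ∃ i : ℕ, k = ((i + n : ℕ) : ℤ) := ⟨(k - n).toNat, by push_cast; omega⟩
    have : proc a ((i + n : ℕ) : ℤ) = (fun u : ℕ → ℝ => u i) ∘ V :=
      funext fun ω => proc_natCast a (i + n) ω
    rw [this, ← MeasurableSpace.comap_comp]
    exact MeasurableSpace.comap_mono (measurable_pi_apply i).comap_le
  · have h1 : IndepFun (Prod.fst : PathSpace → _) Prod.snd (pathLaw θ ε) :=
      indepFun_prod (X := id) (Y := id) measurable_id measurable_id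
    exact h1.comp measurable_id (hsh.comp (measurable_oneSided a))
  · conv_lhs => rw [← (measurePreserving_swapConfig θ ε).map_eq]
    rw [Measure.map_map hV' (measurePreserving_swapConfig θ ε).measurable]
    rfl
  · intro ω hω
    simp only [hGdef, mem_iUnion, mem_ofPred_eq, not_exists, not_not] at hω
    funext k
    exact congrArg (weigh a) (funext fun j => run_eq_of_eq (hω j) k)

lemma mixing_proc (θ ε : ℕ → unitInterval) (a : ℕ → ℝ) {n : ℕ} {r : ℝ}
    (hr : ∀ N, ∑ j ∈ Finset.range N, 2 * ε j * (θ j : ℝ) ^ n ≤ r) :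
    alphaMix (pathLaw θ ε) (proc a) n ≤ betaMix (pathLaw θ ε) (proc a) n ∧
      betaMix (pathLaw θ ε) (proc a) n ≤ r :=
  ⟨alphaCoeff_le_betaCoeff (iSup₂_le fun k _ => (measurable_proc a k).comap_le)
    (iSup₂_le fun k _ => (measurable_proc a k).comap_le) (sum_partition_proc_le θ ε a hr),
    betaCoeff_le (by simpa using hr 0) (sum_partition_proc_le θ ε a hr)⟩

/-! ### Markov property, irreducibility and aperiodicity -/

lemma abs_signCast_le (s : SignType) : |(s : ℝ)| ≤ 1 := by
  rcases s.trichotomy with h | h | h <;> simp [h]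

lemma one_le_abs_signCast {s : SignType} (h : s ≠ 0) : 1 ≤ |(s : ℝ)| := by
  rcases s.trichotomy with h' | h' | h' <;> simp_all

lemma one_le_abs_signCast_sub {s t : SignType} (h : s ≠ t) : 1 ≤ |(s : ℝ) - t| := by
  rcases s.trichotomy with h' | h' | h' <;> rcases t.trichotomy with h'' | h'' | h'' <;>
    simp_all <;> norm_num

/-- Weights that start at or above `1` and grow at least by the factor `5`. -/
structure FastWeights (a : ℕ → ℝ) : Prop where
  one_le : 1 ≤ a 0
  five_mul_le : ∀ j, 5 * a j ≤ a (j + 1)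

namespace FastWeights

variable {a : ℕ → ℝ}

lemma one_le' (ha : FastWeights a) (j : ℕ) : 1 ≤ a j := by
  induction j with
  | zero => exact ha.one_le
  | succ j ih => linarith [ha.five_mul_le j]

lemma pos (ha : FastWeights a) (j : ℕ) : 0 < a j := by linarith [ha.one_le' j]

lemma four_mul_sum_le (ha : FastWeights a) (j : ℕ) : 4 * ∑ i ∈ Finset.range j, a i ≤ a j := by
  induction j with
  | zero => simpa using (ha.pos 0).le
  | succ j ih => rw [Finset.sum_range_succ]; linarith [ha.five_mul_le j]

end FastWeights

/-- A configuration with finitely many nonzero states. -/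
def FinSupp (y : Config) : Prop := ∃ N, ∀ j ≥ N, y j = 0

variable {a : ℕ → ℝ}

lemma weigh_eq_sum {y : Config} {N : ℕ} (hy : ∀ j ≥ N, y j = 0) :
    weigh a y = ∑ j ∈ Finset.range N, a j * (y j : ℝ) := by
  refine tsum_eq_sum fun j hj => ?_
  rw [hy j (by simpa using hj)]; simp

/-- The value `0` is the default value of a divergent series here. -/
lemma weigh_of_not_finSupp (ha : FastWeights a) {y : Config} (hy : ¬ FinSupp y) :
    weigh a y = 0 := by
  refine tsum_eq_zero_of_not_summable fun hs => hy ?_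
  have h := (hs.tendsto_atTop_zero.abs).eventually (gt_mem_nhds (by simp : |(0 : ℝ)| < 1))
  obtain ⟨N, hN⟩ := eventually_atTop.1 h
  refine ⟨N, fun j hj => ?_⟩
  by_contra hne
  have h1 := hN j hj
  rw [abs_mul, abs_of_pos (ha.pos j)] at h1
  nlinarith [ha.one_le' j, one_le_abs_signCast hne]

/-- The highest place at which two configurations differ contributes at least its weight to the
difference of the weighted sums, more than all lower places together. -/
lemma eq_of_sum_eq (ha : FastWeights a) {y z : Config} (N : ℕ)
    (h : ∑ j ∈ Finset.range N, a j * (y j : ℝ) = ∑ j ∈ Finset.range N, a j * (z j : ℝ)) :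
    ∀ j < N, y j = z j := by
  induction N with
  | zero => intro j hj; omega
  | succ N ih =>
    have hN : y N = z N := by
      by_contra hne
      rw [Finset.sum_range_succ, Finset.sum_range_succ] at h
      have h1 : a N * ((y N : ℝ) - z N) = ∑ j ∈ Finset.range N, a j * ((z j : ℝ) - y j) := by
        simp only [mul_sub, Finset.sum_sub_distrib]; linarith
      have h2 : |∑ j ∈ Finset.range N, a j * ((z j : ℝ) - y j)| ≤
          ∑ j ∈ Finset.range N, a j * 2 := by
        refine (Finset.abs_sum_le_sum_abs _ _).trans (Finset.sum_le_sum fun j _ => ?_)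
        rw [abs_mul, abs_of_pos (ha.pos j)]
        have := abs_sub (z j : ℝ) (y j)
        have := abs_signCast_le (z j)
        have := abs_signCast_le (y j)
        exact mul_le_mul_of_nonneg_left (by linarith) (ha.pos j).le
      rw [← h1, abs_mul, abs_of_pos (ha.pos N), ← Finset.sum_mul] at h2
      have := ha.four_mul_sum_le N
      nlinarith [ha.pos N, one_le_abs_signCast_sub hne]
    intro j hj
    rcases Nat.lt_succ_iff_lt_or_eq.1 hj with h' | h'
    · refine ih ?_ j h'
      rw [Finset.sum_range_succ, Finset.sum_range_succ, hN] at h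
      linarith
    · rw [h', hN]

/-- Finitely supported configurations are determined by their weighted sums. -/
lemma eq_of_weigh_eq (ha : FastWeights a) {y z : Config} (hy : FinSupp y) (hz : FinSupp z)
    (h : weigh a y = weigh a z) : y = z := by
  obtain ⟨N, hN⟩ := hy
  obtain ⟨M, hM⟩ := hz
  have hN' : ∀ j ≥ max N M, y j = 0 := fun j hj => hN j (le_trans (le_max_left _ _) hj)
  have hM' : ∀ j ≥ max N M, z j = 0 := fun j hj => hM j (le_trans (le_max_right _ _) hj)
  rw [weigh_eq_sum hN', weigh_eq_sum hM'] at h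
  funext j
  by_cases hj : j < max N M
  · exact eq_of_sum_eq ha _ h j hj
  · rw [hN' j (by omega), hM' j (by omega)]

/-- The top weight of a configuration dominates its weighted sum. -/
lemma abs_weigh_le (ha : FastWeights a) {y : Config} {N : ℕ} (hy : ∀ j ≥ N + 1, y j = 0) :
    |weigh a y| ≤ 2 * a N := by
  rw [weigh_eq_sum hy]
  have h1 : |∑ j ∈ Finset.range (N + 1), a j * (y j : ℝ)| ≤ ∑ j ∈ Finset.range (N + 1), a j := by
    refine (Finset.abs_sum_le_sum_abs _ _).trans (Finset.sum_le_sum fun j _ => ?_)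
    rw [abs_mul, abs_of_pos (ha.pos j)]
    exact mul_le_of_le_one_right (ha.pos j).le (abs_signCast_le _)
  have := ha.four_mul_sum_le (N + 1)
  rw [Finset.sum_range_succ a] at h1
  linarith [ha.four_mul_sum_le N, ha.pos N]

/-- The state space of the process: the weighted sums of finitely supported configurations. -/
def stateSpace (a : ℕ → ℝ) : Set ℝ := range fun y : ℕ →₀ SignType => weigh a y

lemma finSupp_finsupp (y : ℕ →₀ SignType) : FinSupp y :=
  ⟨y.support.sup id + 1, fun j hj => by
    by_contra hne
    have := Finset.le_sup (f := id) (Finsupp.mem_support_iff.2 hne)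
    simp only [id] at this
    omega⟩

lemma FinSupp.exists_finsupp {y : Config} (hy : FinSupp y) : ∃ z : ℕ →₀ SignType, ⇑z = y := by
  obtain ⟨N, hN⟩ := hy
  refine ⟨Finsupp.ofSupportFinite y ((Finset.range N).finite_toSet.subset fun j hj => ?_), rfl⟩
  simp only [Finset.coe_range, mem_Iio]
  by_contra hcon
  exact hj (hN j (by omega))

lemma weigh_mem_stateSpace (ha : FastWeights a) (y : Config) : weigh a y ∈ stateSpace a := by
  by_cases hy : FinSupp y
  · obtain ⟨z, rfl⟩ := hy.exists_finsupp
    exact ⟨z, rfl⟩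
  · rw [weigh_of_not_finSupp ha hy]
    exact ⟨0, by simp [weigh]⟩

lemma countable_stateSpace (a : ℕ → ℝ) : (stateSpace a).Countable := countable_range _

variable {θ ε : ℕ → unitInterval}

/-- By the Borel–Cantelli lemma, almost surely only finitely many components are nonzero. -/
lemma ae_finSupp (hε : Summable fun j => (ε j : ℝ)) (k : ℤ) :
    ∀ᵐ ω ∂(pathLaw θ ε), FinSupp fun j => comp j k ω := by
  have h : ∀ j, pathLaw θ ε {ω | comp j k ω ≠ 0} = ENNReal.ofReal (ε j) := fun j => by
    rw [← stateLaw_ne_zero, ← pathLaw_map_comp θ ε j k,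
      Measure.map_apply (measurable_comp j k) .of_discrete]
    rfl
  have h2 := ae_eventually_notMem (μ := pathLaw θ ε) (s := fun j => {ω | comp j k ω ≠ 0})
    (by simp only [h]; rw [← ENNReal.ofReal_tsum_of_nonneg (fun j => (ε j).2.1) hε]
        exact ENNReal.ofReal_ne_top)
  filter_upwards [h2] with ω hω
  obtain ⟨N, hN⟩ := eventually_atTop.1 hω
  exact ⟨N, fun j hj => by simpa using hN j hj⟩

lemma proc_zero (a : ℕ → ℝ) (ω : PathSpace) : proc a 0 ω = weigh a ω.1.1 := by
  simpa [oneSided, run] using proc_natCast a 0 ω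

lemma ae_finSupp_zero (hε : Summable fun j => (ε j : ℝ)) :
    ∀ᵐ ω ∂(pathLaw θ ε), FinSupp ω.1.1 :=
  (ae_finSupp hε 0).mono fun ω hω => by simpa [comp, twoSided, compData, glue, run] using hω

lemma ae_proc_zero_eq_iff (ha : FastWeights a) (hε : Summable fun j => (ε j : ℝ))
    {y : Config} (hy : FinSupp y) :
    ∀ᵐ ω ∂(pathLaw θ ε), (proc a 0 ω = weigh a y ↔ ω.1.1 = y) := by
  filter_upwards [ae_finSupp_zero hε] with ω hω
  rw [proc_zero]
  exact ⟨fun h => eq_of_weigh_eq ha hω hy h, fun h => by rw [h]⟩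

/-- Given the configuration at time `0`, past and future are independent. -/
lemma measure_past_future (ha : FastWeights a) (hε : Summable fun j => (ε j : ℝ))
    {y : Config} (hy : FinSupp y) (F B : Set (ℕ → ℝ)) :
    pathLaw θ ε {ω | proc a 0 ω = weigh a y ∧ (fun k : ℕ => proc a k ω) ∈ F ∧
      (fun k : ℕ => proc a (-k) ω) ∈ B} =
    configLaw ε {y} * fieldLaw θ ε {w | oneSided a y w ∈ F} *
      fieldLaw θ ε {w | oneSided a y w ∈ B} := by
  have h1 : {ω | proc a 0 ω = weigh a y ∧ (fun k : ℕ => proc a k ω) ∈ F ∧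
      (fun k : ℕ => proc a (-k) ω) ∈ B} =ᵐ[pathLaw θ ε]
      ({y} ×ˢ {w | oneSided a y w ∈ B}) ×ˢ (univ ×ˢ {w | oneSided a y w ∈ F}) := by
    filter_upwards [ae_proc_zero_eq_iff ha hε hy] with ω hω
    simp only [eq_iff_iff]
    change (proc a 0 ω = weigh a y ∧ (fun k : ℕ => proc a k ω) ∈ F ∧
      (fun k : ℕ => proc a (-k) ω) ∈ B) ↔ (ω.1.1 = y ∧ oneSided a y ω.1.2 ∈ B) ∧
        True ∧ oneSided a y ω.2.2 ∈ F
    rw [hω]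
    simp only [proc_natCast, proc_neg_natCast]
    constructor
    · rintro ⟨h, h2, h3⟩; subst h; exact ⟨⟨rfl, h3⟩, trivial, h2⟩
    · rintro ⟨⟨h, h3⟩, _, h2⟩; subst h; exact ⟨rfl, h2, h3⟩
  rw [measure_congr h1, pathLaw, Measure.prod_prod, Measure.prod_prod, Measure.prod_prod,
    measure_univ, one_mul]
  ring

/-- Reflection of time at any point preserves the law of the process. -/
lemma map_proc_sub (θ ε : ℕ → unitInterval) (a : ℕ → ℝ) (n : ℤ) :
    (pathLaw θ ε).map (fun ω (k : ℤ) => proc a (n - k) ω) =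
      (pathLaw θ ε).map (fun ω (k : ℤ) => proc a k ω) := by
  have hneg : Measurable fun (x : ℤ → ℝ) (k : ℤ) => x (-k) := by fun_prop
  have hm : ∀ m : ℤ, Measurable fun ω (k : ℤ) => proc a (k + m) ω := fun m =>
    measurable_pi_lambda _ fun k => measurable_proc a _
  have h := congrArg (fun Q => Q.map fun (x : ℤ → ℝ) (k : ℤ) => x (-k))
    (isStrictlyStationary_proc θ ε a n)
  rw [Measure.map_map hneg (hm n), Measure.map_map hneg (by simpa using hm 0)] at h
  have h2 := isTimeReversible_proc θ ε a
  unfold IsTimeReversible at h2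
  simp only [Function.comp_def] at h
  rw [← h2, ← h]
  congr 1
  funext ω k
  congr 1
  ring

/-- Reflecting time turns the history into an event of the future of time `0`, and the next state
into the value at time `-1`. The value at time `0` determines the configuration, given which future
and past are independent. -/
lemma isCountableMarkovChain_proc (ha : FastWeights a) (hε : Summable fun j => (ε j : ℝ)) :
    IsCountableMarkovChain (pathLaw θ ε) (proc a) (stateSpace a) where
  measurable := measurable_proc a
  countable := countable_stateSpace a
  mem_state k ω := weigh_mem_stateSpace ha _
  markov n m s t hA := by
    set P := pathLaw θ ε
    have hm : ∀ n : ℤ, Measurable fun ω (k : ℤ) => proc a (n - k) ω := fun n =>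
      measurable_pi_lambda _ fun k => measurable_proc a _
    have hm0 : Measurable fun ω (k : ℤ) => proc a k ω :=
      measurable_pi_lambda _ fun k => measurable_proc a _
    have htr : ∀ D : Set (ℤ → ℝ), MeasurableSet D →
        P ((fun ω (k : ℤ) => proc a (n - k) ω) ⁻¹' D) =
          P ((fun ω (k : ℤ) => proc a k ω) ⁻¹' D) := fun D hD => by
      rw [← Measure.map_apply (hm n) hD, map_proc_sub, Measure.map_apply hm0 hD]
    have hD1 : MeasurableSet {x : ℤ → ℝ | ∀ i : ℕ, i ≤ m → x i = s i} := by
      have : {x : ℤ → ℝ | ∀ i : ℕ, i ≤ m → x i = s i} =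
          ⋂ i : ℕ, ⋂ _ : i ≤ m, {x : ℤ → ℝ | x i = s i} := by ext; simp
      rw [this]
      exact .iInter fun i => .iInter fun _ => measurableSet_eq_fun (by fun_prop) (by fun_prop)
    have hD2 : MeasurableSet {x : ℤ → ℝ | x (-1) = t} :=
      measurableSet_eq_fun (by fun_prop) (by fun_prop)
    have hD3 : MeasurableSet {x : ℤ → ℝ | x 0 = s 0} :=
      measurableSet_eq_fun (by fun_prop) (by fun_prop)
    have e1 := htr _ hD1
    have e2 := htr _ (hD1.inter hD2)
    have e3 := htr _ hD3
    have e4 := htr _ (hD3.inter hD2)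
    simp only [preimage_inter, preimage_ofPred_eq, sub_zero, sub_neg_eq_add] at e1 e2 e3 e4
    have hA' := hA
    rw [e1] at hA'
    -- as the history has positive probability, `s 0` is the value of a configuration with finitely
    -- many nonzero states
    obtain ⟨ω₀, hω₀, hfin⟩ : ∃ ω₀, (∀ i : ℕ, i ≤ m → proc a i ω₀ = s i) ∧ FinSupp ω₀.1.1 := by
      by_contra hcon
      push Not at hcon
      refine hA' (measure_mono_null (t := {ω | ¬ FinSupp ω.1.1}) (fun ω hω => hcon ω hω) ?_)
      exact ae_iff.1 (ae_finSupp_zero hε)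
    set y := ω₀.1.1 with hy
    have hs0 : s 0 = weigh a y := by rw [← hω₀ 0 (Nat.zero_le _), Nat.cast_zero, proc_zero]
    set F : Set (ℕ → ℝ) := {u | ∀ i : ℕ, i ≤ m → u i = s i} with hFdef
    set B : Set (ℕ → ℝ) := {u | u 1 = t} with hBdef
    have g1 : {ω | ∀ i : ℕ, i ≤ m → proc a i ω = s i} = {ω | proc a 0 ω = weigh a y ∧
        (fun k : ℕ => proc a k ω) ∈ F ∧ (fun k : ℕ => proc a (-k) ω) ∈ univ} := by
      ext ω
      simp only [mem_ofPred_eq, hFdef, mem_univ, and_true]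
      exact ⟨fun h => ⟨by rw [← hs0]; exact_mod_cast h 0 (Nat.zero_le _), h⟩, fun h => h.2⟩
    have g2 : {ω | ∀ i : ℕ, i ≤ m → proc a i ω = s i} ∩ {ω | proc a (-1) ω = t} =
        {ω | proc a 0 ω = weigh a y ∧
        (fun k : ℕ => proc a k ω) ∈ F ∧ (fun k : ℕ => proc a (-k) ω) ∈ B} := by
      rw [g1]
      ext ω
      simp [hBdef, and_assoc]
    have g3 : {ω | proc a 0 ω = s 0} = {ω | proc a 0 ω = weigh a y ∧
        (fun k : ℕ => proc a k ω) ∈ univ ∧ (fun k : ℕ => proc a (-k) ω) ∈ univ} := by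
      ext ω; simp [hs0]
    have g4 : {ω | proc a 0 ω = s 0} ∩ {ω | proc a (-1) ω = t} = {ω | proc a 0 ω = weigh a y ∧
        (fun k : ℕ => proc a k ω) ∈ univ ∧ (fun k : ℕ => proc a (-k) ω) ∈ B} := by
      ext ω; simp [hs0, hBdef]
    rw [g1, measure_past_future ha hε hfin] at e1
    rw [g2, measure_past_future ha hε hfin] at e2
    rw [g3, measure_past_future ha hε hfin] at e3
    rw [g4, measure_past_future ha hε hfin] at e4
    simp only [mem_univ, ofPred_true, measure_univ, mul_one] at e1 e2 e3 e4
    have mA : MeasurableSet {ω | ∀ i : ℕ, i ≤ m → proc a (n - i) ω = s i} := hm n hD1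
    have mC : MeasurableSet {ω | proc a n ω = s 0} := by
      simpa only [preimage_ofPred_eq, sub_zero] using hm n hD3
    rw [cond_apply mA, cond_apply mC, e1, e2, e3, e4]
    rw [e1] at hA
    set p := configLaw ε {y}
    set α := fieldLaw θ ε {w | oneSided a y w ∈ F}
    set β := fieldLaw θ ε {w | oneSided a y w ∈ B}
    have hp : p ≠ 0 := left_ne_zero_of_mul hA
    rw [← mul_assoc, ENNReal.inv_mul_cancel hA (by finiteness), ← mul_assoc,
      ENNReal.inv_mul_cancel hp (by finiteness)]

lemma one_sub_sum_le_prod (p : ℕ → ℝ) (s : Finset ℕ) (h0 : ∀ i, 0 ≤ p i) (h1 : ∀ i, p i ≤ 1) :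
    1 - ∑ i ∈ s, (1 - p i) ≤ ∏ i ∈ s, p i := by
  induction s using Finset.cons_induction with
  | empty => simp
  | cons i s hi ih =>
    rw [Finset.sum_cons, Finset.prod_cons]
    have : ∏ i ∈ s, p i ≤ 1 := Finset.prod_le_one (fun i _ => h0 i) fun i _ => h1 i
    nlinarith [mul_nonneg (sub_nonneg.2 (h1 i)) (sub_nonneg.2 this)]

/-- A countable product set has positive measure if its sides have positive measures with
summable defects. -/
lemma infinitePi_univ_pi_pos {α : ℕ → Type*} [∀ i, MeasurableSpace (α i)]
    (μ : ∀ i, Measure (α i)) [∀ i, IsProbabilityMeasure (μ i)] {t : ∀ i, Set (α i)}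
    (ht : ∀ i, MeasurableSet (t i)) (hpos : ∀ i, 0 < (μ i).real (t i))
    (hsum : Summable fun i => 1 - (μ i).real (t i)) : 0 < Measure.infinitePi μ (univ.pi t) := by
  set p : ℕ → ℝ := fun i => (μ i).real (t i)
  have hp1 : ∀ i, p i ≤ 1 := fun i => measureReal_le_one
  -- the sides from `N` on have a total defect below `1 / 2`
  obtain ⟨N, hN⟩ := (tendsto_order.1 (tendsto_sum_nat_add fun i => 1 - p i)).2 (1 / 2)
    (by norm_num) |>.exists
  have hlow : ∀ M, (∏ i ∈ Finset.range N, p i) * (1 / 2) ≤ ∏ i ∈ Finset.range (N + M), p i := by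
    intro M
    rw [Finset.prod_range_add]
    refine mul_le_mul_of_nonneg_left ?_ (Finset.prod_nonneg fun i _ => (hpos i).le)
    refine le_trans ?_ (one_sub_sum_le_prod (fun i => p (N + i)) _ (fun i => (hpos _).le)
      fun i => hp1 _)
    have : ∑ i ∈ Finset.range M, (1 - p (N + i)) ≤ ∑' k, (1 - p (k + N)) := by
      simp only [add_comm N]
      exact ((summable_nat_add_iff N).2 hsum).sum_le_tsum _ fun i _ => sub_nonneg.2 (hp1 _)
    linarith
  have htend : Tendsto (fun M => Measure.infinitePi μ ((Finset.range (N + M) : Set ℕ).pi t))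
      atTop (𝓝 (Measure.infinitePi μ (univ.pi t))) := by
    have he : univ.pi t = ⋂ M, (Finset.range (N + M) : Set ℕ).pi t := by
      ext x
      simp only [Set.mem_pi, mem_univ, forall_const, mem_iInter, Finset.mem_coe, Finset.mem_range]
      exact ⟨fun h _ i _ => h i, fun h i => h (i + 1) i (by omega)⟩
    rw [he]
    refine tendsto_measure_iInter_atTop (fun M => (MeasurableSet.pi (Finset.countable_toSet _)
      fun i _ => ht i).nullMeasurableSet) ?_ ⟨0, measure_ne_top _ _⟩
    intro M M' hM x hx i hi
    exact hx i (by simp only [Finset.mem_coe, Finset.mem_range] at hi ⊢; omega)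
  have hlow' : ∀ M, ENNReal.ofReal ((∏ i ∈ Finset.range N, p i) * (1 / 2)) ≤
      Measure.infinitePi μ ((Finset.range (N + M) : Set ℕ).pi t) := by
    intro M
    rw [Measure.infinitePi_pi _ fun i _ => ht i]
    refine (ENNReal.ofReal_le_ofReal (hlow M)).trans_eq ?_
    rw [ENNReal.ofReal_prod_of_nonneg fun i _ => (hpos i).le]
    exact Finset.prod_congr rfl fun i _ => ofReal_measureReal
  refine lt_of_lt_of_le ?_ (ge_of_tendsto' htend hlow')
  rw [ENNReal.ofReal_pos]
  have := Finset.prod_pos (s := Finset.range N) fun i _ => hpos i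
  positivity

lemma stateLaw_zero (ε : unitInterval) : (stateLaw ε).real {0} = 1 - ε := by
  have h : ({0} : Set SignType) = {s | s ≠ 0}ᶜ := by ext; simp
  rw [h, probReal_compl_eq_one_sub .of_discrete, measureReal_def, stateLaw_ne_zero,
    ENNReal.toReal_ofReal ε.2.1]

lemma stateLaw_pos {ε : unitInterval} (h0 : 0 < (ε : ℝ)) (h1 : (ε : ℝ) < 1) (s : SignType) :
    0 < (stateLaw ε).real {s} := by
  rw [measureReal_def, ENNReal.toReal_pos_iff]
  refine ⟨?_, measure_lt_top _ _⟩
  have e0 : 0 < ENNReal.ofReal (1 - ε) := ENNReal.ofReal_pos.2 (by linarith)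
  have e1 : 0 < ENNReal.ofReal (ε / 2) := ENNReal.ofReal_pos.2 (by linarith)
  simp only [stateLaw, Measure.add_apply, Measure.smul_apply, smul_eq_mul,
    Measure.dirac_apply' _ (MeasurableSet.of_discrete : MeasurableSet {s})]
  rcases s.trichotomy with h | h | h <;> subst h <;> simp [indicator, e0, e1]

/-- Any state can be reached from any other in one step: each component can be resampled to the
required state, and for all but finitely many components, which have to move from `0` to `0`, the
probability of failure is summable. -/
lemma transProb_proc_pos (ha : FastWeights a) (hε : Summable fun j => (ε j : ℝ))
    (hε0 : ∀ j, 0 < (ε j : ℝ)) (hε1 : ∀ j, (ε j : ℝ) < 1) (hθ : ∀ j, (θ j : ℝ) < 1)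
    {s t : ℝ} (hs : s ∈ stateSpace a) (ht : t ∈ stateSpace a) :
    0 < transProb (pathLaw θ ε) (proc a) 1 s t := by
  obtain ⟨y, rfl⟩ := hs
  obtain ⟨z, rfl⟩ := ht
  have hy := finSupp_finsupp y
  have hz := finSupp_finsupp z
  have mC : MeasurableSet {ω | proc a 0 ω = weigh a y} :=
    measurableSet_eq_fun (measurable_proc a 0) measurable_const
  have e : {ω | proc a 0 ω = weigh a y} ∩ {ω | proc a (1 : ℕ) ω = weigh a z} =
      {ω | proc a 0 ω = weigh a y ∧ (fun k : ℕ => proc a k ω) ∈ {u : ℕ → ℝ | u 1 = weigh a z} ∧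
        (fun k : ℕ => proc a (-k) ω) ∈ univ} := by
    ext ω; simp
  rw [transProb, cond_apply mC, e, measure_past_future ha hε hy]
  simp only [mem_univ, ofPred_true, measure_univ, mul_one]
  refine ENNReal.mul_pos (ENNReal.inv_ne_zero.2 (measure_ne_top _ _)) (mul_ne_zero ?_ ?_)
  · rw [← univ_pi_singleton, configLaw]
    refine (infinitePi_univ_pi_pos _ (fun j => measurableSet_singleton _)
      (fun j => stateLaw_pos (hε0 j) (hε1 j) _) ?_).ne'
    obtain ⟨N, hN⟩ := hy
    refine (summable_nat_add_iff N).1 (((summable_nat_add_iff N).2 hε).congr fun j => ?_)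
    rw [hN (j + N) (by omega), stateLaw_zero]; ring
  · set T : ∀ j : ℕ, Set (ℕ → Noise) := fun j => (fun u => step (y j) (u 0)) ⁻¹' {z j} with hT
    have hTm : ∀ j, MeasurableSet (T j) := fun j =>
      ((Measurable.of_discrete : Measurable fun n : Noise => step (y j) n).comp
        (measurable_pi_apply 0)) (measurableSet_singleton _)
    have hTP : ∀ j, (Measure.infinitePi fun _ : ℕ => noiseLaw (θ j) (ε j)).real (T j) =
        (noiseLaw (θ j) (ε j)).real {n | step (y j) n = z j} := fun j => by
      rw [measureReal_def, measureReal_def]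
      congr 1
      exact (measurePreserving_eval_infinitePi (fun _ : ℕ => noiseLaw (θ j) (ε j)) 0).measure_preimage
        (MeasurableSet.of_discrete : MeasurableSet {n | step (y j) n = z j}).nullMeasurableSet
    have hrect : ∀ (j : ℕ) (A : Set Bool) (B : Set SignType),
        (noiseLaw (θ j) (ε j)).real (A ×ˢ B) = (coinLaw (θ j)).real A * (stateLaw (ε j)).real B :=
      fun j A B => by
        rw [measureReal_def, noiseLaw, Measure.prod_prod, ENNReal.toReal_mul]; rfl
    have hsub : univ.pi T ⊆ {w | oneSided a y w ∈ {u : ℕ → ℝ | u 1 = weigh a z}} := by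
      intro w hw
      exact congrArg (weigh a) (funext fun j => hw j trivial)
    refine (lt_of_lt_of_le (infinitePi_univ_pi_pos _ hTm (fun j => ?_) ?_)
      (measure_mono hsub)).ne'
    · rw [hTP]
      refine lt_of_lt_of_le ?_ (measureReal_mono (s₁ := {false} ×ˢ {z j}) ?_)
      · rw [hrect]
        refine mul_pos ?_ (stateLaw_pos (hε0 j) (hε1 j) _)
        have : (coinLaw (θ j)) {false} = ENNReal.ofReal (1 - θ j) := by simp [coinLaw]
        rw [measureReal_def, this, ENNReal.toReal_ofReal (by linarith [hθ j])]
        linarith [hθ j]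
      · rintro ⟨b, v⟩ ⟨hb, hv⟩
        simp only [mem_singleton_iff] at hb hv
        simp [step, hb, hv]
    · obtain ⟨N, hN⟩ := hy
      obtain ⟨M, hM⟩ := hz
      refine (summable_nat_add_iff (N + M)).1 (Summable.of_nonneg_of_le
        (fun j => sub_nonneg.2 measureReal_le_one) (fun j => ?_)
        ((summable_nat_add_iff (N + M)).2 hε))
      rw [hTP, hN _ (by omega), hM _ (by omega)]
      have hmono : (noiseLaw (θ (j + (N + M))) (ε (j + (N + M)))).real (univ ×ˢ {0}) ≤
          (noiseLaw (θ (j + (N + M))) (ε (j + (N + M)))).real {n | step 0 n = 0} := by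
        refine measureReal_mono ?_
        rintro ⟨b, v⟩ ⟨_, hv⟩
        simp only [mem_singleton_iff] at hv
        simp [step, hv]
      rw [hrect, probReal_univ, one_mul, stateLaw_zero] at hmono
      linarith

lemma isIrreducibleOn_proc (ha : FastWeights a) (hε : Summable fun j => (ε j : ℝ))
    (hε0 : ∀ j, 0 < (ε j : ℝ)) (hε1 : ∀ j, (ε j : ℝ) < 1) (hθ : ∀ j, (θ j : ℝ) < 1) :
    IsIrreducibleOn (pathLaw θ ε) (proc a) (stateSpace a) := fun _ hs _ ht =>
  ⟨1, le_rfl, transProb_proc_pos ha hε hε0 hε1 hθ hs ht⟩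

lemma isAperiodicOn_proc (ha : FastWeights a) (hε : Summable fun j => (ε j : ℝ))
    (hε0 : ∀ j, 0 < (ε j : ℝ)) (hε1 : ∀ j, (ε j : ℝ) < 1) (hθ : ∀ j, (θ j : ℝ) < 1) :
    IsAperiodicOn (pathLaw θ ε) (proc a) (stateSpace a) := fun _ hs _ hd =>
  Nat.dvd_one.1 (hd 1 le_rfl (transProb_proc_pos ha hε hε0 hε1 hθ hs hs))

/-! ### The transfer operator of a component chain -/

/-- The mean of a function on `{0, 1, -1}` under the symmetric law with mass `ε` off the origin. -/
def avg {E : Type*} [AddCommGroup E] [Module ℝ E] (ε : ℝ) (u : SignType → E) : E :=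
  (1 - ε) • u 0 + ((ε / 2) • u 1 + (ε / 2) • u (-1))

/-- The character `s ↦ exp (i τ s)`. -/
def char (τ : ℝ) (s : SignType) : ℂ := Complex.exp ((τ * (s : ℝ) : ℝ) * Complex.I)

/-- The transition operator of a component chain, twisted by the character `char τ`: the state is
kept with probability `θ` and averaged out otherwise. -/
def transfer (θ ε τ : ℝ) (v : SignType → ℂ) (s : SignType) : ℂ :=
  θ • (char τ s * v s) + (1 - θ) • avg ε fun t => char τ t * v t

/-- The characteristic function at `τ` of the sum of `n` successive states of a component chain. -/
def compChar (θ ε : ℝ) (n : ℕ) (τ : ℝ) : ℂ := avg ε ((transfer θ ε τ)^[n] fun _ => 1)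

@[simp] lemma norm_char (τ : ℝ) (s : SignType) : ‖char τ s‖ = 1 := Complex.norm_exp_ofReal_mul_I _

@[simp] lemma char_zero (τ : ℝ) : char τ 0 = 1 := by simp [char]

lemma norm_char_sub_one_le (τ : ℝ) (s : SignType) : ‖char τ s - 1‖ ≤ |τ| := by
  have h := Real.norm_exp_I_mul_ofReal_sub_one_le (x := τ * (s : ℝ))
  rw [mul_comm Complex.I] at h
  refine h.trans ?_
  rw [Real.norm_eq_abs, abs_mul]
  exact mul_le_of_le_one_right (abs_nonneg _) (abs_signCast_le s)

section

variable {θ ε : ℝ}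

lemma avg_mono (hε0 : 0 ≤ ε) (hε1 : ε ≤ 1) {u v : SignType → ℝ} (h : ∀ s, u s ≤ v s) :
    avg ε u ≤ avg ε v := by
  simp only [avg, smul_eq_mul]
  have h0 : (0 : ℝ) ≤ 1 - ε := by linarith
  have := mul_le_mul_of_nonneg_left (h 0) h0
  have := mul_le_mul_of_nonneg_left (h 1) (by linarith : (0 : ℝ) ≤ ε / 2)
  have := mul_le_mul_of_nonneg_left (h (-1)) (by linarith : (0 : ℝ) ≤ ε / 2)
  linarith

lemma norm_avg_le (hε0 : 0 ≤ ε) (hε1 : ε ≤ 1) (u : SignType → ℂ) :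
    ‖avg ε u‖ ≤ avg ε fun s => ‖u s‖ := by
  simp only [avg]
  have h0 : (0 : ℝ) ≤ 1 - ε := by linarith
  refine (norm_add_le _ _).trans (add_le_add ?_ ((norm_add_le _ _).trans (add_le_add ?_ ?_)))
  · rw [norm_smul, Real.norm_of_nonneg h0, smul_eq_mul]
  · rw [norm_smul, Real.norm_of_nonneg (by linarith), smul_eq_mul]
  · rw [norm_smul, Real.norm_of_nonneg (by linarith), smul_eq_mul]

lemma avg_sub {E : Type*} [AddCommGroup E] [Module ℝ E] (u v : SignType → E) :
    avg ε (fun s => u s - v s) = avg ε u - avg ε v := by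
  simp only [avg, smul_sub]; abel

lemma avg_add {E : Type*} [AddCommGroup E] [Module ℝ E] (u v : SignType → E) :
    avg ε (fun s => u s + v s) = avg ε u + avg ε v := by
  simp only [avg, smul_add]; abel

lemma avg_const {E : Type*} [AddCommGroup E] [Module ℝ E] (c : E) :
    avg ε (fun _ => c) = c := by
  simp only [avg, ← add_smul]
  rw [show 1 - ε + (ε / 2 + ε / 2) = 1 by ring, one_smul]

lemma avg_const_mul (c : ℂ) (u : SignType → ℂ) : avg ε (fun s => c * u s) = c * avg ε u := by
  simp only [avg, mul_add, mul_smul_comm]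

lemma avg_const_mul' (c : ℝ) (u : SignType → ℝ) : avg ε (fun s => c * u s) = c * avg ε u := by
  simp only [avg, smul_eq_mul]; ring

lemma transfer_sub (τ : ℝ) (u v : SignType → ℂ) :
    transfer θ ε τ (u - v) = transfer θ ε τ u - transfer θ ε τ v := by
  funext s
  simp only [transfer, Pi.sub_apply, mul_sub, avg_sub, smul_sub]
  abel

lemma transfer_const_mul (τ : ℝ) (c : ℂ) (v : SignType → ℂ) :
    transfer θ ε τ (fun s => c * v s) = fun s => c * transfer θ ε τ v s := by
  funext s
  have h : (fun t => char τ t * (c * v t)) = fun t => c * (char τ t * v t) := by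
    funext t; ring
  simp only [transfer, h, avg_const_mul, mul_add, Complex.real_smul]
  ring

/-- By stationarity, the transfer operator is a contraction of `L¹`. -/
lemma avg_norm_transfer_le (hθ0 : 0 ≤ θ) (hθ1 : θ ≤ 1) (hε0 : 0 ≤ ε) (hε1 : ε ≤ 1) (τ : ℝ)
    (v : SignType → ℂ) : avg ε (fun s => ‖transfer θ ε τ v s‖) ≤ avg ε fun s => ‖v s‖ := by
  have h1 : ∀ s, ‖transfer θ ε τ v s‖ ≤ θ * ‖v s‖ + (1 - θ) * avg ε fun s => ‖v s‖ := by
    intro s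
    refine (norm_add_le _ _).trans (add_le_add ?_ ?_)
    · rw [norm_smul, Real.norm_of_nonneg hθ0, norm_mul, norm_char, one_mul]
    · rw [norm_smul, Real.norm_of_nonneg (by linarith)]
      refine mul_le_mul_of_nonneg_left ((norm_avg_le hε0 hε1 _).trans ?_) (by linarith)
      simp
  refine (avg_mono hε0 hε1 h1).trans ?_
  rw [avg_add, avg_const_mul', avg_const]
  linarith

lemma avg_norm_iterate_transfer_le (hθ0 : 0 ≤ θ) (hθ1 : θ ≤ 1) (hε0 : 0 ≤ ε) (hε1 : ε ≤ 1)
    (τ : ℝ) (n : ℕ) (v : SignType → ℂ) :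
    avg ε (fun s => ‖(transfer θ ε τ)^[n] v s‖) ≤ avg ε fun s => ‖v s‖ := by
  induction n with
  | zero => simp
  | succ n ih =>
    simp only [Function.iterate_succ_apply']
    exact (avg_norm_transfer_le hθ0 hθ1 hε0 hε1 τ _).trans ih

lemma iterate_transfer_sub (τ : ℝ) (n : ℕ) (u v : SignType → ℂ) :
    (transfer θ ε τ)^[n] (u - v) = (transfer θ ε τ)^[n] u - (transfer θ ε τ)^[n] v := by
  induction n with
  | zero => rfl
  | succ n ih => simp only [Function.iterate_succ_apply', ih, transfer_sub]

/-- An approximate eigenvector of the transfer operator controls its powers. -/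
lemma avg_norm_iterate_sub_le (hθ0 : 0 ≤ θ) (hθ1 : θ ≤ 1) (hε0 : 0 ≤ ε) (hε1 : ε ≤ 1)
    (τ : ℝ) {ρ : ℂ} (hρ : ‖ρ‖ ≤ 1) {v : SignType → ℂ} {δ : ℝ}
    (hv : avg ε (fun s => ‖transfer θ ε τ v s - ρ * v s‖) ≤ δ) (n : ℕ) :
    avg ε (fun s => ‖(transfer θ ε τ)^[n] v s - ρ ^ n * v s‖) ≤ n * δ := by
  induction n with
  | zero => simp [avg]
  | succ n ih =>
    have h1 : ∀ s, ‖(transfer θ ε τ)^[n + 1] v s - ρ ^ (n + 1) * v s‖ ≤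
        ‖transfer θ ε τ (fun s => (transfer θ ε τ)^[n] v s - ρ ^ n * v s) s‖ +
          ‖transfer θ ε τ v s - ρ * v s‖ := by
      intro s
      have h2 : (fun s => (transfer θ ε τ)^[n] v s - ρ ^ n * v s) =
          (transfer θ ε τ)^[n] v - fun s => ρ ^ n * v s := rfl
      have h3 : (transfer θ ε τ)^[n + 1] v s - ρ ^ (n + 1) * v s =
          transfer θ ε τ (fun s => (transfer θ ε τ)^[n] v s - ρ ^ n * v s) s +
            ρ ^ n * (transfer θ ε τ v s - ρ * v s) := by
        rw [h2, transfer_sub, transfer_const_mul, Function.iterate_succ_apply']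
        simp only [Pi.sub_apply]
        ring
      rw [h3]
      refine (norm_add_le _ _).trans (add_le_add le_rfl ?_)
      rw [norm_mul, norm_pow]
      exact mul_le_of_le_one_left (norm_nonneg _) (pow_le_one₀ (norm_nonneg _) hρ)
    refine (avg_mono hε0 hε1 h1).trans ?_
    rw [avg_add]
    have h4 := avg_norm_transfer_le hθ0 hθ1 hε0 hε1 τ
      (fun s => (transfer θ ε τ)^[n] v s - ρ ^ n * v s)
    push_cast
    linarith

/-- The crude bound: the sum vanishes unless some state is nonzero. -/
lemma norm_compChar_sub_one_le (hθ0 : 0 ≤ θ) (hθ1 : θ ≤ 1) (hε0 : 0 ≤ ε) (hε1 : ε ≤ 1)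
    (n : ℕ) (τ : ℝ) : ‖compChar θ ε n τ - 1‖ ≤ n * (ε * |τ|) := by
  have h0 : avg ε (fun s => ‖char τ s - 1‖) ≤ ε * |τ| := by
    simp only [avg, char_zero, sub_self, norm_zero, smul_eq_mul]
    have := mul_le_mul_of_nonneg_left (norm_char_sub_one_le τ 1) (by linarith : (0 : ℝ) ≤ ε / 2)
    have := mul_le_mul_of_nonneg_left (norm_char_sub_one_le τ (-1))
      (by linarith : (0 : ℝ) ≤ ε / 2)
    linarith
  have h1 : avg ε (fun s => ‖transfer θ ε τ (fun _ => 1) s - 1 * 1‖) ≤ ε * |τ| := by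
    have h2 : ∀ s, ‖transfer θ ε τ (fun _ => 1) s - 1 * 1‖ ≤
        θ * ‖char τ s - 1‖ + (1 - θ) * avg ε fun s => ‖char τ s - 1‖ := by
      intro s
      have h3 : transfer θ ε τ (fun _ => 1) s - 1 * 1 =
          θ • (char τ s - 1) + (1 - θ) • avg ε (fun s => char τ s - 1) := by
        rw [avg_sub, avg_const]
        simp only [transfer, mul_one, smul_sub, Complex.real_smul]
        push_cast
        ring
      rw [h3]
      refine (norm_add_le _ _).trans (add_le_add ?_ ?_)
      · rw [norm_smul, Real.norm_of_nonneg hθ0]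
      · rw [norm_smul, Real.norm_of_nonneg (by linarith)]
        exact mul_le_mul_of_nonneg_left (norm_avg_le hε0 hε1 _) (by linarith)
    refine (avg_mono hε0 hε1 h2).trans ?_
    rw [avg_add, avg_const_mul', avg_const]
    linarith
  have h2 := avg_norm_iterate_sub_le hθ0 hθ1 hε0 hε1 τ (ρ := 1) (by simp) h1 n
  have h3 : compChar θ ε n τ - 1 =
      avg ε fun s => (transfer θ ε τ)^[n] (fun _ => 1) s - 1 ^ n * 1 := by
    rw [avg_sub, one_pow, one_mul, avg_const]; rfl
  rw [h3]
  exact (norm_avg_le hε0 hε1 _).trans h2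

/-- `1 - E cos (τ G)` for a geometric variable `G` with success probability `1 - θ`. -/
def geomDefect (θ τ : ℝ) : ℝ :=
  (1 + θ) * (1 - Real.cos τ) / ((1 - θ) ^ 2 + 2 * θ * (1 - Real.cos τ))

lemma geomDefect_nonneg (hθ0 : 0 ≤ θ) (τ : ℝ) : 0 ≤ geomDefect θ τ := by
  have := Real.cos_le_one τ
  exact div_nonneg (mul_nonneg (by linarith) (by linarith))
    (add_nonneg (sq_nonneg _) (mul_nonneg (by linarith) (by linarith)))

lemma geomDefect_le (hθ0 : 0 ≤ θ) (hθ1 : θ < 1) (τ : ℝ) :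
    geomDefect θ τ ≤ τ ^ 2 / (1 - θ) ^ 2 := by
  have h1 := Real.cos_le_one τ
  have h2 := Real.one_sub_sq_div_two_le_cos (x := τ)
  have h3 : (0 : ℝ) < (1 - θ) ^ 2 := by have : 0 < 1 - θ := by linarith
                                        positivity
  refine div_le_div₀ (sq_nonneg _) ?_ h3 ?_
  · nlinarith
  · nlinarith [mul_nonneg hθ0 (sub_nonneg.2 h1)]

lemma geomDefect_le_two (hθ0 : 0 ≤ θ) (hθ1 : θ < 1) (τ : ℝ) : geomDefect θ τ ≤ 2 := by
  have h1 := Real.cos_le_one τ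
  have h4 := Real.neg_one_le_cos τ
  have h3 : (0 : ℝ) < (1 - θ) ^ 2 := by have : 0 < 1 - θ := by linarith
                                        positivity
  rw [geomDefect, div_le_iff₀ (by nlinarith [mul_nonneg hθ0 (sub_nonneg.2 h1)])]
  nlinarith [mul_nonneg hθ0 (sub_nonneg.2 h1), sq_nonneg (1 - θ)]

/-- The components at `±1` of the approximate eigenvector: `E exp (i τ (G - 1))` for a geometric
variable `G`, written with `z = exp (± i τ)`. -/
def eigenComp (θ : ℝ) (z : ℂ) : ℂ := (1 - θ) / (1 - θ * z)

lemma le_norm_one_sub_mul (hθ0 : 0 ≤ θ) {z : ℂ} (hz : ‖z‖ = 1) : 1 - θ ≤ ‖1 - θ * z‖ := by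
  have h := norm_sub_norm_le (1 : ℂ) (θ * z)
  rwa [norm_one, norm_mul, hz, mul_one, Complex.norm_real, Real.norm_of_nonneg hθ0] at h

lemma one_sub_mul_ne_zero (hθ0 : 0 ≤ θ) (hθ1 : θ < 1) {z : ℂ} (hz : ‖z‖ = 1) :
    1 - θ * z ≠ 0 := by
  have := le_norm_one_sub_mul hθ0 hz
  exact norm_pos_iff.1 (by linarith)

lemma norm_eigenComp_sub_one_le (hθ0 : 0 ≤ θ) (hθ1 : θ < 1) {z : ℂ} (hz : ‖z‖ = 1) :
    ‖eigenComp θ z - 1‖ ≤ ‖z - 1‖ / (1 - θ) := by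
  have h1 := le_norm_one_sub_mul hθ0 hz
  have h2 := one_sub_mul_ne_zero hθ0 hθ1 hz
  have h3 : eigenComp θ z - 1 = θ * (z - 1) / (1 - θ * z) := by
    rw [eigenComp]; field_simp; ring
  rw [h3, norm_div, norm_mul, Complex.norm_real, Real.norm_of_nonneg hθ0]
  exact div_le_div₀ (norm_nonneg _) (mul_le_of_le_one_left (norm_nonneg _) hθ1.le)
    (by linarith) h1

lemma norm_eigenComp_sub_one_le_two (hθ0 : 0 ≤ θ) (hθ1 : θ < 1) {z : ℂ} (hz : ‖z‖ = 1) :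
    ‖eigenComp θ z - 1‖ ≤ 2 := by
  have h1 := le_norm_one_sub_mul hθ0 hz
  have h2 : ‖eigenComp θ z‖ ≤ 1 := by
    have h : ‖((1 - θ : ℝ) : ℂ)‖ = 1 - θ := by
      rw [Complex.norm_real, Real.norm_of_nonneg (by linarith)]
    rw [eigenComp, norm_div, ← Complex.ofReal_one, ← Complex.ofReal_sub, h]
    push_cast
    exact div_le_one_of_le₀ h1 (norm_nonneg _)
  refine (norm_sub_le _ _).trans ?_
  rw [norm_one]; linarith

/-- The values of `char τ · eigenComp θ (char τ ·)` at `±1` are `E exp (± i τ G)` for a geometric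
variable `G`; this is twice their mean. -/
lemma sum_eigenComp (hθ0 : 0 ≤ θ) (hθ1 : θ < 1) (τ : ℝ) :
    char τ 1 * eigenComp θ (char τ 1) + char τ (-1) * eigenComp θ (char τ (-1)) =
      ((2 * (1 - geomDefect θ τ) : ℝ) : ℂ) := by
  have n1 := one_sub_mul_ne_zero hθ0 hθ1 (norm_char τ 1)
  have n2 := one_sub_mul_ne_zero hθ0 hθ1 (norm_char τ (-1))
  have hprod : char τ 1 * char τ (-1) = 1 := by
    rw [char, char, ← Complex.exp_add]; simp
  have hsum : char τ 1 + char τ (-1) = 2 * (Real.cos τ : ℂ) := by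
    simp only [char, SignType.coe_one, SignType.coe_neg_one, mul_one, mul_neg]
    rw [Complex.ofReal_cos, Complex.cos]; push_cast; ring
  have hD : (1 - θ * char τ 1) * (1 - θ * char τ (-1)) =
      (((1 - θ) ^ 2 + 2 * θ * (1 - Real.cos τ) : ℝ) : ℂ) := by
    generalize Real.cos τ = c at hsum ⊢
    push_cast
    linear_combination (θ : ℂ) ^ 2 * hprod - (θ : ℂ) * hsum
  have hD0 : (((1 - θ) ^ 2 + 2 * θ * (1 - Real.cos τ) : ℝ) : ℂ) ≠ 0 := by
    rw [← hD]; exact mul_ne_zero n1 n2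
  have h1 : ((2 * (1 - geomDefect θ τ) : ℝ) : ℂ) = ((1 - θ) * (2 * (Real.cos τ : ℂ) - 2 * θ)) /
      (((1 - θ) ^ 2 + 2 * θ * (1 - Real.cos τ) : ℝ) : ℂ) := by
    rw [eq_div_iff hD0, ← Complex.ofReal_ofNat, ← Complex.ofReal_one]
    norm_cast at hD0 ⊢
    rw [geomDefect]
    field_simp
    ring
  rw [h1, ← hD, eq_div_iff (mul_ne_zero n1 n2)]
  have i1 : eigenComp θ (char τ 1) * (1 - θ * char τ 1) = 1 - θ := div_mul_cancel₀ _ n1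
  have i2 : eigenComp θ (char τ (-1)) * (1 - θ * char τ (-1)) = 1 - θ := div_mul_cancel₀ _ n2
  linear_combination char τ 1 * (1 - θ * char τ (-1)) * i1 +
    char τ (-1) * (1 - θ * char τ 1) * i2 + (1 - θ : ℂ) * hsum - 2 * θ * (1 - θ : ℂ) * hprod

/-- The characteristic function of the sum of `n` states is close to the `n`-th power of the
approximate leading eigenvalue `1 - (1 - θ) ε q` of the transfer operator, `q = geomDefect θ τ`.
The approximate eigenvector is `s ↦ eigenComp θ (char τ s)`. It solves
`θ χ v + (1 - θ) = v`, where `χ = char τ`, and `χ v` has the mean `1 - ε q`, so that the residual in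
the eigenvalue equation is `(1 - θ) ε q (v - 1)`. This is small in mean, as `v 0 = 1`. -/
lemma norm_compChar_sub_pow_le (hθ0 : 0 ≤ θ) (hθ1 : θ < 1) (hε0 : 0 ≤ ε) (hε1 : ε ≤ 1)
    (n : ℕ) (τ : ℝ) {d : ℝ} (hd : ∀ s, ‖eigenComp θ (char τ s) - 1‖ ≤ d) :
    ‖compChar θ ε n τ - ((1 - (1 - θ) * (ε * geomDefect θ τ) : ℝ) : ℂ) ^ n‖ ≤
      2 * (ε * d) + n * (ε * ((1 - θ) * (ε * geomDefect θ τ) * d)) := by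
  set q := geomDefect θ τ with hq
  have hq0 : 0 ≤ q := geomDefect_nonneg hθ0 τ
  have hq2 : q ≤ 2 := geomDefect_le_two hθ0 hθ1 τ
  set ρ : ℂ := ((1 - (1 - θ) * (ε * q) : ℝ) : ℂ) with hρdef
  have hx0 : 0 ≤ (1 - θ) * (ε * q) := mul_nonneg (by linarith) (mul_nonneg hε0 hq0)
  have hx2 : (1 - θ) * (ε * q) ≤ 2 := by
    have : ε * q ≤ 1 * 2 := mul_le_mul hε1 hq2 hq0 zero_le_one
    have : (1 - θ) * (ε * q) ≤ 1 * (ε * q) :=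
      mul_le_mul_of_nonneg_right (by linarith) (mul_nonneg hε0 hq0)
    linarith
  have hρ : ‖ρ‖ ≤ 1 := by
    rw [hρdef, Complex.norm_real, Real.norm_eq_abs, abs_le]
    constructor <;> linarith
  set v : SignType → ℂ := fun s => eigenComp θ (char τ s) with hv
  have hv0 : v 0 = 1 := by
    have : (1 - θ : ℂ) ≠ 0 := by
      have : (1 - θ : ℝ) ≠ 0 := by linarith
      exact_mod_cast this
    simp [hv, eigenComp, this]
  have hm : avg ε (fun t => char τ t * v t) = ((1 - ε * q : ℝ) : ℂ) := by
    have := sum_eigenComp hθ0 hθ1 τ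
    rw [avg, char_zero, hv0, ← smul_add, this]
    simp only [Complex.real_smul]
    push_cast
    ring
  have hres : ∀ s, transfer θ ε τ v s - ρ * v s =
      (((1 - θ) * (ε * q) : ℝ) : ℂ) * (v s - 1) := by
    intro s
    have h1 : (1 - θ : ℂ) = (1 - θ * char τ s) * v s := by
      simp only [hv, eigenComp]
      rw [mul_div_cancel₀ _ (one_sub_mul_ne_zero hθ0 hθ1 (norm_char τ s))]
    simp only [transfer, hm, Complex.real_smul, hρdef]
    push_cast
    linear_combination h1
  have hd0 : 0 ≤ d := (norm_nonneg _).trans (hd 0)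
  have hN : avg ε (fun s => ‖v s - 1‖) ≤ ε * d := by
    simp only [avg, hv0, sub_self, norm_zero, smul_eq_mul]
    have := mul_le_mul_of_nonneg_left (hd 1) (by linarith : (0 : ℝ) ≤ ε / 2)
    have := mul_le_mul_of_nonneg_left (hd (-1)) (by linarith : (0 : ℝ) ≤ ε / 2)
    linarith
  have hr : avg ε (fun s => ‖transfer θ ε τ v s - ρ * v s‖) ≤ ε * ((1 - θ) * (ε * q) * d) := by
    have : (fun s => ‖transfer θ ε τ v s - ρ * v s‖) =
        fun s => ((1 - θ) * (ε * q)) * ‖v s - 1‖ := by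
      funext s
      rw [hres, norm_mul, Complex.norm_real, Real.norm_of_nonneg hx0]
    rw [this, avg_const_mul']
    calc _ ≤ (1 - θ) * (ε * q) * (ε * d) := mul_le_mul_of_nonneg_left hN hx0
      _ = _ := by ring
  have h1 := avg_norm_iterate_sub_le hθ0 hθ1.le hε0 hε1 τ hρ hr n
  have h2 := avg_norm_iterate_transfer_le hθ0 hθ1.le hε0 hε1 τ n ((fun _ => 1) - v)
  have h2' : avg ε (fun s => ‖((fun _ => 1 : SignType → ℂ) - v) s‖) = avg ε (fun s => ‖v s - 1‖) := by
    congr 1; funext s; exact norm_sub_rev _ _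
  rw [h2', iterate_transfer_sub] at h2
  -- pass from `1` to the eigenvector `v`, apply the operator `n` times, and return to `1`
  have h3 : compChar θ ε n τ - ρ ^ n =
      avg ε ((transfer θ ε τ)^[n] (fun _ => 1) - (transfer θ ε τ)^[n] v) +
      avg ε (fun s => (transfer θ ε τ)^[n] v s - ρ ^ n * v s) +
      ρ ^ n * avg ε (fun s => v s - 1) := by
    have e1 : avg ε ((transfer θ ε τ)^[n] (fun _ => 1) - (transfer θ ε τ)^[n] v) = _ :=
      avg_sub ((transfer θ ε τ)^[n] (fun _ => 1)) ((transfer θ ε τ)^[n] v)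
    rw [e1, avg_sub, avg_sub, avg_const, avg_const_mul, compChar]
    ring
  rw [h3]
  have n1 := norm_avg_le hε0 hε1 ((transfer θ ε τ)^[n] (fun _ => 1) - (transfer θ ε τ)^[n] v)
  have n2 := norm_avg_le hε0 hε1 (fun s => (transfer θ ε τ)^[n] v s - ρ ^ n * v s)
  have n3 : ‖ρ ^ n * avg ε (fun s => v s - 1)‖ ≤ avg ε (fun s => ‖v s - 1‖) := by
    rw [norm_mul, norm_pow]
    exact (mul_le_of_le_one_left (norm_nonneg _) (pow_le_one₀ (norm_nonneg _) hρ)).trans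
      (norm_avg_le hε0 hε1 _)
  refine (norm_add₃_le).trans ?_
  linarith

end

/-! ### Characteristic functions of the partial sums -/

lemma integrable_smul_dirac {α : Type*} [MeasurableSpace α] [Finite α]
    [MeasurableSingletonClass α] (u : α → ℂ) (c : ℝ) (x : α) :
    Integrable u (ENNReal.ofReal c • Measure.dirac x) :=
  Integrable.of_finite.smul_measure ENNReal.ofReal_ne_top

lemma integral_stateLaw (ε : unitInterval) (u : SignType → ℂ) :
    ∫ s, u s ∂(stateLaw ε) = avg (ε : ℝ) u := by
  have h0 := ε.2.1
  have h1 := ε.2.2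
  rw [stateLaw, integral_add_measure (integrable_smul_dirac _ _ _)
    ((integrable_smul_dirac _ _ _).add_measure (integrable_smul_dirac _ _ _)),
    integral_add_measure (integrable_smul_dirac _ _ _) (integrable_smul_dirac _ _ _)]
  simp only [integral_smul_measure, integral_dirac]
  rw [ENNReal.toReal_ofReal (by linarith), ENNReal.toReal_ofReal (by linarith)]
  rfl

lemma integral_noiseLaw (θ ε : unitInterval) (u : SignType → ℂ) (s : SignType) :
    ∫ n, u (step s n) ∂(noiseLaw θ ε) = (θ : ℝ) • u s + (1 - θ : ℝ) • avg (ε : ℝ) u := by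
  have h0 := θ.2.1
  have h1 := θ.2.2
  rw [noiseLaw, integral_prod _ Integrable.of_finite, coinLaw, integral_add_measure
    (integrable_smul_dirac _ _ _) (integrable_smul_dirac _ _ _)]
  simp only [integral_smul_measure, integral_dirac, step, if_true, Bool.false_eq_true, if_false,
    integral_stateLaw, avg_const]
  rw [ENNReal.toReal_ofReal (by linarith), ENNReal.toReal_ofReal (by linarith)]

lemma integral_infinitePi_prepend {α : Type*} [MeasurableSpace α] (ν : Measure α)
    [IsProbabilityMeasure ν] {G : (ℕ → α) → ℂ} (hG : Measurable G) (hb : ∀ w, ‖G w‖ ≤ 1) :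
    ∫ w, G w ∂(Measure.infinitePi fun _ : ℕ => ν) =
      ∫ x, ∫ w, G (prepend x w) ∂(Measure.infinitePi fun _ : ℕ => ν) ∂ν := by
  conv_lhs => rw [← infinitePi_map_prepend ν]
  rw [integral_map measurable_prepend.aemeasurable hG.aestronglyMeasurable,
    integral_prod (fun p : α × (ℕ → α) => G (prepend p.1 p.2))]
  exact Integrable.of_bound (hG.comp measurable_prepend).aestronglyMeasurable 1
    (Eventually.of_forall fun p => hb _)

lemma measurable_sum_run (s : SignType) (n : ℕ) :
    Measurable fun w : ℕ → Noise => ∑ k ∈ Finset.range n, (run s w (k + 1) : ℝ) := by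
  refine Finset.measurable_fun_sum _ fun k _ => ?_
  exact (Measurable.of_discrete : Measurable fun s : SignType => (s : ℝ)).comp
    ((measurable_pi_apply (k + 1)).comp (measurable_run.comp measurable_prodMk_left))

/-- The powers of the transfer operator are the characteristic functions of the sums along
trajectories with a given initial state. -/
lemma integral_exp_sum_run (θ ε : unitInterval) (τ : ℝ) (n : ℕ) (s : SignType) :
    ∫ w, Complex.exp ((τ * ∑ k ∈ Finset.range n, (run s w (k + 1) : ℝ) : ℝ) * Complex.I)
      ∂(Measure.infinitePi fun _ : ℕ => noiseLaw θ ε) =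
        (transfer θ ε τ)^[n] (fun _ => 1) s := by
  induction n generalizing s with
  | zero => simp
  | succ n ih =>
    rw [integral_infinitePi_prepend]
    · have h : ∀ (x : Noise) (w : ℕ → Noise),
          Complex.exp ((τ * ∑ k ∈ Finset.range (n + 1), (run s (prepend x w) (k + 1) : ℝ) : ℝ) *
            Complex.I) = char τ (step s x) * Complex.exp ((τ * ∑ k ∈ Finset.range n,
              (run (step s x) w (k + 1) : ℝ) : ℝ) * Complex.I) := by
        intro x w
        rw [char, ← Complex.exp_add, run_prepend, Finset.sum_range_succ']
        congr 1
        simp only [prepend, run]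
        push_cast
        ring
      simp only [h, integral_const_mul, ih]
      rw [integral_noiseLaw θ ε (fun t => char τ t * (transfer θ ε τ)^[n] (fun _ => 1) t),
        Function.iterate_succ_apply']
      rfl
    · exact Complex.measurable_exp.comp ((Complex.measurable_ofReal.comp
        ((measurable_sum_run s (n + 1)).const_mul τ)).mul_const _)
    · intro w; exact (Complex.norm_exp_ofReal_mul_I _).le

/-- The contribution of the `j`-th component to the partial sum. -/
def compSum (a : ℕ → ℝ) (j n : ℕ) (ω : PathSpace) : ℝ :=
  ∑ k ∈ Finset.Icc 1 n, a j * (comp j k ω : ℝ)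

lemma compSum_eq (a : ℕ → ℝ) (j n : ℕ) (ω : PathSpace) :
    compSum a j n ω = a j * ∑ k ∈ Finset.range n, (run (ω.1.1 j) (ω.2.2 j) (k + 1) : ℝ) := by
  rw [compSum, ← Finset.mul_sum, Finset.range_eq_Ico, Finset.sum_Ico_add'
    (fun k => (run (ω.1.1 j) (ω.2.2 j) k : ℝ)) 0 n 1]
  congr 1

lemma measurable_compSum (a : ℕ → ℝ) (j n : ℕ) : Measurable (compSum a j n) :=
  Finset.measurable_fun_sum _ fun k _ =>
    (Measurable.of_discrete : Measurable fun s : SignType => a j * (s : ℝ)).comp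
      (measurable_comp j k)

variable {θ ε : ℕ → unitInterval} {a : ℕ → ℝ}

/-- Partial sums start at time `1`, hence exactly `n` applications of the transfer operator followed
by the mean over the initial state. -/
lemma charFun_compSum (θ ε : ℕ → unitInterval) (a : ℕ → ℝ) (j n : ℕ) (t : ℝ) :
    charFun ((pathLaw θ ε).map (compSum a j n)) t = compChar (θ j) (ε j) n (t * a j) := by
  rw [charFun_apply_real, integral_map (measurable_compSum a j n).aemeasurable
    (by fun_prop : Measurable fun x : ℝ => Complex.exp (t * x * Complex.I)).aestronglyMeasurable]
  have hmp := measurePreserving_forward θ ε j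
  set Nw := Measure.infinitePi fun _ : ℕ => noiseLaw (θ j) (ε j)
  have hp : MeasurePreserving (fun ω : PathSpace => (ω.1.1 j, ω.2.2 j)) (pathLaw θ ε)
      ((stateLaw (ε j)).prod Nw) :=
    ((MeasurePreserving.id (stateLaw (ε j))).prod
      (measurePreserving_snd (μ := stateLaw (ε j)) (ν := Nw))).comp hmp
  set G : SignType × (ℕ → Noise) → ℂ := fun p => Complex.exp ((t * a j *
    ∑ k ∈ Finset.range n, (run p.1 p.2 (k + 1) : ℝ) : ℝ) * Complex.I) with hG
  have hGm : Measurable G := by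
    refine Complex.measurable_exp.comp ((Complex.measurable_ofReal.comp
      (Measurable.const_mul (Finset.measurable_fun_sum _ fun k _ => ?_) _)).mul_const _)
    exact (Measurable.of_discrete : Measurable fun s : SignType => (s : ℝ)).comp
      ((measurable_pi_apply (k + 1)).comp measurable_run)
  have h1 : ∀ ω, Complex.exp (t * (compSum a j n ω) * Complex.I) =
      G (ω.1.1 j, ω.2.2 j) := by
    intro ω
    rw [compSum_eq, hG]
    push_cast
    ring_nf
  simp only [h1]
  rw [← integral_map (f := G) hp.measurable.aemeasurable hGm.aestronglyMeasurable, hp.map_eq,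
    integral_prod G (Integrable.of_bound hGm.aestronglyMeasurable 1
      (Eventually.of_forall fun p => (Complex.norm_exp_ofReal_mul_I _).le))]
  simp only [hG, Nw, integral_exp_sum_run, integral_stateLaw]
  rfl

lemma iIndepFun_compSum (θ ε : ℕ → unitInterval) (a : ℕ → ℝ) (n : ℕ) :
    iIndepFun (fun j => compSum a j n) (pathLaw θ ε) := by
  have h : iIndepFun (fun j => compData j) (pathLaw θ ε) := by
    rw [iIndepFun_iff_map_fun_eq_infinitePi_map measurable_compData, pathLaw_map_compData]
    congr 1
    funext j
    have h := congrArg (fun Q => Q.map fun z : ℕ → CompSpace => z j) (pathLaw_map_compData θ ε)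
    rw [Measure.map_map (measurable_pi_apply j) (measurable_pi_lambda _ measurable_compData)] at h
    rw [Measure.infinitePi_map_eval] at h
    exact h.symm
  refine h.comp (fun j z => ∑ k ∈ Finset.Icc 1 n, a j * (twoSided z k : ℝ)) fun j =>
    Finset.measurable_fun_sum _ fun k _ => ?_
  exact (Measurable.of_discrete : Measurable fun s : SignType => a j * (s : ℝ)).comp
      ((measurable_pi_apply _).comp measurable_twoSided)

lemma measurable_partialSum (a : ℕ → ℝ) (n : ℕ) : Measurable (partialSum (proc a) n) :=
  Finset.measurable_fun_sum _ fun k _ => measurable_proc a k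

lemma ae_tendsto_sum_compSum (hε : Summable fun j => (ε j : ℝ)) (n : ℕ) :
    ∀ᵐ ω ∂(pathLaw θ ε), Tendsto (fun m => ∑ j ∈ Finset.range m, compSum a j n ω) atTop
      (𝓝 (partialSum (proc a) n ω)) := by
  have h : ∀ᵐ ω ∂(pathLaw θ ε), ∀ k : ℤ, FinSupp fun j => comp j k ω :=
    ae_all_iff.2 fun k => ae_finSupp hε k
  filter_upwards [h] with ω hω
  have h1 : ∀ k ∈ Finset.Icc 1 n, Tendsto (fun m => ∑ j ∈ Finset.range m,
      a j * (comp j (k : ℕ) ω : ℝ)) atTop (𝓝 (proc a (k : ℕ) ω)) := by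
    intro k _
    obtain ⟨N, hN⟩ := hω k
    refine tendsto_const_nhds.congr' ?_
    filter_upwards [eventually_ge_atTop N] with m hm
    exact weigh_eq_sum fun j hj => hN j (hm.trans hj)
  refine (tendsto_finsetSum _ h1).congr fun m => ?_
  rw [Finset.sum_comm]
  rfl

/-- The characteristic function of a partial sum is the product of those of its components. -/
lemma tendsto_prod_compChar (hε : Summable fun j => (ε j : ℝ)) (n : ℕ) (t : ℝ) :
    Tendsto (fun m => ∏ j ∈ Finset.range m, compChar (θ j) (ε j) n (t * a j)) atTop
      (𝓝 (charFun ((pathLaw θ ε).map (partialSum (proc a) n)) t)) := by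
  have hexp : Measurable fun x : ℝ => Complex.exp (t * x * Complex.I) := by fun_prop
  have h1 : ∀ m, ∏ j ∈ Finset.range m, compChar (θ j) (ε j) n (t * a j) =
      ∫ ω, Complex.exp (t * (∑ j ∈ Finset.range m, compSum a j n ω : ℝ) * Complex.I)
        ∂(pathLaw θ ε) := by
    intro m
    have hm : Measurable fun ω => ∑ j ∈ Finset.range m, compSum a j n ω :=
      Finset.measurable_fun_sum _ fun j _ => measurable_compSum a j n
    have h2 := congrFun (iIndepFun.charFun_map_fun_finsetSum_eq_prod (s := Finset.range m)
      (fun j _ => (measurable_compSum a j n).aemeasurable)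
      ((iIndepFun_compSum θ ε a n).restrict _)) t
    rw [Finset.prod_apply] at h2
    simp only [charFun_compSum] at h2
    rw [← h2, charFun_apply_real, integral_map hm.aemeasurable hexp.aestronglyMeasurable]
  simp only [h1]
  rw [charFun_apply_real, integral_map (measurable_partialSum a n).aemeasurable
    hexp.aestronglyMeasurable]
  refine tendsto_integral_of_dominated_convergence (fun _ => 1) (fun m => ?_)
    (integrable_const _) (fun m => Eventually.of_forall fun ω => ?_) ?_
  · exact (hexp.comp (Finset.measurable_fun_sum _ fun j _ =>
      measurable_compSum a j n)).aestronglyMeasurable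
  · rw [← Complex.ofReal_mul, Complex.norm_exp_ofReal_mul_I]
  · filter_upwards [ae_tendsto_sum_compSum (a := a) hε n] with ω hω
    have hc : Continuous fun x : ℝ => Complex.exp (t * x * Complex.I) := by fun_prop
    exact (hc.tendsto _).comp hω

lemma norm_compChar_le_one (θ ε : unitInterval) (n : ℕ) (τ : ℝ) : ‖compChar θ ε n τ‖ ≤ 1 := by
  have h := avg_norm_iterate_transfer_le θ.2.1 θ.2.2 ε.2.1 ε.2.2 τ n fun _ => 1
  rw [norm_one, avg_const] at h
  exact (norm_avg_le ε.2.1 ε.2.2 _).trans h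

/-- By independence, any single component bounds the characteristic function of the partial sum. -/
lemma norm_charFun_partialSum_le (hε : Summable fun j => (ε j : ℝ)) (i n : ℕ) (t : ℝ) :
    ‖charFun ((pathLaw θ ε).map (partialSum (proc a) n)) t‖ ≤
      ‖compChar (θ i) (ε i) n (t * a i)‖ := by
  refine le_of_tendsto (tendsto_prod_compChar (a := a) hε n t).norm ?_
  filter_upwards [eventually_gt_atTop i] with m hm
  rw [norm_prod, ← Finset.mul_prod_erase _ _ (Finset.mem_range.2 hm)]
  exact mul_le_of_le_one_right (norm_nonneg _)
    (Finset.prod_le_one (fun _ _ => norm_nonneg _) fun j _ => norm_compChar_le_one _ _ _ _)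

/-! ### Complete dissipation -/

/-- `(1 - x_m)^{n_m} → e^{-s}` when `x_m → 0` and `n_m x_m → s`. -/
lemma tendsto_one_sub_pow_exp_neg {x : ℕ → ℝ} {n : ℕ → ℕ} {s : ℝ}
    (hx : Tendsto x atTop (𝓝 0)) (hn : Tendsto (fun m => (n m : ℝ) * x m) atTop (𝓝 s)) :
    Tendsto (fun m => (1 - x m) ^ n m) atTop (𝓝 (Real.exp (-s))) := by
  have h1 : Tendsto (fun m => Real.exp (-((n m : ℝ) * x m))) atTop (𝓝 (Real.exp (-s))) :=
    (Real.continuous_exp.tendsto _).comp hn.neg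
  have h2 : Tendsto (fun m => Real.exp (-((n m : ℝ) * x m / (1 - x m)))) atTop
      (𝓝 (Real.exp (-s))) := by
    have h := hn.div (tendsto_const_nhds (x := (1 : ℝ)) |>.sub hx) (by norm_num)
    rw [sub_zero, div_one] at h
    exact (Real.continuous_exp.tendsto _).comp h.neg
  have hev : ∀ᶠ m in atTop, x m < 1 := hx.eventually_lt_const one_pos
  refine tendsto_of_tendsto_of_tendsto_of_le_of_le' h2 h1 ?_ ?_
  · filter_upwards [hev] with m hm
    have hpos : 0 < 1 - x m := by linarith
    have hlog := Real.one_sub_inv_le_log_of_pos hpos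
    rw [← Real.exp_log hpos, ← Real.exp_nat_mul, Real.exp_log hpos, Real.exp_le_exp]
    have h3 : -((n m : ℝ) * x m / (1 - x m)) = n m * (1 - (1 - x m)⁻¹) := by
      field_simp; ring
    rw [h3]
    exact mul_le_mul_of_nonneg_left hlog (Nat.cast_nonneg _)
  · filter_upwards [hev] with m hm
    have h := pow_le_pow_left₀ (by linarith) (Real.one_sub_le_exp_neg (x m)) (n m)
    rwa [← Real.exp_nat_mul, mul_neg] at h

/-- A concentration bound by Gaussian smoothing: the Gaussian kernel that dominates the indicator of
an interval is itself a characteristic function, so by Fubini's theorem the mass of the interval is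
bounded by an average of the characteristic function. -/
lemma measure_interval_le_integral_charFun (μ : Measure ℝ) [IsProbabilityMeasure μ] {c : ℝ}
    (hc : 0 < c) (r : ℝ) :
    μ {x | r - c < x ∧ x < r + c} ≤
      ENNReal.ofReal (Real.exp (1 / 2) * ∫ z, ‖charFun μ (z / c)‖ ∂(gaussianReal 0 1)) := by
  set γ := gaussianReal 0 1
  set ker : ℝ → ℝ := fun x => Real.exp (-(((x - r) / c) ^ 2 / 2)) with hker
  have hkm : Continuous ker := by fun_prop
  have hk1 : ∀ x, ker x ≤ 1 := fun x => Real.exp_le_one_iff.2 (by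
    have := sq_nonneg ((x - r) / c); linarith)
  have hki : Integrable ker μ := Integrable.of_bound hkm.aestronglyMeasurable 1
    (Eventually.of_forall fun x => by
      rw [Real.norm_of_nonneg (Real.exp_pos _).le]; exact hk1 x)
  have hset : MeasurableSet {x : ℝ | r - c < x ∧ x < r + c} :=
    (measurableSet_lt measurable_const measurable_id).inter
      (measurableSet_lt measurable_id measurable_const)
  have h1 : μ.real {x | r - c < x ∧ x < r + c} ≤ Real.exp (1 / 2) * ∫ x, ker x ∂μ := by
    rw [← integral_const_mul, ← integral_indicator_one hset]
    refine integral_mono ((integrable_const 1).indicator hset) (hki.const_mul _) fun x => ?_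
    by_cases hx : x ∈ {x : ℝ | r - c < x ∧ x < r + c}
    · rw [indicator_of_mem hx, Pi.one_apply, hker, ← Real.exp_add, Real.one_le_exp_iff]
      have h : ((x - r) / c) ^ 2 ≤ 1 := by
        rw [sq_le_one_iff_abs_le_one, abs_div, abs_of_pos hc, div_le_one hc, abs_le]
        constructor <;> linarith [hx.1, hx.2]
      linarith
    · rw [indicator_of_notMem hx]
      positivity
  have h2 : ((∫ x, ker x ∂μ : ℝ) : ℂ) =
      ∫ z, Complex.exp (-(r / c * z) * Complex.I) * charFun μ (z / c) ∂γ := by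
    have h3 : ∀ x, ((ker x : ℝ) : ℂ) = ∫ z, Complex.exp ((x - r) / c * z * Complex.I) ∂γ := by
      intro x
      have h := charFun_gaussianReal (μ := 0) (v := 1) ((x - r) / c)
      rw [charFun_apply_real] at h
      push_cast at h
      rw [h, hker]
      push_cast
      congr 1
      ring
    rw [← integral_complex_ofReal]
    simp_rw [h3]
    rw [integral_integral_swap]
    · refine integral_congr_ae (Eventually.of_forall fun z => ?_)
      simp only
      rw [charFun_apply_real, ← integral_const_mul]
      refine integral_congr_ae (Eventually.of_forall fun x => ?_)
      simp only
      rw [← Complex.exp_add]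
      congr 1
      push_cast
      ring
    · refine Integrable.of_bound (Continuous.aestronglyMeasurable (by fun_prop)) 1
        (Eventually.of_forall fun p => ?_)
      have h := Complex.norm_exp_ofReal_mul_I ((p.1 - r) / c * p.2)
      push_cast at h
      exact h.le
  have h4 : ∫ x, ker x ∂μ ≤ ∫ z, ‖charFun μ (z / c)‖ ∂γ := by
    have h5 : ‖((∫ x, ker x ∂μ : ℝ) : ℂ)‖ = ∫ x, ker x ∂μ := by
      rw [Complex.norm_real, Real.norm_of_nonneg (integral_nonneg fun x => (Real.exp_pos _).le)]
    rw [← h5, h2]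
    refine (norm_integral_le_integral_norm _).trans_eq
      (integral_congr_ae (Eventually.of_forall fun z => ?_))
    have h := Complex.norm_exp_ofReal_mul_I (-(r / c * z))
    push_cast at h
    simp only [norm_mul, h, one_mul]
  rw [← ofReal_measureReal (μ := μ)]
  exact ENNReal.ofReal_le_ofReal
    (h1.trans (mul_le_mul_of_nonneg_left h4 (Real.exp_pos _).le))

/-- The quadratic behaviour of `geomDefect θ` at the origin, in product form. -/
lemma geomDefect_eq_sq_mul (θ τ : ℝ) : geomDefect θ τ =
    τ ^ 2 * ((1 + θ) * (Real.sinc (τ / 2) ^ 2 / 2) /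
      ((1 - θ) ^ 2 + 2 * θ * (1 - Real.cos τ))) := by
  have h : 1 - Real.cos τ = τ ^ 2 * (Real.sinc (τ / 2) ^ 2 / 2) := by
    have h1 : Real.cos τ = 1 - 2 * Real.sin (τ / 2) ^ 2 := by
      rw [Real.sin_sq_eq_half_sub, mul_div_cancel₀ τ two_ne_zero]; ring
    rcases eq_or_ne τ 0 with rfl | h0
    · simp
    · rw [h1, Real.sinc_of_ne_zero (by positivity)]
      field_simp
      ring
  rw [geomDefect]
  nth_rewrite 1 [h]
  ring

/-- Under the square root normalization a single component behaves like a Gaussian variable with the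
asymptotic variance `ε (1 + θ) / (1 - θ)`. -/
lemma tendsto_norm_compChar_sqrt {θ ε : ℝ} (hθ0 : 0 ≤ θ) (hθ1 : θ < 1) (hε0 : 0 ≤ ε) (hε1 : ε ≤ 1)
    (z : ℝ) : Tendsto (fun n : ℕ => ‖compChar θ ε n ((√(n : ℝ))⁻¹ * z)‖) atTop
      (𝓝 (Real.exp (-(ε * (1 + θ) / (1 - θ) * z ^ 2 / 2)))) := by
  have hl : 0 < 1 - θ := by linarith
  set τ : ℕ → ℝ := fun n => (√(n : ℝ))⁻¹ * z with hτ
  have hτ0 : Tendsto τ atTop (𝓝 0) := by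
    have h := (tendsto_inv_atTop_zero.comp
      (Real.tendsto_sqrt_atTop.comp tendsto_natCast_atTop_atTop)).mul_const z
    rwa [zero_mul] at h
  have hn : ∀ᶠ n : ℕ in atTop, (n : ℝ) * τ n ^ 2 = z ^ 2 := by
    filter_upwards [eventually_gt_atTop 0] with n hn
    have : (0 : ℝ) < n := Nat.cast_pos.2 hn
    rw [hτ, mul_pow, inv_pow, Real.sq_sqrt this.le]
    field_simp
  set G : ℝ → ℝ := fun t => (1 + θ) * (Real.sinc (t / 2) ^ 2 / 2) /
    ((1 - θ) ^ 2 + 2 * θ * (1 - Real.cos t)) with hG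
  have hden : ∀ t, (1 - θ) ^ 2 + 2 * θ * (1 - Real.cos t) ≠ 0 := fun t => by
    have := Real.cos_le_one t
    have : 0 ≤ 2 * θ * (1 - Real.cos t) := by
      apply mul_nonneg <;> linarith
    positivity
  have hGc : Continuous G := by
    have := Real.continuous_sinc
    exact Continuous.div (by fun_prop) (by fun_prop) hden
  have hG0 : G 0 = (1 + θ) / (2 * (1 - θ) ^ 2) := by
    simp only [hG, zero_div, Real.sinc_zero, Real.cos_zero]
    field_simp
    ring
  have hdef : Tendsto (fun n => geomDefect θ (τ n)) atTop (𝓝 0) := by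
    have h := (hτ0.pow 2).mul ((hGc.tendsto 0).comp hτ0)
    simp only [ne_eq, OfNat.ofNat_ne_zero, not_false_eq_true, zero_pow, zero_mul] at h
    exact h.congr fun n => (geomDefect_eq_sq_mul θ (τ n)).symm
  have hmul : Tendsto (fun n : ℕ => (n : ℝ) * ((1 - θ) * (ε * geomDefect θ (τ n)))) atTop
      (𝓝 (ε * (1 + θ) / (1 - θ) * z ^ 2 / 2)) := by
    have h := ((hGc.tendsto 0).comp hτ0).const_mul ((1 - θ) * ε * z ^ 2)
    rw [hG0] at h
    have hval : (1 - θ) * ε * z ^ 2 * ((1 + θ) / (2 * (1 - θ) ^ 2)) =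
        ε * (1 + θ) / (1 - θ) * z ^ 2 / 2 := by
      field_simp
    rw [hval] at h
    refine h.congr' ?_
    filter_upwards [hn] with n hn
    rw [geomDefect_eq_sq_mul, ← hn]
    simp only [Function.comp, hG]
    ring
  have hx : Tendsto (fun n => (1 - θ) * (ε * geomDefect θ (τ n))) atTop (𝓝 0) := by
    simpa using (hdef.const_mul ε).const_mul (1 - θ)
  have hpow := tendsto_one_sub_pow_exp_neg (n := fun n => n) hx hmul
  set ρ : ℕ → ℝ := fun n => 1 - (1 - θ) * (ε * geomDefect θ (τ n)) with hρ
  have herr : Tendsto (fun n : ℕ => 2 * (ε * (|τ n| / (1 - θ))) +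
      n * (ε * ((1 - θ) * (ε * geomDefect θ (τ n)) * (|τ n| / (1 - θ))))) atTop (𝓝 0) := by
    have h1 : Tendsto (fun n => |τ n| / (1 - θ)) atTop (𝓝 0) := by
      have h := hτ0.abs.div_const (1 - θ)
      rwa [abs_zero, zero_div] at h
    have h2 := ((h1.const_mul ε).const_mul 2).add ((hmul.mul h1).const_mul ε)
    simp only [mul_zero, add_zero] at h2
    refine h2.congr fun n => ?_
    ring
  have hdist : Tendsto (fun n : ℕ => ‖compChar θ ε n (τ n) - ((ρ n : ℝ) : ℂ) ^ n‖) atTop (𝓝 0) :=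
    squeeze_zero (fun n => norm_nonneg _) (fun n =>
      norm_compChar_sub_pow_le hθ0 hθ1 hε0 hε1 n (τ n) fun s =>
        (norm_eigenComp_sub_one_le hθ0 hθ1 (norm_char _ _)).trans
          (div_le_div_of_nonneg_right (norm_char_sub_one_le _ _) hl.le)) herr
  have hcp : Tendsto (fun n : ℕ => ((ρ n : ℝ) : ℂ) ^ n) atTop
      (𝓝 ((Real.exp (-(ε * (1 + θ) / (1 - θ) * z ^ 2 / 2)) : ℝ) : ℂ)) := by
    have h := (Complex.continuous_ofReal.tendsto _).comp hpow
    refine h.congr fun n => ?_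
    simp [hρ]
  have hlim := ((tendsto_zero_iff_norm_tendsto_zero.2 hdist).add hcp).norm
  rw [zero_add, Complex.norm_real, Real.norm_of_nonneg (Real.exp_pos _).le] at hlim
  refine hlim.congr fun n => ?_
  rw [sub_add_cancel]

/-- If the asymptotic variances of the components tend to infinity, the normalized partial sums
dissipate completely: the concentration function is asymptotically bounded by a Gaussian integral
that involves the variance of one component only, and this component is arbitrary. -/
lemma isCompletelyDissipated_proc {θ ε : ℕ → unitInterval} {a : ℕ → ℝ}
    (hε : Summable fun j => (ε j : ℝ)) (hθ : ∀ j, (θ j : ℝ) < 1)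
    (hv : Tendsto (fun i => a i ^ 2 * ε i / (1 - θ i)) atTop atTop) :
    IsCompletelyDissipated (pathLaw θ ε) (proc a) := by
  intro c hc
  set γ := gaussianReal 0 1
  set L : ℕ → ℝ := fun i => ∫ z, Real.exp
    (-((ε i : ℝ) * (1 + θ i) / (1 - θ i) * (z / c * a i) ^ 2 / 2)) ∂γ with hL
  set B : ℕ → ℕ → ℝ := fun i n => ∫ z, ‖compChar (θ i) (ε i) n ((√(n : ℝ))⁻¹ * (z / c * a i))‖ ∂γ
    with hB
  have hmeas : ∀ i n, Measurable fun t : ℝ => compChar (θ i) (ε i) n (t * a i) := by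
    intro i n
    simp_rw [← charFun_compSum θ ε a i n]
    exact measurable_charFun
  have hmeas' : ∀ i n, AEStronglyMeasurable
      (fun z : ℝ => ‖compChar (θ i) (ε i) n ((√(n : ℝ))⁻¹ * (z / c * a i))‖) γ := by
    intro i n
    simp_rw [← mul_assoc]
    exact ((hmeas i n).comp
      ((measurable_id.div_const c).const_mul (√(n : ℝ))⁻¹)).norm.aestronglyMeasurable
  have hlimB : ∀ i, Tendsto (B i) atTop (𝓝 (L i)) := by
    intro i
    refine tendsto_integral_of_dominated_convergence (fun _ => 1) (hmeas' i)
      (integrable_const 1) (fun n => Eventually.of_forall fun z => ?_)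
      (Eventually.of_forall fun z => tendsto_norm_compChar_sqrt (θ i).2.1 (hθ i) (ε i).2.1
        (ε i).2.2 _)
    rw [norm_norm]
    exact norm_compChar_le_one _ _ _ _
  have hlimL : Tendsto L atTop (𝓝 0) := by
    have h0 : (0 : ℝ) = ∫ _ : ℝ, (0 : ℝ) ∂γ := by simp
    rw [h0]
    refine tendsto_integral_of_dominated_convergence (fun _ => 1)
      (fun n => Continuous.aestronglyMeasurable (by fun_prop))
      (integrable_const 1) (fun i => Eventually.of_forall fun z => ?_) ?_
    · rw [Real.norm_of_nonneg (Real.exp_pos _).le, Real.exp_le_one_iff, neg_nonpos]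
      have h1 : (0 : ℝ) < 1 - θ i := by linarith [hθ i]
      have h2 := (θ i).2.1
      have h3 := (ε i).2.1
      positivity
    · have hna : ∀ᵐ z ∂γ, z ≠ 0 := by
        have := nullSingletonClass_gaussianReal (μ := 0) (v := 1) one_ne_zero
        exact compl_mem_ae_iff.2 (measure_singleton 0 : γ {0} = 0)
      filter_upwards [hna] with z hz
      refine Real.tendsto_exp_neg_atTop_nhds_zero.comp ?_
      refine tendsto_atTop_mono (fun i => ?_)
        (hv.atTop_mul_const (by positivity : (0 : ℝ) < (z / c) ^ 2 / 2))
      have h1 : (0 : ℝ) < 1 - θ i := by linarith [hθ i]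
      have h2 := (θ i).2.1
      have h3 := (ε i).2.1
      have : (ε i : ℝ) * (1 + θ i) / (1 - θ i) * (z / c * a i) ^ 2 / 2 =
          a i ^ 2 * ε i / (1 - θ i) * ((z / c) ^ 2 / 2) * (1 + θ i) := by ring
      rw [this]
      exact le_mul_of_one_le_right (by positivity) (by linarith)
  have hbound : ∀ i (n : ℕ), ⨆ r : ℝ, pathLaw θ ε
      {ω | r - c < (√(n : ℝ))⁻¹ * partialSum (proc a) n ω ∧
        (√(n : ℝ))⁻¹ * partialSum (proc a) n ω < r + c} ≤
      ENNReal.ofReal (Real.exp (1 / 2) * B i n) := by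
    intro i n
    refine iSup_le fun r => ?_
    have hm : Measurable fun ω => (√(n : ℝ))⁻¹ * partialSum (proc a) n ω :=
      (measurable_partialSum a n).const_mul _
    have hprob : IsProbabilityMeasure
        ((pathLaw θ ε).map fun ω => (√(n : ℝ))⁻¹ * partialSum (proc a) n ω) :=
      Measure.isProbabilityMeasure_map hm.aemeasurable
    have h := measure_interval_le_integral_charFun
      ((pathLaw θ ε).map fun ω => (√(n : ℝ))⁻¹ * partialSum (proc a) n ω) hc r
    have hset : MeasurableSet {x : ℝ | r - c < x ∧ x < r + c} :=
      (measurableSet_lt measurable_const measurable_id).inter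
        (measurableSet_lt measurable_id measurable_const)
    rw [Measure.map_apply hm hset] at h
    refine h.trans (ENNReal.ofReal_le_ofReal (mul_le_mul_of_nonneg_left ?_ (Real.exp_pos _).le))
    have hle : ∀ z : ℝ, ‖charFun
        ((pathLaw θ ε).map fun ω => (√(n : ℝ))⁻¹ * partialSum (proc a) n ω) (z / c)‖ ≤
        ‖compChar (θ i) (ε i) n ((√(n : ℝ))⁻¹ * (z / c * a i))‖ := by
      intro z
      have h2 := charFun_map_mul_comp (measurable_partialSum a n).aemeasurable
        (μ := pathLaw θ ε) (√(n : ℝ))⁻¹ (z / c)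
      rw [h2, ← mul_assoc]
      exact norm_charFun_partialSum_le hε i n _
    refine integral_mono_of_nonneg (Eventually.of_forall fun z => norm_nonneg _) ?_
      (Eventually.of_forall hle)
    refine Integrable.of_bound (hmeas' i n) 1 (Eventually.of_forall fun z => ?_)
    rw [norm_norm]
    exact norm_compChar_le_one _ _ _ _
  refine ENNReal.tendsto_nhds_zero.2 fun δ hδ => ?_
  obtain ⟨d, hd0, hd⟩ := ENNReal.lt_iff_exists_nnreal_btwn.1 hδ
  have hd0' : (0 : ℝ) < d := by exact_mod_cast hd0
  have h1 := hlimL.const_mul (Real.exp (1 / 2))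
  rw [mul_zero] at h1
  -- choose the component `i` first, and only then let `n` tend to infinity
  obtain ⟨i, hi⟩ := (h1.eventually_lt_const hd0').exists
  filter_upwards [((hlimB i).const_mul (Real.exp (1 / 2))).eventually_lt_const hi] with n hn
  refine (hbound i n).trans (le_trans ?_ hd.le)
  rw [← ENNReal.ofReal_coe_nnreal]
  exact ENNReal.ofReal_le_ofReal hn.le

/-! ### Growth of variances and the characteristic function of the limit law -/

/-- By Chebyshev's inequality, complete dissipation forces superlinear growth of the variances. -/
lemma tendsto_variance_of_isCompletelyDissipated {Ω : Type*} [MeasurableSpace Ω] {P : Measure Ω}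
    [IsProbabilityMeasure P] {X : ℤ → Ω → ℝ} (hX : ∀ n, MemLp (partialSum X n) 2 P)
    (hm : ∀ n, Measurable (partialSum X n)) (hd : IsCompletelyDissipated P X) :
    Tendsto (fun n : ℕ => (n : ℝ)⁻¹ * variance (partialSum X n) P) atTop atTop := by
  refine tendsto_atTop.2 fun M => ?_
  -- an interval of half-width `c √n` around the mean has probability less than `1 / 2`, so the
  -- variance is at least `c ^ 2 n / 2`
  set c := |M| + 2 with hc
  have hc0 : 0 < c := by positivity
  have hev := (hd c hc0).eventually_lt_const (by norm_num : (0 : ENNReal) < 2⁻¹)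
  filter_upwards [hev, eventually_gt_atTop 0] with n hn hpos
  have hn0 : (0 : ℝ) < n := Nat.cast_pos.2 hpos
  have hs0 : 0 < √(n : ℝ) := Real.sqrt_pos.2 hn0
  set E := ∫ ω, partialSum X n ω ∂P
  have h1 : P {ω | (√(n : ℝ))⁻¹ * E - c < (√(n : ℝ))⁻¹ * partialSum X n ω ∧
      (√(n : ℝ))⁻¹ * partialSum X n ω < (√(n : ℝ))⁻¹ * E + c} < 2⁻¹ :=
    (le_iSup (fun r : ℝ => P {ω | r - c < (√(n : ℝ))⁻¹ * partialSum X n ω ∧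
      (√(n : ℝ))⁻¹ * partialSum X n ω < r + c}) ((√(n : ℝ))⁻¹ * E)).trans_lt hn
  have hset : {ω | (√(n : ℝ))⁻¹ * E - c < (√(n : ℝ))⁻¹ * partialSum X n ω ∧
      (√(n : ℝ))⁻¹ * partialSum X n ω < (√(n : ℝ))⁻¹ * E + c} =
      {ω | c * √(n : ℝ) ≤ |partialSum X n ω - E|}ᶜ := by
    ext ω
    have h : |partialSum X n ω - E| < c * √(n : ℝ) ↔
        |(√(n : ℝ))⁻¹ * (partialSum X n ω - E)| < c := by
      rw [abs_mul, abs_of_pos (inv_pos.2 hs0), inv_mul_lt_iff₀ hs0, mul_comm]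
    rw [mem_ofPred_eq, mem_compl_iff, mem_ofPred_eq, not_le, h, abs_lt, mul_sub]
    constructor <;> rintro ⟨h1, h2⟩ <;> constructor <;> linarith
  have hms : MeasurableSet {ω | c * √(n : ℝ) ≤ |partialSum X n ω - E|} :=
    measurableSet_le measurable_const ((hm n).sub_const E).abs
  rw [hset, prob_compl_eq_one_sub hms] at h1
  have h2 := meas_ge_le_variance_div_sq (hX n) (mul_pos hc0 hs0)
  set V := variance (partialSum X n) P
  have h3 : (2 : ENNReal)⁻¹ < ENNReal.ofReal (V / (c * √(n : ℝ)) ^ 2) := by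
    refine lt_of_lt_of_le ?_ h2
    by_contra hcon
    rw [not_lt] at hcon
    refine absurd h1 (not_lt.2 ?_)
    rw [← ENNReal.one_sub_inv_two]
    exact tsub_le_tsub_left hcon 1
  have h4 : (2 : ℝ)⁻¹ < V / (c * √(n : ℝ)) ^ 2 := by
    rw [ENNReal.lt_ofReal_iff_toReal_lt (by simp)] at h3
    simpa using h3
  rw [mul_pow, Real.sq_sqrt hn0.le, lt_div_iff₀ (by positivity)] at h4
  rw [inv_mul_eq_div, le_div_iff₀ hn0]
  have h5 : M ≤ 2⁻¹ * c ^ 2 := by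
    rw [hc]; nlinarith [le_abs_self M, abs_nonneg M]
  nlinarith

lemma charFun_laplaceMeasure (t : ℝ) : charFun laplaceMeasure t = ((1 / (1 + t ^ 2) : ℝ) : ℂ) := by
  have hden : (1 - t * Complex.I) ≠ 0 := fun h => by
    have := congrArg Complex.re h; simp at this
  have hden' : (1 + t * Complex.I) ≠ 0 := fun h => by
    have := congrArg Complex.re h; simp at this
  rw [charFun_apply_real, laplaceMeasure, integral_withDensity_eq_integral_toReal_smul
    (by fun_prop) (Eventually.of_forall fun _ => ENNReal.ofReal_lt_top)]
  have h1 : ∀ x : ℝ, (ENNReal.ofReal (1 / 2 * Real.exp (-|x|))).toReal •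
      Complex.exp (t * x * Complex.I) =
      1 / 2 * Complex.exp (-(|x| : ℝ) + t * x * Complex.I) := by
    intro x
    rw [ENNReal.toReal_ofReal (by positivity), Complex.real_smul, Complex.exp_add]
    push_cast
    ring
  simp_rw [h1]
  have hneg : EqOn (fun x : ℝ => 1 / 2 * Complex.exp (-(|x| : ℝ) + t * x * Complex.I))
      (fun x : ℝ => 1 / 2 * Complex.exp ((1 + t * Complex.I) * x)) (Iic 0) := by
    intro x hx
    simp only [abs_of_nonpos (mem_Iic.1 hx)]
    congr 2; push_cast; ring
  have hpos : EqOn (fun x : ℝ => 1 / 2 * Complex.exp (-(|x| : ℝ) + t * x * Complex.I))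
      (fun x : ℝ => 1 / 2 * Complex.exp ((-1 + t * Complex.I) * x)) (Ioi 0) := by
    intro x hx
    simp only [abs_of_pos (mem_Ioi.1 hx)]
    congr 2; ring
  have hre : 0 < (1 + t * Complex.I).re := by simp
  have hre' : (-1 + t * Complex.I).re < 0 := by simp
  rw [← intervalIntegral.integral_Iic_add_Ioi (b := 0)
    (IntegrableOn.congr_fun ((integrableOn_exp_mul_complex_Iic hre 0).const_mul _) hneg.symm
      measurableSet_Iic)
    (IntegrableOn.congr_fun ((integrableOn_exp_mul_complex_Ioi hre' 0).const_mul _) hpos.symm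
      measurableSet_Ioi),
    setIntegral_congr_fun measurableSet_Iic hneg, setIntegral_congr_fun measurableSet_Ioi hpos,
    integral_const_mul, integral_const_mul, integral_exp_mul_complex_Iic hre,
    integral_exp_mul_complex_Ioi hre']
  have hprod : (1 + (t : ℂ) ^ 2) = (1 - t * Complex.I) * (1 + t * Complex.I) := by
    linear_combination (t : ℂ) ^ 2 * Complex.I_sq
  push_cast
  rw [hprod]
  simp only [mul_zero, Complex.exp_zero]
  rw [show (-1 + t * Complex.I : ℂ) = -(1 - t * Complex.I) by ring, neg_div_neg_eq]
  generalize (t : ℂ) * Complex.I = q at hden hden' ⊢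
  field_simp
  ring

/-- The exponential series over the number of summands gives `exp (1 / (1 + t ^ 2) - 1)`. -/
lemma charFun_muP1sL (t : ℝ) :
    charFun muP1sL t = ((Real.exp (-(t ^ 2 / (1 + t ^ 2))) : ℝ) : ℂ) := by
  set φ : ℂ := ((1 / (1 + t ^ 2) : ℝ) : ℂ) with hφ
  set L := Measure.infinitePi fun _ : ℕ => laplaceMeasure
  have hms : Measurable fun p : ℕ × (ℕ → ℝ) => ∑ k ∈ Finset.range p.1, p.2 k := by
    refine measurable_from_prod_countable_right fun n => ?_
    change Measurable fun y : ℕ → ℝ => ∑ k ∈ Finset.range n, y k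
    fun_prop
  have hexp : Measurable fun x : ℝ => Complex.exp (t * x * Complex.I) := by fun_prop
  have hinner : ∀ n : ℕ, ∫ y, Complex.exp (t * (∑ k ∈ Finset.range n, y k : ℝ) * Complex.I) ∂L =
      φ ^ n := by
    intro n
    have hind : iIndepFun (fun (k : ℕ) (y : ℕ → ℝ) => y k) L :=
      iIndepFun_infinitePi (P := fun _ : ℕ => laplaceMeasure) (X := fun _ x => x)
        fun _ => measurable_id
    have h1 := (hind.restrict (Finset.range n : Finset ℕ)).charFun_map_fun_finsetSum_eq_prod
      (fun k _ => (measurable_pi_apply k).aemeasurable)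
    have h2 := congrFun h1 t
    rw [charFun_apply_real, integral_map (by fun_prop) hexp.aestronglyMeasurable] at h2
    rw [h2, Finset.prod_apply]
    have h3 : ∀ k ∈ Finset.range n, charFun (L.map fun y => y k) t = φ := fun k _ => by
      rw [(measurePreserving_eval_infinitePi (fun _ : ℕ => laplaceMeasure) k).map_eq,
        charFun_laplaceMeasure]
    rw [Finset.prod_congr rfl h3, Finset.prod_const, Finset.card_range]
  rw [charFun_apply_real, muP1sL, integral_map hms.aemeasurable hexp.aestronglyMeasurable,
    integral_prod]
  · refine Eq.trans (integral_congr_ae (Eventually.of_forall hinner)) ?_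
    rw [integral_poissonMeasure]
    have h4 : ∀ n : ℕ, (Real.exp (-((1 : NNReal) : ℝ)) * ((1 : NNReal) : ℝ) ^ n / n.factorial) • φ ^ n =
        Complex.exp (-1) * (φ ^ n / n.factorial) := by
      intro n
      rw [Complex.real_smul]
      push_cast
      rw [one_pow]
      ring
    simp_rw [h4]
    rw [tsum_mul_left, (NormedSpace.expSeries_div_hasSum_exp φ).tsum_eq, ← Complex.exp_eq_exp_ℂ,
      ← Complex.exp_add, Complex.ofReal_exp]
    congr 1
    rw [hφ, ← Complex.ofReal_one, ← Complex.ofReal_neg, ← Complex.ofReal_add]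
    congr 1
    have : (1 + t ^ 2) ≠ 0 := by positivity
    field_simp
    ring
  · refine Integrable.of_bound (hexp.comp hms).aestronglyMeasurable 1
      (Eventually.of_forall fun p => ?_)
    have h := Complex.norm_exp_ofReal_mul_I (t * ∑ k ∈ Finset.range p.1, p.2 k)
    rw [Complex.ofReal_mul] at h
    exact h.le

/-! ### Convergence to the Poisson sum of Laplace variables -/

lemma norm_prod_sub_one_le {ι : Type*} (s : Finset ι) (z : ι → ℂ) (hz : ∀ i ∈ s, ‖z i‖ ≤ 1) :
    ‖∏ i ∈ s, z i - 1‖ ≤ ∑ i ∈ s, ‖z i - 1‖ := by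
  classical
  induction s using Finset.induction_on with
  | empty => simp
  | insert i s hi ih =>
    rw [Finset.prod_insert hi, Finset.sum_insert hi]
    have h1 := ih fun j hj => hz j (Finset.mem_insert_of_mem hj)
    have h2 : z i * ∏ j ∈ s, z j - 1 = (z i - 1) + z i * (∏ j ∈ s, z j - 1) := by ring
    rw [h2]
    refine (norm_add_le _ _).trans (add_le_add le_rfl ?_)
    rw [norm_mul]
    exact (mul_le_of_le_one_left (norm_nonneg _)
      (hz i (Finset.mem_insert_self i s))).trans h1

/-- A bound by the asymptotic variance, at the cost of a term that does not grow with `n`. It is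
effective when `n` is large compared with the relaxation time `1 / (1 - θ)`. -/
lemma norm_compChar_sub_one_le_sq {θ ε : ℝ} (hθ0 : 0 ≤ θ) (hθ1 : θ < 1) (hε0 : 0 ≤ ε) (hε1 : ε ≤ 1)
    (n : ℕ) (τ : ℝ) : ‖compChar θ ε n τ - 1‖ ≤
      3 * (n * (ε * τ ^ 2 / (1 - θ))) + 2 * (|τ| / (1 - θ)) := by
  have hl : 0 < 1 - θ := by linarith
  -- the bound `2` for the eigenvector serves in the term with the factor `n`, the bound
  -- `|τ| / (1 - θ)` in the other one
  have hd1 := min_le_left (2 : ℝ) (|τ| / (1 - θ))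
  have hd2 := min_le_right (2 : ℝ) (|τ| / (1 - θ))
  have hd0 : 0 ≤ min (2 : ℝ) (|τ| / (1 - θ)) := le_min two_pos.le (by positivity)
  have h1 := norm_compChar_sub_pow_le hθ0 hθ1 hε0 hε1 n τ (d := min 2 (|τ| / (1 - θ))) fun s =>
    le_min (norm_eigenComp_sub_one_le_two hθ0 hθ1 (norm_char _ _))
      ((norm_eigenComp_sub_one_le hθ0 hθ1 (norm_char _ _)).trans
        (div_le_div_of_nonneg_right (norm_char_sub_one_le _ _) hl.le))
  set d := min (2 : ℝ) (|τ| / (1 - θ))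
  set q := geomDefect θ τ
  have hq0 : 0 ≤ q := geomDefect_nonneg hθ0 τ
  have hq2 : q ≤ 2 := geomDefect_le_two hθ0 hθ1 τ
  have hq : q ≤ τ ^ 2 / (1 - θ) ^ 2 := geomDefect_le hθ0 hθ1 τ
  set x := (1 - θ) * (ε * q) with hx
  have hx0 : 0 ≤ x := by positivity
  have hx2 : x ≤ 2 := by
    have : ε * q ≤ 2 := by nlinarith
    have : 0 ≤ ε * q := by positivity
    nlinarith
  have hxq : x ≤ ε * τ ^ 2 / (1 - θ) := by
    calc x ≤ (1 - θ) * (ε * (τ ^ 2 / (1 - θ) ^ 2)) := by rw [hx]; gcongr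
      _ = ε * τ ^ 2 / (1 - θ) := by field_simp
  have h2 : ‖((1 - x : ℝ) : ℂ) ^ n - 1‖ ≤ n * x := by
    rw [← Complex.ofReal_pow, ← Complex.ofReal_one, ← Complex.ofReal_sub, Complex.norm_real,
      Real.norm_eq_abs, abs_le]
    have h3 := one_add_mul_le_pow (by linarith : -2 ≤ -x) n
    have h4 : (1 - x) ^ n ≤ 1 := by
      refine (le_abs_self _).trans ?_
      rw [abs_pow]
      exact pow_le_one₀ (abs_nonneg _) (abs_le.2 ⟨by linarith, by linarith⟩)
    rw [← sub_eq_add_neg] at h3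
    have : 0 ≤ n * x := by positivity
    constructor <;> linarith
  have h5 : ‖compChar θ ε n τ - 1‖ ≤ (2 * (ε * d) + n * (ε * (x * d))) + n * x := by
    have h6 : compChar θ ε n τ - 1 =
        (compChar θ ε n τ - ((1 - x : ℝ) : ℂ) ^ n) + (((1 - x : ℝ) : ℂ) ^ n - 1) := by ring
    rw [h6]
    exact (norm_add_le _ _).trans (add_le_add h1 h2)
  have h7 : ε * d ≤ |τ| / (1 - θ) := (mul_le_of_le_one_left hd0 hε1).trans hd2
  have h8 : ε * (x * d) ≤ 2 * (ε * τ ^ 2 / (1 - θ)) := by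
    calc ε * (x * d) ≤ 1 * (ε * τ ^ 2 / (1 - θ) * 2) := by gcongr
      _ = _ := by ring
  have h9 : (n : ℝ) * (ε * (x * d)) ≤ n * (2 * (ε * τ ^ 2 / (1 - θ))) := by gcongr
  have h10 : (n : ℝ) * x ≤ n * (ε * τ ^ 2 / (1 - θ)) := by gcongr
  linarith

/-- The defect at frequency of the order of the inverse relaxation time: this is where the
characteristic function `1 / (1 + t ^ 2)` of the Laplace law comes from. -/
lemma tendsto_geomDefect {θ : ℕ → ℝ} (hθ1 : ∀ m, θ m < 1) (hθ : Tendsto θ atTop (𝓝 1))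
    (t : ℝ) : Tendsto (fun m => geomDefect (θ m) (t * (1 - θ m))) atTop
      (𝓝 (t ^ 2 / (1 + t ^ 2))) := by
  set s : ℕ → ℝ := fun m => Real.sinc (t * (1 - θ m) / 2) ^ 2 / 2 with hs
  have hs1 : Tendsto s atTop (𝓝 (1 / 2)) := by
    have h1 : Tendsto (fun m => t * (1 - θ m) / 2) atTop (𝓝 0) := by
      have h := ((hθ.const_sub 1).const_mul t).div_const 2
      rwa [sub_self, mul_zero, zero_div] at h
    have h := (((Real.continuous_sinc.tendsto 0).comp h1).pow 2).div_const 2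
    rwa [Real.sinc_zero, one_pow] at h
  have h := (((hθ.const_add 1).mul hs1).const_mul (t ^ 2)).div
    (((hθ.const_mul 2).mul (hs1.const_mul (t ^ 2))).const_add 1)
    (by positivity : (1 + 2 * 1 * (t ^ 2 * (1 / 2))) ≠ 0)
  have hval : t ^ 2 * ((1 + 1) * (1 / 2)) / (1 + 2 * 1 * (t ^ 2 * (1 / 2))) =
      t ^ 2 / (1 + t ^ 2) := by
    congr 1 <;> ring
  rw [hval] at h
  refine h.congr fun m => ?_
  have hl : (1 - θ m) ≠ 0 := by linarith [hθ1 m]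
  have hcos : 1 - Real.cos (t * (1 - θ m)) = (t * (1 - θ m)) ^ 2 * s m := by
    have h0 := geomDefect_eq_sq_mul 0 (t * (1 - θ m))
    simpa [geomDefect] using h0
  rw [geomDefect, hcos]
  have hfac : (1 - θ m) ^ 2 + 2 * θ m * ((t * (1 - θ m)) ^ 2 * s m) =
      (1 - θ m) ^ 2 * (1 + 2 * θ m * (t ^ 2 * s m)) := by ring
  have hfac' : (1 + θ m) * ((t * (1 - θ m)) ^ 2 * s m) =
      (1 - θ m) ^ 2 * (t ^ 2 * ((1 + θ m) * s m)) := by ring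
  rw [hfac, hfac', mul_div_mul_left _ _ (pow_ne_zero 2 hl)]
  rfl

section Limit

variable {θ ε : ℕ → unitInterval} {a : ℕ → ℝ} {J : ℕ → ℕ}

/-- At its own time scale, a rare and slowly mixing component is asymptotically a Poisson sum of
Laplace variables: it leaves `0` a Poisson number of times, and the sum over an excursion is
a geometric number of states of a random sign. -/
lemma tendsto_compChar_own_scale (hθ : ∀ j, (θ j : ℝ) < 1)
    (hθ1 : Tendsto (fun j => (θ j : ℝ)) atTop (𝓝 1))
    (hε : Tendsto (fun j => (ε j : ℝ)) atTop (𝓝 0))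
    (hJ : Tendsto (fun m => (J m : ℝ) * (ε m * (1 - θ m))) atTop (𝓝 1)) (t : ℝ) :
    Tendsto (fun m => compChar (θ m) (ε m) (J m) (t * (1 - θ m))) atTop
      (𝓝 ((Real.exp (-(t ^ 2 / (1 + t ^ 2))) : ℝ) : ℂ)) := by
  set q : ℕ → ℝ := fun m => geomDefect (θ m) (t * (1 - θ m)) with hq
  set x : ℕ → ℝ := fun m => (1 - θ m) * (ε m * q m) with hx
  have hq1 : Tendsto q atTop (𝓝 (t ^ 2 / (1 + t ^ 2))) := tendsto_geomDefect hθ hθ1 t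
  have hx1 : Tendsto x atTop (𝓝 0) := by
    have h := (hθ1.const_sub 1).mul (hε.mul hq1)
    simpa using h
  have hJx : Tendsto (fun m => (J m : ℝ) * x m) atTop (𝓝 (t ^ 2 / (1 + t ^ 2))) := by
    have h := hJ.mul hq1
    rw [one_mul] at h
    refine h.congr fun m => ?_
    simp only [hx]; ring
  have hpow := tendsto_one_sub_pow_exp_neg hx1 hJx
  have herr : Tendsto (fun m => 2 * (ε m * (2 : ℝ)) + J m * (ε m * (x m * 2))) atTop (𝓝 0) := by
    have h := ((hε.mul_const 2).const_mul 2).add ((hε.mul (hJx.mul_const 2)))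
    simp only [zero_mul, mul_zero, add_zero] at h
    refine h.congr fun m => ?_
    ring
  have hdist : Tendsto (fun m => ‖compChar (θ m) (ε m) (J m) (t * (1 - θ m)) -
      ((1 - x m : ℝ) : ℂ) ^ J m‖) atTop (𝓝 0) :=
    squeeze_zero (fun m => norm_nonneg _) (fun m =>
      norm_compChar_sub_pow_le (θ m).2.1 (hθ m) (ε m).2.1 (ε m).2.2 _ _ fun s =>
        norm_eigenComp_sub_one_le_two (θ m).2.1 (hθ m) (norm_char _ _)) herr
  have hcp : Tendsto (fun m => ((1 - x m : ℝ) : ℂ) ^ J m) atTop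
      (𝓝 ((Real.exp (-(t ^ 2 / (1 + t ^ 2))) : ℝ) : ℂ)) :=
    ((Complex.continuous_ofReal.tendsto _).comp hpow).congr fun m => by simp
  have hlim := (tendsto_zero_iff_norm_tendsto_zero.2 hdist).add hcp
  rw [zero_add] at hlim
  exact hlim.congr fun m => sub_add_cancel _ _

/-- At the time scale of the component `m`, the other components are negligible: those of smaller
index have averaged out, those of larger index have most likely not left `0`. -/
lemma norm_charFun_sub_compChar_le (hε : Summable fun j => (ε j : ℝ)) (hθ : ∀ j, (θ j : ℝ) < 1)
    (ha : ∀ j, 0 < a j) (hhigh : ∀ m l, m < l → (J m : ℝ) * (ε l * a l) ≤ (1 / 2) ^ l) (m : ℕ) (t : ℝ) :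
    ‖charFun ((pathLaw θ ε).map (partialSum (proc a) (J m))) ((a m / (1 - θ m))⁻¹ * t) -
      compChar (θ m) (ε m) (J m) (t * (1 - θ m))‖ ≤
    (3 * t ^ 2 + 2 * |t|) * ∑ l ∈ Finset.range m,
      (J m * (a l ^ 2 * ε l / (1 - θ l)) / (a m / (1 - θ m)) ^ 2 +
        a l / (1 - θ l) / (a m / (1 - θ m))) + 2 * |t| / (a m / (1 - θ m)) := by
  have hl : ∀ j, (0 : ℝ) < 1 - θ j := fun j => by linarith [hθ j]
  set b := a m / (1 - θ m) with hb
  have hb0 : 0 < b := div_pos (ha m) (hl m)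
  set z : ℕ → ℂ := fun l => compChar (θ l) (ε l) (J m) (b⁻¹ * t * a l) with hz
  have hz1 : ∀ l, ‖z l‖ ≤ 1 := fun l => norm_compChar_le_one _ _ _ _
  have hzm : z m = compChar (θ m) (ε m) (J m) (t * (1 - θ m)) := by
    simp only [hz, hb]
    congr 1
    have := (ha m).ne'
    have := (hl m).ne'
    field_simp
  have hlim := tendsto_prod_compChar (θ := θ) (a := a) hε (J m) (b⁻¹ * t)
  rw [← hzm]
  refine le_of_tendsto (hlim.sub_const (z m)).norm ?_
  filter_upwards [eventually_ge_atTop (m + 1)] with M hM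
  change ‖∏ l ∈ Finset.range M, z l - z m‖ ≤ _
  rw [← Finset.prod_range_mul_prod_Ico z hM, Finset.prod_range_succ]
  set p := ∏ l ∈ Finset.range m, z l with hp
  set r := ∏ l ∈ Finset.Ico (m + 1) M, z l with hr
  have h1 : ‖p - 1‖ ≤ ∑ l ∈ Finset.range m, ‖z l - 1‖ := norm_prod_sub_one_le _ _ fun l _ => hz1 l
  have h2 : ‖r - 1‖ ≤ ∑ l ∈ Finset.Ico (m + 1) M, ‖z l - 1‖ :=
    norm_prod_sub_one_le _ _ fun l _ => hz1 l
  have hr1 : ‖r‖ ≤ 1 := by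
    rw [hr, norm_prod]
    exact Finset.prod_le_one (fun _ _ => norm_nonneg _) fun l _ => hz1 l
  have h3 : ‖p * z m * r - z m‖ ≤ ‖p - 1‖ + ‖r - 1‖ := by
    have : p * z m * r - z m = z m * ((p - 1) * r + (r - 1)) := by ring
    rw [this, norm_mul]
    refine (mul_le_of_le_one_left (norm_nonneg _) (hz1 m)).trans ((norm_add_le _ _).trans ?_)
    rw [norm_mul]
    exact add_le_add (mul_le_of_le_one_right (norm_nonneg _) hr1) le_rfl
  refine h3.trans (add_le_add (h1.trans ?_) (h2.trans ?_))
  · rw [Finset.mul_sum]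
    refine Finset.sum_le_sum fun l _ => ?_
    have h4 := norm_compChar_sub_one_le_sq (θ l).2.1 (hθ l) (ε l).2.1 (ε l).2.2 (J m)
      (b⁻¹ * t * a l)
    have h5 : |b⁻¹ * t * a l| = |t| * (a l / b) := by
      rw [abs_mul, abs_mul, abs_of_pos (inv_pos.2 hb0), abs_of_pos (ha l)]; ring
    rw [h5] at h4
    have h6 : 3 * (J m * ((ε l : ℝ) * (b⁻¹ * t * a l) ^ 2 / (1 - θ l))) =
        3 * t ^ 2 * (J m * (a l ^ 2 * ε l / (1 - θ l)) / b ^ 2) := by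
      field_simp
    have h7 : 2 * (|t| * (a l / b) / (1 - θ l)) = 2 * |t| * (a l / (1 - θ l) / b) := by
      field_simp
    rw [h6, h7] at h4
    have h8 : (0 : ℝ) ≤ J m * (a l ^ 2 * ε l / (1 - θ l)) / b ^ 2 := by
      have := hl l
      have := (ε l).2.1
      positivity
    have h9 : 0 ≤ a l / (1 - θ l) / b := by
      have := hl l
      have := ha l
      positivity
    have := abs_nonneg t
    nlinarith [mul_nonneg (sq_nonneg t) h9, mul_nonneg this h8]
  · have h4 : ∀ l ∈ Finset.Ico (m + 1) M, ‖z l - 1‖ ≤ |t| / b * (1 / 2) ^ l := by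
      intro l hlm
      have h5 := norm_compChar_sub_one_le (θ l).2.1 (θ l).2.2 (ε l).2.1 (ε l).2.2 (J m)
        (b⁻¹ * t * a l)
      have h6 := hhigh m l (Finset.mem_Ico.1 hlm).1
      refine h5.trans ?_
      rw [abs_mul, abs_mul, abs_of_pos (inv_pos.2 hb0), abs_of_pos (ha l)]
      calc (J m : ℝ) * (ε l * (b⁻¹ * |t| * a l)) = |t| / b * (J m * (ε l * a l)) := by
            field_simp
        _ ≤ _ := by gcongr
    refine (Finset.sum_le_sum h4).trans ?_
    rw [← Finset.mul_sum]
    have h5 : ∑ l ∈ Finset.Ico (m + 1) M, (1 / 2 : ℝ) ^ l ≤ 2 := by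
      exact (summable_geometric_two.sum_le_tsum _ fun l _ => by positivity).trans_eq
        tsum_geometric_two
    calc |t| / b * ∑ l ∈ Finset.Ico (m + 1) M, (1 / 2 : ℝ) ^ l ≤ |t| / b * 2 := by gcongr
      _ = 2 * |t| / b := by ring

/-- Convergence along the subsequence `J` of time scales of the single components. -/
theorem tendstoInDistribution_proc (hε : Summable fun j => (ε j : ℝ)) (hθ : ∀ j, (θ j : ℝ) < 1)
    (ha : ∀ j, 0 < a j) (hθ1 : Tendsto (fun j => (θ j : ℝ)) atTop (𝓝 1))
    (hb : Tendsto (fun m => a m / (1 - θ m)) atTop atTop)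
    (hJ : Tendsto (fun m => (J m : ℝ) * (ε m * (1 - θ m))) atTop (𝓝 1))
    (hlow : Tendsto (fun m => ∑ l ∈ Finset.range m,
      (J m * (a l ^ 2 * ε l / (1 - θ l)) / (a m / (1 - θ m)) ^ 2 +
        a l / (1 - θ l) / (a m / (1 - θ m)))) atTop (𝓝 0))
    (hhigh : ∀ m l, m < l → (J m : ℝ) * (ε l * a l) ≤ (1 / 2) ^ l) :
    TendstoInDistribution (fun m ω => (a m / (1 - θ m))⁻¹ * partialSum (proc a) (J m) ω) atTop
      (id : ℝ → ℝ) (fun _ => pathLaw θ ε) muP1sL where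
  forall_aemeasurable m := ((measurable_partialSum a (J m)).const_mul _).aemeasurable
  aemeasurable_limit := aemeasurable_id
  tendsto := by
    refine ProbabilityMeasure.tendsto_of_tendsto_charFun fun t => ?_
    change Tendsto (fun m => charFun ((pathLaw θ ε).map
      fun ω => (a m / (1 - θ m))⁻¹ * partialSum (proc a) (J m) ω) t) atTop
      (𝓝 (charFun (muP1sL.map id) t))
    rw [Measure.map_id, charFun_muP1sL]
    have hmain := tendsto_compChar_own_scale hθ hθ1 hε.tendsto_atTop_zero hJ t
    have herr := (hlow.const_mul (3 * t ^ 2 + 2 * |t|)).add (hb.const_div_atTop (2 * |t|))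
    rw [mul_zero, add_zero] at herr
    have hdist := squeeze_zero_norm
      (fun m => norm_charFun_sub_compChar_le hε hθ ha hhigh m t) herr
    have hlim := hdist.add hmain
    rw [zero_add] at hlim
    refine hlim.congr fun m => ?_
    rw [sub_add_cancel, charFun_map_mul_comp (measurable_partialSum a (J m)).aemeasurable]

end Limit

/-! ### Moments and quantiles of the marginal law -/

section Moments

variable {θ ε : ℕ → unitInterval} {a : ℕ → ℝ}

lemma measurePreserving_config (θ ε : ℕ → unitInterval) :
    MeasurePreserving (fun ω : PathSpace => ω.1.1) (pathLaw θ ε) (configLaw ε) :=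
  measurePreserving_fst.comp measurePreserving_fst

lemma stateLaw_map_neg (ε : unitInterval) : (stateLaw ε).map Neg.neg = stateLaw ε := by
  have hm : Measurable (Neg.neg : SignType → SignType) := .of_discrete
  simp only [stateLaw]
  rw [Measure.map_add _ _ hm, Measure.map_add _ _ hm, Measure.map_smul, Measure.map_smul,
    Measure.map_smul, Measure.map_dirac' hm, Measure.map_dirac' hm, Measure.map_dirac' hm, neg_zero,
    neg_neg, add_comm (ENNReal.ofReal (ε / 2) • Measure.dirac (-1))]

/-- The marginal law is symmetric, hence centred. -/
lemma integral_proc_zero (θ ε : ℕ → unitInterval) (a : ℕ → ℝ) :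
    ∫ ω, proc a 0 ω ∂(pathLaw θ ε) = 0 := by
  have hneg : MeasurePreserving (fun (y : Config) j => -(y j)) (configLaw ε) (configLaw ε) := by
    refine ⟨measurable_pi_lambda _ fun j => (Measurable.of_discrete
      (f := fun s : SignType => -s)).comp (measurable_pi_apply j), ?_⟩
    rw [configLaw, Measure.infinitePi_map_pi _ (fun j => (.of_discrete :
      Measurable (Neg.neg : SignType → SignType)))]
    simp_rw [stateLaw_map_neg]
  have h1 : ∫ ω, proc a 0 ω ∂(pathLaw θ ε) = ∫ y, weigh a y ∂(configLaw ε) := by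
    rw [← (measurePreserving_config θ ε).map_eq,
      integral_map (measurePreserving_config θ ε).measurable.aemeasurable
        (measurable_weigh a).aestronglyMeasurable]
    exact integral_congr_ae (Eventually.of_forall (proc_zero a))
  have h2 : ∫ y, weigh a y ∂(configLaw ε) = -∫ y, weigh a y ∂(configLaw ε) := by
    nth_rewrite 1 [← hneg.map_eq]
    rw [integral_map hneg.measurable.aemeasurable (measurable_weigh a).aestronglyMeasurable,
      ← integral_neg]
    refine integral_congr_ae (Eventually.of_forall fun y => ?_)
    simp [weigh, SignType.coe_neg, tsum_neg]
  rw [h1]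
  linarith

/-- Only the top nonzero component matters for the size of the weighted sum. -/
lemma sq_weigh_le (ha : FastWeights a) (y : Config) : ENNReal.ofReal (weigh a y ^ 2) ≤
    ∑' j, {y : Config | y j ≠ 0}.indicator (fun _ => ENNReal.ofReal (4 * a j ^ 2)) y := by
  classical
  by_cases hy : FinSupp y
  · rcases hN : Nat.find hy with _ | N
    · have h0 := Nat.find_spec hy
      rw [hN] at h0
      rw [weigh_eq_sum h0]
      simp
    · have h0 := Nat.find_spec hy
      have hne : y N ≠ 0 := by
        intro h
        refine Nat.find_min hy (m := N) (by omega) fun j hj => ?_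
        rcases hj.eq_or_lt with rfl | hj
        · exact h
        · exact h0 j (by omega)
      rw [hN] at h0
      refine le_trans ?_ (ENNReal.le_tsum N)
      rw [indicator_of_mem (by exact hne)]
      refine ENNReal.ofReal_le_ofReal ?_
      have h := abs_weigh_le ha h0
      rw [← sq_abs]
      nlinarith [abs_nonneg (weigh a y)]
  · rw [weigh_of_not_finSupp ha hy]
    simp

lemma memLp_proc_zero (ha : FastWeights a) (hs : Summable fun j => a j ^ 2 * (ε j : ℝ)) :
    MemLp (proc a 0) 2 (pathLaw θ ε) := by
  rw [memLp_two_iff_integrable_sq (measurable_proc a 0).aestronglyMeasurable]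
  refine ⟨((measurable_proc a 0).pow_const 2).aestronglyMeasurable, ?_⟩
  rw [hasFiniteIntegral_iff_ofReal (Eventually.of_forall fun ω => sq_nonneg _)]
  have hmp := measurePreserving_config θ ε
  have h1 : ∫⁻ ω, ENNReal.ofReal (proc a 0 ω ^ 2) ∂(pathLaw θ ε) =
      ∫⁻ y, ENNReal.ofReal (weigh a y ^ 2) ∂(configLaw ε) := by
    simp_rw [proc_zero]
    exact hmp.lintegral_comp (f := fun y => ENNReal.ofReal (weigh a y ^ 2))
      ((measurable_weigh a).pow_const 2).ennreal_ofReal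
  have hset : ∀ j, MeasurableSet {y : Config | y j ≠ 0} := fun j =>
    (.of_discrete : MeasurableSet {s : SignType | s ≠ 0}).preimage (measurable_pi_apply j)
  have h2 : ∀ j, configLaw ε {y : Config | y j ≠ 0} = ENNReal.ofReal (ε j) := fun j => by
    have h := (measurePreserving_eval_infinitePi (fun j => stateLaw (ε j)) j).measure_preimage
      (MeasurableSet.of_discrete (s := {s : SignType | s ≠ 0})).nullMeasurableSet
    rw [stateLaw_ne_zero] at h
    exact h
  have h3 : ∫⁻ y, ENNReal.ofReal (weigh a y ^ 2) ∂(configLaw ε) ≤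
      ∑' j, ENNReal.ofReal (4 * (a j ^ 2 * ε j)) := by
    refine (lintegral_mono (sq_weigh_le ha)).trans_eq ?_
    rw [lintegral_tsum fun j => (measurable_const.indicator (hset j)).aemeasurable]
    congr 1
    funext j
    rw [lintegral_indicator_const (hset j), h2, ← ENNReal.ofReal_mul (by positivity), mul_assoc]
  rw [h1]
  refine h3.trans_lt ?_
  exact (hs.mul_left 4).tsum_ofReal_lt_top

lemma memLp_partialSum_proc (ha : FastWeights a) (hs : Summable fun j => a j ^ 2 * (ε j : ℝ))
    (n : ℕ) : MemLp (partialSum (proc a) n) 2 (pathLaw θ ε) := by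
  refine memLp_finsetSum _ fun k _ => ?_
  have h := congrArg (fun Q : Measure (ℤ → ℝ) => Q.map fun u => u 0)
    (isStrictlyStationary_proc θ ε a k)
  rw [Measure.map_map (measurable_pi_apply 0)
      (measurable_pi_lambda _ fun i => measurable_proc a (i + k)),
    Measure.map_map (measurable_pi_apply 0) (measurable_pi_lambda _ (measurable_proc a))] at h
  have hid : IdentDistrib (proc a k) (proc a 0) (pathLaw θ ε) (pathLaw θ ε) :=
    ⟨(measurable_proc a k).aemeasurable, (measurable_proc a 0).aemeasurable, by
      simpa [Function.comp_def] using h⟩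
  exact hid.memLp_iff.2 (memLp_proc_zero ha hs)

end Moments

section Quantile

lemma upperQuantile_nonneg {Ω : Type*} [MeasurableSpace Ω] (P : Measure Ω) (W : Ω → ℝ) (u : ℝ) :
    0 ≤ upperQuantile P W u := Real.sInf_nonneg fun _ ht => ht.1

lemma upperQuantile_le {Ω : Type*} [MeasurableSpace Ω] {P : Measure Ω} {W : Ω → ℝ} {u t : ℝ}
    (ht : 0 ≤ t) (h : P.real {ω | t < W ω} ≤ u) : upperQuantile P W u ≤ t :=
  csInf_le ⟨0, fun _ hs => hs.1⟩ ⟨ht, h⟩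

variable {θ ε : ℕ → unitInterval} {a : ℕ → ℝ}

/-- The sum of the `ε i` over `i ≥ j`. -/
def tailSum (ε : ℕ → unitInterval) (j : ℕ) : ℝ := ∑' i, (ε (i + j) : ℝ)

lemma tailSum_eq_add (hε : Summable fun j => (ε j : ℝ)) (j : ℕ) :
    tailSum ε j = ε j + tailSum ε (j + 1) := by
  have h := ((summable_nat_add_iff j).2 hε).tsum_eq_zero_add
  rw [zero_add] at h
  rw [tailSum, h, tailSum]
  congr 2
  funext i
  rw [add_right_comm, add_assoc]

lemma measureReal_exists_ne_zero_le (hε : Summable fun j => (ε j : ℝ)) (j : ℕ) :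
    (pathLaw θ ε).real {ω | ∃ i, ω.1.1 (i + j) ≠ 0} ≤ tailSum ε j := by
  have hset : {ω : PathSpace | ∃ i, ω.1.1 (i + j) ≠ 0} = ⋃ i, {ω | ω.1.1 (i + j) ≠ 0} := by
    ext; simp
  have h1 : ∀ i, pathLaw θ ε {ω | ω.1.1 i ≠ 0} = ENNReal.ofReal (ε i) := fun i => by
    have h := ((measurePreserving_eval_infinitePi (fun j => stateLaw (ε j)) i).comp
      (measurePreserving_config θ ε)).measure_preimage
      (MeasurableSet.of_discrete (s := {s : SignType | s ≠ 0})).nullMeasurableSet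
    rw [stateLaw_ne_zero] at h
    exact h
  have hs := (summable_nat_add_iff j).2 hε
  have h2 : pathLaw θ ε {ω | ∃ i, ω.1.1 (i + j) ≠ 0} ≤ ENNReal.ofReal (tailSum ε j) := by
    rw [hset, tailSum, ENNReal.ofReal_tsum_of_nonneg (fun i => (ε (i + j)).2.1) hs]
    refine (measure_iUnion_le _).trans_eq ?_
    simp_rw [h1]
  exact ENNReal.toReal_le_of_le_ofReal (tsum_nonneg fun i => (ε (i + j)).2.1) h2

/-- The weighted sum exceeds `2 * a j` only if a component beyond `j` is nonzero. -/
lemma upperQuantile_proc_le (ha : FastWeights a) (hε : Summable fun j => (ε j : ℝ)) {j : ℕ} {u : ℝ}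
    (hu : tailSum ε (j + 1) ≤ u) :
    upperQuantile (pathLaw θ ε) (fun ω => |proc a 0 ω|) u ≤ 2 * a j := by
  refine upperQuantile_le (by linarith [ha.pos j]) (le_trans ?_
    ((measureReal_exists_ne_zero_le (θ := θ) hε (j + 1)).trans hu))
  refine measureReal_mono fun ω hω => ?_
  by_contra hcon
  simp only [mem_ofPred_eq, not_exists, not_not] at hcon hω
  refine absurd hω (not_lt.2 ?_)
  rw [proc_zero]
  refine abs_weigh_le ha fun i hi => ?_
  obtain ⟨k, rfl⟩ := Nat.exists_eq_add_of_le' hi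
  exact hcon k

lemma upperQuantile_proc_eq_zero (hε : Summable fun j => (ε j : ℝ)) {u : ℝ}
    (hu : tailSum ε 0 ≤ u) :
    upperQuantile (pathLaw θ ε) (fun ω => |proc a 0 ω|) u = 0 := by
  refine le_antisymm (upperQuantile_le le_rfl (le_trans ?_
    ((measureReal_exists_ne_zero_le (θ := θ) hε 0).trans hu))) (upperQuantile_nonneg _ _ _)
  refine measureReal_mono fun ω hω => ?_
  by_contra hcon
  simp only [mem_ofPred_eq, not_exists, not_not, add_zero] at hcon hω
  rw [proc_zero, weigh_eq_sum (N := 0) fun i _ => hcon i] at hω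
  simp at hω

lemma exists_tailSum_le (ε : ℕ → unitInterval) {u : ℝ} (hu : 0 < u) :
    ∃ j, tailSum ε j ≤ u :=
  ((tendsto_sum_nat_add fun j => (ε j : ℝ)).eventually_le_const hu).exists

/-- On the interval between two successive tail sums, of length `ε j`, the quantile is at most
`2 * a j`. -/
lemma sq_upperQuantile_proc_le (ha : FastWeights a) (hε : Summable fun j => (ε j : ℝ)) {u : ℝ}
    (hu : 0 < u) :
    ENNReal.ofReal (upperQuantile (pathLaw θ ε) (fun ω => |proc a 0 ω|) u ^ 2) ≤
      ∑' j, (Ico (tailSum ε (j + 1)) (tailSum ε j)).indicator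
        (fun _ => ENNReal.ofReal (4 * a j ^ 2)) u := by
  classical
  have hex := exists_tailSum_le ε hu
  rcases hN : Nat.find hex with _ | N
  · have h0 := Nat.find_spec hex
    rw [hN] at h0
    rw [upperQuantile_proc_eq_zero hε h0]
    simp
  · have h0 := Nat.find_spec hex
    have hlt : u < tailSum ε N := not_le.1 (Nat.find_min hex (by omega))
    rw [hN] at h0
    refine le_trans ?_ (ENNReal.le_tsum N)
    rw [indicator_of_mem (by exact ⟨h0, hlt⟩)]
    refine ENNReal.ofReal_le_ofReal ?_
    have h := upperQuantile_proc_le (θ := θ) ha hε h0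
    nlinarith [upperQuantile_nonneg (pathLaw θ ε) (fun ω => |proc a 0 ω|) u]

/-- The infimum that defines the quantile is over a nonempty set for `u > 0`, so no default value
interferes with monotonicity. -/
lemma antitoneOn_upperQuantile_proc (ha : FastWeights a) (hε : Summable fun j => (ε j : ℝ)) :
    AntitoneOn (upperQuantile (pathLaw θ ε) fun ω => |proc a 0 ω|) (Ioi 0) := by
  intro u hu v _ huv
  obtain ⟨j, hj⟩ := exists_tailSum_le ε hu
  refine csInf_le_csInf ⟨0, fun _ hs => hs.1⟩ ⟨2 * a j, by linarith [ha.pos j], ?_⟩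
    fun t ht => ⟨ht.1, ht.2.trans huv⟩
  refine le_trans (measureReal_mono fun ω hω => ?_)
    ((measureReal_exists_ne_zero_le (θ := θ) hε j).trans hj)
  by_contra hcon
  simp only [mem_ofPred_eq, not_exists, not_not] at hcon hω
  refine absurd hω (not_lt.2 ?_)
  rw [proc_zero]
  refine abs_weigh_le ha fun i hi => ?_
  obtain ⟨k, rfl⟩ := Nat.exists_eq_add_of_le' (Nat.le_of_succ_le hi)
  exact hcon k

/-- Integrability of the squared quantile function, and a bound for its integral near `0`: the
component `j` contributes at most `4 a j ^ 2` on a set of length at most `min (ε j) x`. -/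
lemma integral_sq_upperQuantile_proc_le (ha : FastWeights a) (hε : Summable fun j => (ε j : ℝ))
    {x C : ℝ} (hx : 0 ≤ x)
    (hC : ∀ N, ∑ j ∈ Finset.range N, a j ^ 2 * min (ε j : ℝ) x ≤ C) :
    IntegrableOn (fun u => upperQuantile (pathLaw θ ε) (fun ω => |proc a 0 ω|) u ^ 2) (Ioc 0 x) ∧
      ∫ u in (0 : ℝ)..x, upperQuantile (pathLaw θ ε) (fun ω => |proc a 0 ω|) u ^ 2 ≤ 4 * C := by
  set Q := upperQuantile (pathLaw θ ε) fun ω => |proc a 0 ω|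
  have hC0 : 0 ≤ C := by simpa using hC 0
  have hm : AEStronglyMeasurable (fun u => Q u ^ 2) (volume.restrict (Ioc 0 x)) :=
    ((aemeasurable_restrict_of_antitoneOn measurableSet_Ioc
      ((antitoneOn_upperQuantile_proc ha hε).mono Ioc_subset_Ioi_self)).pow_const 2
      ).aestronglyMeasurable
  have hlin : ∫⁻ u in Ioc 0 x, ENNReal.ofReal (Q u ^ 2) ≤ ENNReal.ofReal (4 * C) := by
    calc ∫⁻ u in Ioc 0 x, ENNReal.ofReal (Q u ^ 2)
        ≤ ∫⁻ u in Ioc 0 x, ∑' j, (Ico (tailSum ε (j + 1)) (tailSum ε j)).indicator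
            (fun _ => ENNReal.ofReal (4 * a j ^ 2)) u :=
          setLIntegral_mono' measurableSet_Ioc fun u hu => sq_upperQuantile_proc_le ha hε hu.1
      _ = ∑' j, ENNReal.ofReal (4 * a j ^ 2) *
            volume (Ico (tailSum ε (j + 1)) (tailSum ε j) ∩ Ioc 0 x) := by
          rw [lintegral_tsum fun j =>
            (measurable_const.indicator measurableSet_Ico).aemeasurable]
          congr 1
          funext j
          rw [lintegral_indicator_const measurableSet_Ico, Measure.restrict_apply measurableSet_Ico]
      _ ≤ ∑' j, ENNReal.ofReal (4 * (a j ^ 2 * min (ε j : ℝ) x)) := by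
          refine ENNReal.tsum_le_tsum fun j => ?_
          have h4 : (4 : ℝ) * (a j ^ 2 * min (ε j : ℝ) x) = 4 * a j ^ 2 * min (ε j : ℝ) x := by ring
          rw [h4, ENNReal.ofReal_mul (p := 4 * a j ^ 2) (by positivity), ENNReal.ofReal_min]
          refine mul_le_mul' le_rfl (le_min ?_ ?_)
          · refine (measure_mono inter_subset_left).trans_eq ?_
            rw [Real.volume_Ico, tailSum_eq_add hε j, add_sub_cancel_right]
          · refine (measure_mono inter_subset_right).trans_eq ?_
            rw [Real.volume_Ioc, sub_zero]
      _ ≤ ENNReal.ofReal (4 * C) := by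
          refine ENNReal.tsum_le_of_sum_range_le fun N => ?_
          rw [← ENNReal.ofReal_sum_of_nonneg fun j _ => by
            have := (ε j).2.1
            positivity, ← Finset.mul_sum]
          exact ENNReal.ofReal_le_ofReal (mul_le_mul_of_nonneg_left (hC N) (by norm_num))
  have hint : IntegrableOn (fun u => Q u ^ 2) (Ioc 0 x) :=
    ⟨hm, (hasFiniteIntegral_iff_ofReal (Eventually.of_forall fun u => sq_nonneg _)).2
      (hlin.trans_lt ENNReal.ofReal_lt_top)⟩
  refine ⟨hint, ?_⟩
  rw [intervalIntegral.integral_of_le hx, integral_eq_lintegral_of_nonneg_ae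
    (Eventually.of_forall fun u => sq_nonneg _) hm]
  exact ENNReal.toReal_le_of_le_ofReal (by positivity) hlin

end Quantile

/-! ### The rate function -/

/-- The properties of a mixing rate `f` and its logarithmic rate of decay `h = -f' / f` on which the
choice of the parameters rests. -/
structure RateData (f h : ℝ → ℝ) (w : ℝ) : Prop where
  one_lt : 1 < w
  pos : ∀ x, 1 ≤ x → 0 < f x
  le_one : ∀ x, 1 ≤ x → f x ≤ 1
  antitone_h : AntitoneOn h (Ioi 1)
  one_le_mul : ∀ x, w < x → 1 ≤ x * h x
  tendsto_h : Tendsto h atTop (𝓝 0)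
  /-- The graph of `log f` lies above its tangent at `x`. -/
  tangent : ∀ x y, 1 < x → 1 ≤ y → f x * Real.exp (h x * (x - y)) ≤ f y
  antitone_mul : AntitoneOn (fun x => x * f x) (Ici w)

/-- Convexity of `log f` makes `h = -f' / f` nonincreasing and yields the tangent bound,
monotonicity of `x f x` gives `1 ≤ x h x`, and subexponential decay forces `h → 0`. -/
lemma rateData_neg_deriv_div {f : ℝ → ℝ} {w : ℝ}
    (hf_range : ∀ x ∈ Ici (1 : ℝ), 0 < f x ∧ f x ≤ 1)
    (hf_smooth : ContDiffOn ℝ 2 f (Ioi 1))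
    (hf_slow : ∀ c : ℝ, 0 < c → Tendsto (fun x => Real.exp (c * x) * f x) atTop atTop)
    (hw : 1 < w) (hf_mul : AntitoneOn (fun x => x * f x) (Ici w))
    (hf_logconvex : ConvexOn ℝ (Ici 1) (fun x => Real.log (f x))) :
    RateData f (fun x => -deriv f x / f x) w := by
  have hpos : ∀ x, 1 ≤ x → 0 < f x := fun x hx => (hf_range x hx).1
  have hdiff : ∀ x, 1 < x → DifferentiableAt ℝ f x := fun x hx =>
    ((hf_smooth.differentiableOn (by norm_num)) x hx).differentiableAt (Ioi_mem_nhds hx)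
  have hlog : ∀ x, 1 < x → HasDerivAt (fun x => Real.log (f x)) (-(-deriv f x / f x)) x := by
    intro x hx
    have h := (hdiff x hx).hasDerivAt.log (hpos x hx.le).ne'
    convert h using 1
    ring
  have htan : ∀ x y, 1 < x → 1 ≤ y →
      f x * Real.exp (-deriv f x / f x * (x - y)) ≤ f y := by
    intro x y hx hy
    set h := -deriv f x / f x
    have hle : Real.log (f x) + h * (x - y) ≤ Real.log (f y) := by
      rcases lt_trichotomy x y with hxy | rfl | hxy
      · have h1 := hf_logconvex.le_slope_of_hasDerivAt hx.le hy hxy (hlog x hx)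
        rw [slope_def_field, le_div_iff₀ (by linarith)] at h1
        linarith
      · simp
      · have h1 := hf_logconvex.slope_le_of_hasDerivAt hy hx.le hxy (hlog x hx)
        rw [slope_def_field, div_le_iff₀ (by linarith)] at h1
        linarith
    have h2 := Real.exp_le_exp.2 hle
    rwa [Real.exp_add, Real.exp_log (hpos x hx.le), Real.exp_log (hpos y hy)] at h2
  have hmono : AntitoneOn (fun x => -deriv f x / f x) (Ioi 1) := by
    have h1 := (hf_logconvex.subset Ioi_subset_Ici_self (convex_Ioi 1)).monotoneOn_deriv
      fun x hx => (hlog x hx).differentiableAt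
    intro x hx y hy hxy
    have h2 := h1 hx hy hxy
    rw [(hlog x hx).deriv, (hlog y hy).deriv] at h2
    exact neg_le_neg_iff.1 h2
  have hone : ∀ x, w < x → 1 ≤ x * (-deriv f x / f x) := by
    intro x hx
    have hx1 : 1 < x := hw.trans hx
    have h1 := (hasDerivAt_id x).mul (hdiff x hx1).hasDerivAt
    have h2 := hf_mul.derivWithin_nonpos (x := x)
    have h3 : derivWithin (fun x => x * f x) (Ici w) x = 1 * f x + x * deriv f x := by
      rw [derivWithin_of_mem_nhds (Ici_mem_nhds hx)]
      exact h1.deriv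
    rw [h3] at h2
    rw [← mul_div_assoc, le_div_iff₀ (hpos x hx1.le)]
    linarith
  refine ⟨hw, hpos, fun x hx => (hf_range x hx).2, hmono, hone, ?_, htan, hf_mul⟩
  have hnn : ∀ᶠ x in atTop, 0 ≤ -deriv f x / f x := by
    filter_upwards [eventually_gt_atTop w] with x hx
    have h1 := hone x hx
    by_contra hneg
    nlinarith
  refine tendsto_order.2 ⟨fun b hb => hnn.mono fun x hx => hb.trans_le hx, fun c hc => ?_⟩
  -- if `h ≥ c` throughout, then `f` would decay at least like `exp (-c x)`
  obtain ⟨y, hy1, hyc⟩ : ∃ y, 1 < y ∧ -deriv f y / f y < c := by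
    by_contra! hcon
    have hbd : ∀ᶠ x in atTop, Real.exp (c * x) * f x ≤ f 2 * Real.exp (c * 2) := by
      filter_upwards [eventually_gt_atTop 2] with x hx
      have h1 := htan x 2 (by linarith) (by norm_num)
      have h2 : f x * Real.exp (c * (x - 2)) ≤ f 2 := by
        refine le_trans ?_ h1
        have := hpos x (by linarith)
        have := hcon x (by linarith)
        have : 0 ≤ x - 2 := by linarith
        gcongr
      calc Real.exp (c * x) * f x = f x * Real.exp (c * (x - 2)) * Real.exp (c * 2) := by
            rw [mul_assoc, ← Real.exp_add, mul_comm]; congr 2; ring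
        _ ≤ _ := by gcongr
    obtain ⟨x, hx1, hx2⟩ := (hbd.and ((hf_slow c hc).eventually_gt_atTop _)).exists
    exact absurd hx1 (not_le.2 hx2)
  filter_upwards [eventually_ge_atTop y] with x hx
  exact (hmono hy1 (hy1.trans_le hx) hx).trans_lt hyc

namespace RateData

variable {f h : ℝ → ℝ} {w : ℝ}

lemma pos_h (d : RateData f h w) {x : ℝ} (hx : w < x) : 0 < h x := by
  have h1 := d.one_le_mul x hx
  have h2 := d.one_lt
  by_contra hneg
  nlinarith

lemma inv_le_h (d : RateData f h w) {x : ℝ} (hx : w < x) : x⁻¹ ≤ h x := by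
  have h1 := d.one_le_mul x hx
  have h2 := d.one_lt
  rwa [inv_le_iff_one_le_mul₀' (by linarith)]

/-- The height at the point `1 / h x` of the exponential curve that is tangent to `f` at `x`. -/
def height (f h : ℝ → ℝ) (x : ℝ) : ℝ := f x * Real.exp (h x * x - 1)

lemma height_pos (d : RateData f h w) {x : ℝ} (hx : 1 ≤ x) : 0 < height f h x :=
  mul_pos (d.pos x hx) (Real.exp_pos _)

/-- The tangent bound at the point `(h x)⁻¹`. -/
lemma height_le (d : RateData f h w) {x : ℝ} (hx : w < x) (hh : h x ≤ w⁻¹) :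
    height f h x ≤ f (h x)⁻¹ ∧ w ≤ (h x)⁻¹ := by
  have h1 := d.pos_h hx
  have h2 := d.one_lt
  have h3 : w ≤ (h x)⁻¹ := (le_inv_comm₀ (by linarith) h1).2 hh
  have h4 := d.tangent x (h x)⁻¹ (by linarith) (by linarith)
  rw [mul_sub, mul_inv_cancel₀ h1.ne'] at h4
  exact ⟨h4, h3⟩

lemma height_le_one (d : RateData f h w) {x : ℝ} (hx : w < x) (hh : h x ≤ w⁻¹) :
    height f h x ≤ 1 := by
  obtain ⟨h1, h2⟩ := d.height_le hx hh
  exact h1.trans (d.le_one _ (d.one_lt.le.trans h2))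

lemma height_le_mul (d : RateData f h w) {x : ℝ} (hx : w < x) (hh : h x ≤ w⁻¹) :
    height f h x ≤ w * f w * h x := by
  obtain ⟨h1, h2⟩ := d.height_le hx hh
  have h3 := d.antitone_mul self_mem_Ici h2 h2
  have h4 := d.pos_h hx
  refine h1.trans ?_
  simp only at h3
  rw [inv_mul_le_iff₀ h4] at h3
  linarith

/-- The tangent bound in the form that controls the mixing rate. -/
lemma height_mul_exp_le (d : RateData f h w) {x : ℝ} (hx : w < x) {n : ℕ} (hn : 1 ≤ n) :
    height f h x * Real.exp (-h x) ^ n ≤ f n := by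
  have h1 := d.tangent x n (d.one_lt.trans hx) (by exact_mod_cast hn)
  refine le_trans ?_ h1
  rw [height, mul_assoc, ← Real.exp_nat_mul, ← Real.exp_add]
  have := d.pos x (d.one_lt.trans hx).le
  gcongr
  linarith

/-- The contribution to the quantile integral at `x` of a component located at `y ≤ x`. The bound
combines `x f x ≤ y f y`, `t ≤ exp (t - 1)` for `t = y h y`, and `x⁻¹ ≤ h x`. -/
lemma mul_div_height_le (d : RateData f h w) {x y : ℝ} (hy : w < y) (hyx : y ≤ x) :
    h y * f x / height f h y ≤ h x := by
  have hy0 : 0 < y := by linarith [d.one_lt]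
  have hx0 : 0 < x := hy0.trans_le hyx
  have h1 := d.antitone_mul (mem_Ici.2 hy.le) (mem_Ici.2 (hy.le.trans hyx)) hyx
  simp only at h1
  have h2 := d.inv_le_h (hy.trans_le hyx)
  have h3 := d.pos_h hy
  have h4 : h y * y ≤ Real.exp (h y * y - 1) := by
    have := Real.add_one_le_exp (h y * y - 1); linarith
  have h5 := d.height_pos (d.one_lt.trans hy).le
  have h6 := d.pos y (d.one_lt.trans hy).le
  refine le_trans ?_ h2
  rw [div_le_iff₀ h5, inv_mul_eq_div, le_div_iff₀ hx0, height]
  calc h y * f x * x = h y * (x * f x) := by ring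
    _ ≤ h y * (y * f y) := by gcongr
    _ = f y * (h y * y) := by ring
    _ ≤ _ := by gcongr

end RateData

/-! ### Choice of the parameters -/

/-- Recursive choice of a sequence whose terms satisfy `Q` and whose successive terms satisfy `R`. -/
lemma exists_seq_of_step {α : Type*} {Q : ℕ → α → Prop} {R : ℕ → α → α → Prop}
    (h0 : ∃ p, Q 0 p) (hs : ∀ n p, Q n p → ∃ q, Q (n + 1) q ∧ R n p q) :
    ∃ u : ℕ → α, (∀ n, Q n (u n)) ∧ ∀ n, R n (u n) (u (n + 1)) := by
  obtain ⟨p0, hp0⟩ := h0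
  choose! F hF using hs
  set u : ℕ → α := fun n => Nat.rec p0 (fun n p => F n p) n with hu
  have hQ : ∀ n, Q n (u n) := fun n => by
    induction n with
    | zero => exact hp0
    | succ n ih => exact (hF n _ ih).1
  exact ⟨u, hQ, fun n => (hF n _ (hQ n)).2⟩

/-- The share of the component `j` in the mixing rate. -/
def share (j : ℕ) : ℝ := (1 / 2) ^ (j + 3)

lemma share_pos (j : ℕ) : 0 < share j := by unfold share; positivity

lemma share_le (j : ℕ) : share j ≤ 1 / 8 := by
  rw [share, pow_add]
  have : (1 / 2 : ℝ) ^ j ≤ 1 := pow_le_one₀ (by norm_num) (by norm_num)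
  linarith

lemma summable_share : Summable share := by
  simp_rw [funext fun j => (show share j = (1 / 2) ^ j * (1 / 2) ^ 3 from pow_add _ _ _)]
  exact summable_geometric_two.mul_right _

lemma sum_share_le (N : ℕ) : ∑ j ∈ Finset.range N, 2 * share j ≤ 1 := by
  have h1 : ∑ j ∈ Finset.range N, (1 / 2 : ℝ) ^ j ≤ 2 :=
    (summable_geometric_two.sum_le_tsum _ fun l _ => by positivity).trans_eq tsum_geometric_two
  have h2 : ∀ j ∈ Finset.range N, 2 * share j = 1 / 4 * (1 / 2 : ℝ) ^ j := fun j _ => by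
    rw [share, pow_add]; ring
  rw [Finset.sum_congr rfl h2, ← Finset.mul_sum]
  linarith

section Stage

variable (f h : ℝ → ℝ) (j : ℕ) (x K : ℝ)

/-- The probability that the component `j` with location parameter `x` is not `0`. -/
def rarity : ℝ := share j * RateData.height f h x

/-- The probability of refreshing in one step. -/
def refresh : ℝ := 1 - Real.exp (-h x)

/-- The weight of a component with variance `h x * K`. -/
def weight : ℝ := √(h x * K / rarity f h j x)

/-- The time in which the component is expected to leave `0` once. -/
def timeScale : ℕ := ⌈1 / (rarity f h j x * refresh h x)⌉₊

/-- The typical size of an excursion sum of the component. -/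
def spaceScale : ℝ := weight f h j x K / refresh h x

end Stage

section Stage

variable {f h : ℝ → ℝ} {w x K : ℝ} {j : ℕ}

lemma refresh_pos (d : RateData f h w) (hx : w < x) : 0 < refresh h x := by
  have := Real.exp_lt_one_iff.2 (neg_lt_zero.2 (d.pos_h hx))
  unfold refresh; linarith

lemma refresh_lt_one : refresh h x < 1 := by
  have := Real.exp_pos (-h x)
  unfold refresh; linarith

lemma refresh_le : refresh h x ≤ h x := by
  have := Real.one_sub_le_exp_neg (h x)
  unfold refresh; linarith

lemma le_two_mul_refresh (d : RateData f h w) (hx : w < x) (hh : h x ≤ w⁻¹) :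
    h x ≤ 2 * refresh h x := by
  have h0 := d.pos_h hx
  have h1 : h x ≤ 1 := hh.trans (inv_le_one_of_one_le₀ d.one_lt.le)
  have h2 : Real.exp (-h x) ≤ 1 / (1 + h x) := by
    rw [Real.exp_neg, ← one_div]
    have := Real.add_one_le_exp (h x)
    gcongr
    linarith
  have h3 : 1 / (1 + h x) ≤ 1 - h x / 2 := by
    rw [div_le_iff₀ (by linarith)]; nlinarith
  unfold refresh
  linarith

lemma rarity_pos (d : RateData f h w) (hx : w < x) : 0 < rarity f h j x :=
  mul_pos (share_pos j) (d.height_pos (d.one_lt.trans hx).le)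

lemma rarity_le (d : RateData f h w) (hx : w < x) (hh : h x ≤ w⁻¹) : rarity f h j x ≤ share j :=
  mul_le_of_le_one_right (share_pos j).le (d.height_le_one hx hh)

lemma rarity_le_one_eighth (d : RateData f h w) (hx : w < x) (hh : h x ≤ w⁻¹) :
    rarity f h j x ≤ 1 / 8 := (rarity_le d hx hh).trans (share_le j)

lemma weight_sq (d : RateData f h w) (hx : w < x) (hK : 0 ≤ K) :
    weight f h j x K ^ 2 = h x * K / rarity f h j x :=
  Real.sq_sqrt (div_nonneg (mul_nonneg (d.pos_h hx).le hK) (rarity_pos d hx).le)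

lemma weight_sq_mul_rarity (d : RateData f h w) (hx : w < x) (hK : 0 ≤ K) :
    weight f h j x K ^ 2 * rarity f h j x = h x * K := by
  rw [weight_sq d hx hK, div_mul_cancel₀ _ (rarity_pos d hx).ne']

lemma weight_pos (d : RateData f h w) (hx : w < x) (hK : 0 < K) : 0 < weight f h j x K :=
  Real.sqrt_pos.2 (div_pos (mul_pos (d.pos_h hx) hK) (rarity_pos d hx))

/-- Since the height is `O(h x)`, a large multiplier `K` makes the weight large, whatever `x` is. -/
lemma le_weight {s : ℝ} (d : RateData f h w) (hx : w < x) (hh : h x ≤ w⁻¹)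
    (hK : w * f w * s ^ 2 ≤ K) : s ≤ weight f h j x K := by
  refine Real.le_sqrt_of_sq_le ?_
  rw [le_div_iff₀ (rarity_pos d hx)]
  have h1 : rarity f h j x ≤ w * f w * h x :=
    (mul_le_of_le_one_left (d.height_pos (d.one_lt.trans hx).le).le
      ((share_le j).trans (by norm_num))).trans (d.height_le_mul hx hh)
  calc s ^ 2 * rarity f h j x ≤ s ^ 2 * (w * f w * h x) := by gcongr
    _ = h x * (w * f w * s ^ 2) := by ring
    _ ≤ h x * K := by have := d.pos_h hx; gcongr

lemma le_timeScale_mul (d : RateData f h w) (hx : w < x) :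
    1 ≤ timeScale f h j x * (rarity f h j x * refresh h x) := by
  rw [← div_le_iff₀ (mul_pos (rarity_pos d hx) (refresh_pos d hx))]
  exact Nat.le_ceil _

lemma timeScale_mul_le (d : RateData f h w) (hx : w < x) :
    timeScale f h j x * (rarity f h j x * refresh h x) ≤ 1 + rarity f h j x * refresh h x := by
  have h0 := mul_pos (rarity_pos (j := j) d hx) (refresh_pos d hx)
  have h1 := (Nat.ceil_lt_add_one (one_div_pos.2 h0).le).le
  calc timeScale f h j x * (rarity f h j x * refresh h x)
      ≤ (1 / (rarity f h j x * refresh h x) + 1) * (rarity f h j x * refresh h x) := by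
        unfold timeScale; gcongr
    _ = _ := by rw [add_mul, one_div_mul_cancel h0.ne', one_mul]

lemma timeScale_pos (d : RateData f h w) (hx : w < x) : 0 < timeScale f h j x :=
  Nat.ceil_pos.2 (one_div_pos.2 (mul_pos (rarity_pos d hx) (refresh_pos d hx)))

lemma spaceScale_pos (d : RateData f h w) (hx : w < x) (hK : 0 < K) : 0 < spaceScale f h j x K :=
  div_pos (weight_pos d hx hK) (refresh_pos d hx)

end Stage

/-- The conditions on the locations `x j` and the variance multipliers `K j` of the components. -/
structure Params (f g h : ℝ → ℝ) (w : ℝ) (x K : ℕ → ℝ) : Prop where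
  lt_x : ∀ j, w < x j
  h_le : ∀ j, h (x j) ≤ w⁻¹
  one_le_K : ∀ j, 1 ≤ K j
  le_g : ∀ j y, x j ≤ y → 2 * (K j / share j) ≤ g y
  le_K_zero : w * f w ≤ K 0
  x_succ : ∀ j, x j + 1 ≤ x (j + 1)
  K_succ : ∀ j, 4 ^ (j + 1) * K j ≤ K (j + 1)
  weight_le_K : ∀ j, w * f w * (5 * weight f h j (x j) (K j)) ^ 2 ≤ K (j + 1)
  variance_le : ∀ j, h (x (j + 1)) * K (j + 1) ≤ (1 / 2) ^ (j + 1) * h (x j)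
  variance_le_sq : ∀ j,
    h (x (j + 1)) * K (j + 1) ≤ ((1 / 2) ^ (j + 1) / timeScale f h j (x j)) ^ 2
  h_succ_time : ∀ j, h (x (j + 1)) * (timeScale f h j (x j) + 1) ≤ 1
  h_succ_space : ∀ j, h (x (j + 1)) * (4 ^ (j + 1) * spaceScale f h j (x j) (K j)) ≤ 1
  variance_le_g : ∀ j y, x j ≤ y → y ≤ x (j + 1) → h (x (j + 1)) * K (j + 1) ≤ h y * g y

/-- The parameters can be chosen recursively. The new multiplier `K'` is fixed by the previous stage;
each condition on the new location then holds for all sufficiently large values, since `h → 0` and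
`g → ∞`. -/
lemma RateData.exists_params {f g h : ℝ → ℝ} {w : ℝ} (d : RateData f h w)
    (hg1 : ∀ x ∈ Ici (1 : ℝ), 1 ≤ g x) (hg : Tendsto g atTop atTop) :
    ∃ x K : ℕ → ℝ, Params f g h w x K := by
  have hev_g : ∀ c : ℝ, ∀ᶠ x in atTop, ∀ y, x ≤ y → c ≤ g y := fun c => by
    obtain ⟨x0, hx0⟩ := eventually_atTop.1 (hg.eventually_ge_atTop c)
    filter_upwards [eventually_ge_atTop x0] with x hx y hy
    exact hx0 y (hx.trans hy)
  have hev_h : ∀ c δ : ℝ, 0 < δ → ∀ᶠ x in atTop, h x * c ≤ δ := fun c δ hδ => by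
    have h1 := d.tendsto_h.mul_const c
    rw [zero_mul] at h1
    exact h1.eventually_le_const hδ
  have hw0 : 0 < w⁻¹ := inv_pos.2 (by linarith [d.one_lt])
  have hev_w : ∀ᶠ x in atTop, h x ≤ w⁻¹ := d.tendsto_h.eventually_le_const hw0
  have hM : 0 < w * f w := mul_pos (by linarith [d.one_lt]) (d.pos w d.one_lt.le)
  let Q : ℕ → ℝ × ℝ → Prop := fun j p => w < p.1 ∧ h p.1 ≤ w⁻¹ ∧ 1 ≤ p.2 ∧
    (∀ y, p.1 ≤ y → 2 * (p.2 / share j) ≤ g y) ∧ (j = 0 → w * f w ≤ p.2)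
  let R : ℕ → ℝ × ℝ → ℝ × ℝ → Prop := fun j p q => p.1 + 1 ≤ q.1 ∧ 4 ^ (j + 1) * p.2 ≤ q.2 ∧
      w * f w * (5 * weight f h j p.1 p.2) ^ 2 ≤ q.2 ∧
      h q.1 * q.2 ≤ (1 / 2) ^ (j + 1) * h p.1 ∧
      h q.1 * q.2 ≤ ((1 / 2) ^ (j + 1) / timeScale f h j p.1) ^ 2 ∧
      h q.1 * (timeScale f h j p.1 + 1) ≤ 1 ∧
      h q.1 * (4 ^ (j + 1) * spaceScale f h j p.1 p.2) ≤ 1 ∧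
      ∀ y, p.1 ≤ y → y ≤ q.1 → h q.1 * q.2 ≤ h y * g y
  suffices hseq : ∃ u : ℕ → ℝ × ℝ, (∀ j, Q j (u j)) ∧ ∀ j, R j (u j) (u (j + 1)) by
    obtain ⟨u, hQ, hR⟩ := hseq
    exact ⟨fun j => (u j).1, fun j => (u j).2, fun j => (hQ j).1, fun j => (hQ j).2.1,
        fun j => (hQ j).2.2.1, fun j => (hQ j).2.2.2.1, (hQ 0).2.2.2.2 rfl, fun j => (hR j).1,
        fun j => (hR j).2.1, fun j => (hR j).2.2.1, fun j => (hR j).2.2.2.1,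
        fun j => (hR j).2.2.2.2.1, fun j => (hR j).2.2.2.2.2.1, fun j => (hR j).2.2.2.2.2.2.1,
        fun j => (hR j).2.2.2.2.2.2.2⟩
  refine exists_seq_of_step ?_ ?_
  · set K0 := max 1 (w * f w)
    obtain ⟨x, hx1, hx2, hx3⟩ := ((eventually_gt_atTop w).and
      (hev_w.and (hev_g (2 * (K0 / share 0))))).exists
    exact ⟨(x, K0), hx1, hx2, le_max_left _ _, hx3, fun _ => le_max_right _ _⟩
  · rintro j ⟨x, K⟩ ⟨hx, hh, hK, -, -⟩
    simp only at hx hh hK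
    have hK0 : 0 < K := by linarith
    have hhx := d.pos_h hx
    set K' := max (4 ^ (j + 1) * K) (w * f w * (5 * weight f h j x K) ^ 2) with hK'
    have hK'1 : 1 ≤ K' := by
      refine le_trans ?_ (le_max_left _ _)
      have : (1 : ℝ) ≤ 4 ^ (j + 1) := one_le_pow₀ (by norm_num)
      nlinarith
    -- beyond `y` the growth of `g` pays for `K'`; up to `y` a small value of `h x'` does
    obtain ⟨y, hy1, hy2⟩ := ((eventually_gt_atTop w).and (hev_g K')).exists
    have hhy := d.pos_h hy1
    have hJ : (0 : ℝ) < timeScale f h j x := Nat.cast_pos.2 (timeScale_pos d hx)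
    obtain ⟨x', e1, e2, e3, e4, e5, e6, e7, e8⟩ := ((eventually_ge_atTop (x + 1)).and
      (hev_w.and ((hev_g (2 * (K' / share (j + 1)))).and
      ((hev_h K' ((1 / 2) ^ (j + 1) * h x) (by positivity)).and
      ((hev_h K' (((1 / 2) ^ (j + 1) / timeScale f h j x) ^ 2) (by positivity)).and
      ((hev_h (timeScale f h j x + 1) 1 one_pos).and
      ((hev_h (4 ^ (j + 1) * spaceScale f h j x K) 1 one_pos).and
      (hev_h K' (h y) hhy)))))))).exists
    have hx' : w < x' := by linarith
    refine ⟨(x', K'), ⟨hx', e2, hK'1, e3, fun h => absurd h (Nat.succ_ne_zero j)⟩, e1,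
      le_max_left _ _, le_max_right _ _, e4, e5, e6, e7, fun z hz hz' => ?_⟩
    simp only at hz hz' ⊢
    have hwz : w < z := hx.trans_le hz
    have h1 : ∀ {s : ℝ}, w < s → s ∈ Ioi (1 : ℝ) := fun hs => d.one_lt.trans hs
    rcases le_total y z with hyz | hzy
    · exact mul_le_mul (d.antitone_h (h1 hwz) (h1 hx') hz') (hy2 z hyz) (by linarith)
        (d.pos_h hwz).le
    · calc h x' * K' ≤ h y := e8
        _ ≤ h z := d.antitone_h (h1 hwz) (h1 hy1) hzy
        _ ≤ h z * g z := le_mul_of_one_le_right (d.pos_h hwz).le (hg1 z (d.one_lt.trans hwz).le)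

/-! ### Consequences of the choice of the parameters -/

namespace Params

variable {f g h : ℝ → ℝ} {w : ℝ} {x K : ℕ → ℝ}

lemma K_pos (p : Params f g h w x K) (j : ℕ) : 0 < K j := one_pos.trans_le (p.one_le_K j)

lemma fastWeights (p : Params f g h w x K) (d : RateData f h w) :
    FastWeights fun j => weight f h j (x j) (K j) where
  one_le := le_weight d (p.lt_x 0) (p.h_le 0) (by simpa using p.le_K_zero)
  five_mul_le j := le_weight d (p.lt_x _) (p.h_le _) (p.weight_le_K j)

lemma summable_rarity (p : Params f g h w x K) (d : RateData f h w) :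
    Summable fun j => rarity f h j (x j) :=
  summable_share.of_nonneg_of_le (fun j => (rarity_pos d (p.lt_x j)).le)
    fun j => rarity_le d (p.lt_x j) (p.h_le j)

lemma tendsto_x (p : Params f g h w x K) : Tendsto x atTop atTop := by
  have h1 : ∀ j : ℕ, x 0 + j ≤ x j := fun j => by
    induction j with
    | zero => simp
    | succ j ih => push_cast; linarith [p.x_succ j]
  exact tendsto_atTop_mono h1 (tendsto_atTop_add_const_left _ _ tendsto_natCast_atTop_atTop)

lemma monotone_x (p : Params f g h w x K) : Monotone x :=
  monotone_nat_of_le_succ fun j => by linarith [p.x_succ j]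

lemma monotone_K (p : Params f g h w x K) : Monotone K :=
  monotone_nat_of_le_succ fun j => (le_mul_of_one_le_left (p.K_pos j).le
    (one_le_pow₀ (by norm_num))).trans (p.K_succ j)

lemma tendsto_K (p : Params f g h w x K) : Tendsto K atTop atTop := by
  refine tendsto_atTop_mono (fun j => ?_)
    (tendsto_pow_atTop_atTop_of_one_lt (by norm_num : (1 : ℝ) < 4))
  cases j with
  | zero => simpa using p.one_le_K 0
  | succ j => exact (le_mul_of_one_le_right (by positivity) (p.one_le_K j)).trans (p.K_succ j)

lemma h_le_one (p : Params f g h w x K) (d : RateData f h w) (j : ℕ) : h (x j) ≤ 1 :=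
  (p.h_le j).trans (inv_le_one_of_one_le₀ d.one_lt.le)

lemma summable_variance (p : Params f g h w x K) (d : RateData f h w) :
    Summable fun j => weight f h j (x j) (K j) ^ 2 * rarity f h j (x j) := by
  simp_rw [fun j => weight_sq_mul_rarity (j := j) d (p.lt_x j) (p.K_pos j).le]
  refine (summable_nat_add_iff 1).1 (Summable.of_nonneg_of_le (fun j => ?_) (fun j => ?_)
    ((summable_nat_add_iff 1).2 summable_geometric_two))
  · exact mul_nonneg (d.pos_h (p.lt_x _)).le (p.K_pos _).le
  · exact (p.variance_le j).trans (mul_le_of_le_one_right (by positivity) (p.h_le_one d j))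

lemma tendsto_h_x (p : Params f g h w x K) (d : RateData f h w) :
    Tendsto (fun j => h (x j)) atTop (𝓝 0) := d.tendsto_h.comp p.tendsto_x

lemma tendsto_exp_neg_h_x (p : Params f g h w x K) (d : RateData f h w) :
    Tendsto (fun j => Real.exp (-h (x j))) atTop (𝓝 1) := by
  have h1 := (Real.continuous_exp.tendsto _).comp (p.tendsto_h_x d).neg
  rwa [neg_zero, Real.exp_zero] at h1

/-- The asymptotic variance of the component `j` is of the order `K j`. -/
lemma le_variance_div_refresh (p : Params f g h w x K) (d : RateData f h w) (j : ℕ) :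
    K j ≤ weight f h j (x j) (K j) ^ 2 * rarity f h j (x j) / refresh h (x j) := by
  rw [weight_sq_mul_rarity d (p.lt_x j) (p.K_pos j).le, le_div_iff₀ (refresh_pos d (p.lt_x j)),
    mul_comm]
  exact mul_le_mul_of_nonneg_right refresh_le (p.K_pos j).le

lemma variance_div_refresh_le (p : Params f g h w x K) (d : RateData f h w) (j : ℕ) :
    weight f h j (x j) (K j) ^ 2 * rarity f h j (x j) / refresh h (x j) ≤ 2 * K j := by
  rw [weight_sq_mul_rarity d (p.lt_x j) (p.K_pos j).le, div_le_iff₀ (refresh_pos d (p.lt_x j))]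
  nlinarith [le_two_mul_refresh d (p.lt_x j) (p.h_le j), p.K_pos j]

lemma weight_le_spaceScale (p : Params f g h w x K) (d : RateData f h w) (j : ℕ) :
    weight f h j (x j) (K j) ≤ spaceScale f h j (x j) (K j) :=
  le_div_self (weight_pos d (p.lt_x j) (p.K_pos j)).le (refresh_pos d (p.lt_x j))
    refresh_lt_one.le

lemma spaceScale_succ (p : Params f g h w x K) (d : RateData f h w) (j : ℕ) :
    4 ^ (j + 1) * spaceScale f h j (x j) (K j) ≤
      spaceScale f h (j + 1) (x (j + 1)) (K (j + 1)) := by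
  have h1 := p.h_succ_space j
  have hh := d.pos_h (p.lt_x (j + 1))
  rw [mul_comm, ← le_div_iff₀ hh] at h1
  exact h1.trans (div_le_div₀ (weight_pos d (p.lt_x _) (p.K_pos _)).le
    ((p.fastWeights d).one_le' _) (refresh_pos d (p.lt_x _)) refresh_le)

lemma monotone_spaceScale (p : Params f g h w x K) (d : RateData f h w) :
    Monotone fun j => spaceScale f h j (x j) (K j) :=
  monotone_nat_of_le_succ fun j => (le_mul_of_one_le_left
    (spaceScale_pos d (p.lt_x j) (p.K_pos j)).le (one_le_pow₀ (by norm_num))).trans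
    (p.spaceScale_succ d j)

lemma tendsto_spaceScale (p : Params f g h w x K) (d : RateData f h w) :
    Tendsto (fun j => spaceScale f h j (x j) (K j)) atTop atTop := by
  refine tendsto_atTop_mono (fun j => ?_)
    (tendsto_pow_atTop_atTop_of_one_lt (by norm_num : (1 : ℝ) < 4))
  have h1 : ∀ j, 1 ≤ spaceScale f h j (x j) (K j) := fun j =>
    ((p.fastWeights d).one_le' j).trans (p.weight_le_spaceScale d j)
  cases j with
  | zero => simpa using h1 0
  | succ j => exact (le_mul_of_one_le_right (by positivity) (h1 j)).trans (p.spaceScale_succ d j)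

lemma strictMono_timeScale (p : Params f g h w x K) (d : RateData f h w) :
    StrictMono fun j => timeScale f h j (x j) := by
  refine strictMono_nat_of_lt_succ fun j => ?_
  have h1 := p.h_succ_time j
  have h2 := le_timeScale_mul (j := j + 1) d (p.lt_x (j + 1))
  have hh := d.pos_h (p.lt_x (j + 1))
  have h3 : rarity f h (j + 1) (x (j + 1)) * refresh h (x (j + 1)) ≤ h (x (j + 1)) :=
    (mul_le_of_le_one_left (refresh_pos d (p.lt_x _)).le
      ((rarity_le_one_eighth d (p.lt_x _) (p.h_le _)).trans (by norm_num))).trans refresh_le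
  have h4 : h (x (j + 1)) * (timeScale f h j (x j) + 1) ≤
      h (x (j + 1)) * timeScale f h (j + 1) (x (j + 1)) := by
    calc _ ≤ 1 := h1
      _ ≤ _ := h2
      _ ≤ timeScale f h (j + 1) (x (j + 1)) * h (x (j + 1)) := by gcongr
      _ = _ := mul_comm _ _
  have h5 := le_of_mul_le_mul_left h4 hh
  have h6 : timeScale f h j (x j) + 1 ≤ timeScale f h (j + 1) (x (j + 1)) := by exact_mod_cast h5
  exact h6

lemma tendsto_timeScale_mul (p : Params f g h w x K) (d : RateData f h w) :
    Tendsto (fun j => (timeScale f h j (x j) : ℝ) * (rarity f h j (x j) * refresh h (x j))) atTop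
      (𝓝 1) := by
  have h1 : Tendsto (fun j => 1 + rarity f h j (x j) * refresh h (x j)) atTop (𝓝 1) := by
    have h2 := (p.tendsto_exp_neg_h_x d).const_sub 1
    have h3 := (p.summable_rarity d).tendsto_atTop_zero.mul h2
    rw [zero_mul] at h3
    simpa [refresh] using h3.const_add 1
  exact tendsto_of_tendsto_of_tendsto_of_le_of_le tendsto_const_nhds h1
    (fun j => le_timeScale_mul d (p.lt_x j)) fun j => timeScale_mul_le d (p.lt_x j)

/-- The components of larger index stay small up to the time scale of a given component. -/
lemma timeScale_mul_rarity_mul_weight_le (p : Params f g h w x K) (d : RateData f h w) {m l : ℕ}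
    (hml : m < l) : (timeScale f h m (x m) : ℝ) *
      (rarity f h l (x l) * weight f h l (x l) (K l)) ≤ (1 / 2) ^ l := by
  obtain ⟨n, rfl⟩ := Nat.exists_eq_add_of_lt hml
  set n' := m + n
  have hJ : (timeScale f h m (x m) : ℝ) ≤ timeScale f h n' (x n') :=
    Nat.cast_le.2 ((p.strictMono_timeScale d).monotone (Nat.le_add_right m n))
  have hJ0 : (0 : ℝ) < timeScale f h n' (x n') := Nat.cast_pos.2 (timeScale_pos d (p.lt_x n'))
  have hr := rarity_pos (j := n' + 1) d (p.lt_x (n' + 1))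
  have hw := weight_pos (j := n' + 1) d (p.lt_x (n' + 1)) (p.K_pos (n' + 1))
  have hr1 := rarity_le_one_eighth (j := n' + 1) d (p.lt_x (n' + 1)) (p.h_le (n' + 1))
  set r := rarity f h (n' + 1) (x (n' + 1))
  set v := weight f h (n' + 1) (x (n' + 1)) (K (n' + 1))
  have h1 : (r * v) ^ 2 ≤ ((1 / 2) ^ (n' + 1) / timeScale f h n' (x n')) ^ 2 := by
    refine le_trans ?_ (p.variance_le_sq n')
    rw [← weight_sq_mul_rarity d (p.lt_x _) (p.K_pos _).le]
    change (r * v) ^ 2 ≤ v ^ 2 * r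
    have : r * r ≤ r := by nlinarith
    nlinarith [sq_nonneg v]
  have h2 := (le_abs_self _).trans (abs_le_of_sq_le_sq h1 (by positivity))
  calc (timeScale f h m (x m) : ℝ) * (r * v)
      ≤ timeScale f h n' (x n') * ((1 / 2) ^ (n' + 1) / timeScale f h n' (x n')) := by gcongr
    _ = (1 / 2) ^ (n' + 1) := mul_div_cancel₀ _ hJ0.ne'

/-- The components of smaller index contribute little at the space scale of a given component. -/
lemma low_components_le (p : Params f g h w x K) (d : RateData f h w) {m l : ℕ} (hlm : l < m) :
    timeScale f h m (x m) * (weight f h l (x l) (K l) ^ 2 * rarity f h l (x l) /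
      refresh h (x l)) / spaceScale f h m (x m) (K m) ^ 2 +
      spaceScale f h l (x l) (K l) / spaceScale f h m (x m) (K m) ≤ 5 * (1 / 4) ^ m := by
  obtain ⟨n, rfl⟩ := Nat.exists_eq_add_of_lt hlm
  set n' := l + n
  have hb := spaceScale_pos (j := n' + 1) d (p.lt_x (n' + 1)) (p.K_pos (n' + 1))
  have hw := weight_pos (j := n' + 1) d (p.lt_x (n' + 1)) (p.K_pos (n' + 1))
  have hu := refresh_pos d (p.lt_x (n' + 1))
  have hr := rarity_pos (j := n' + 1) d (p.lt_x (n' + 1))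
  have hK := p.K_pos (n' + 1)
  have hh := d.pos_h (p.lt_x (n' + 1))
  have hKl : K l ≤ (1 / 4) ^ (n' + 1) * K (n' + 1) := by
    have h1 := (p.monotone_K (Nat.le_add_right l n)).trans (b := K n') le_rfl
    have h2 := p.K_succ n'
    rw [one_div, inv_pow, le_inv_mul_iff₀ (by positivity)]
    exact (mul_le_mul_of_nonneg_left h1 (by positivity)).trans h2
  have hJb : timeScale f h (n' + 1) (x (n' + 1)) / spaceScale f h (n' + 1) (x (n' + 1))
      (K (n' + 1)) ^ 2 ≤ 2 / K (n' + 1) := by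
    have h1 := timeScale_mul_le (j := n' + 1) d (p.lt_x (n' + 1))
    have h2 : rarity f h (n' + 1) (x (n' + 1)) * refresh h (x (n' + 1)) ≤ 1 :=
      mul_le_one₀ ((rarity_le_one_eighth d (p.lt_x _) (p.h_le _)).trans (by norm_num)) hu.le
        refresh_lt_one.le
    have h3 := weight_sq_mul_rarity (j := n' + 1) d (p.lt_x (n' + 1)) hK.le
    have h4 := refresh_le (h := h) (x := x (n' + 1))
    rw [spaceScale, div_pow]
    set v := weight f h (n' + 1) (x (n' + 1)) (K (n' + 1))
    set r := rarity f h (n' + 1) (x (n' + 1))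
    set u := refresh h (x (n' + 1))
    set T := (timeScale f h (n' + 1) (x (n' + 1)) : ℝ)
    rw [div_le_div_iff₀ (by positivity) hK, mul_div_assoc', le_div_iff₀ (by positivity)]
    have h5 : T * (r * u) ≤ 2 := by linarith
    refine le_of_mul_le_mul_right ?_ hr
    calc T * K (n' + 1) * u ^ 2 * r = T * (r * u) * (K (n' + 1) * u) := by ring
      _ ≤ 2 * (K (n' + 1) * h (x (n' + 1))) := by gcongr
      _ = 2 * (v ^ 2 * r) := by rw [h3]; ring
      _ = 2 * v ^ 2 * r := by ring
  have h1 : timeScale f h (n' + 1) (x (n' + 1)) * (weight f h l (x l) (K l) ^ 2 *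
      rarity f h l (x l) / refresh h (x l)) /
      spaceScale f h (n' + 1) (x (n' + 1)) (K (n' + 1)) ^ 2 ≤ 4 * (1 / 4) ^ (n' + 1) := by
    rw [mul_div_right_comm]
    have hvar := p.variance_div_refresh_le d l
    calc _ ≤ 2 / K (n' + 1) * (2 * ((1 / 4) ^ (n' + 1) * K (n' + 1))) :=
          mul_le_mul hJb (hvar.trans (by gcongr))
            ((p.K_pos l).le.trans (p.le_variance_div_refresh d l)) (by positivity)
      _ = 4 * (1 / 4) ^ (n' + 1) := by field_simp; ring
  have h2 : spaceScale f h l (x l) (K l) / spaceScale f h (n' + 1) (x (n' + 1)) (K (n' + 1)) ≤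
      (1 / 4) ^ (n' + 1) := by
    rw [div_le_iff₀ hb, one_div, inv_pow, le_inv_mul_iff₀ (by positivity)]
    exact (mul_le_mul_of_nonneg_left (p.monotone_spaceScale d (Nat.le_add_right l n))
      (by positivity)).trans (p.spaceScale_succ d n')
  linarith

lemma tendsto_sum_low_components (p : Params f g h w x K) (d : RateData f h w) :
    Tendsto (fun m => ∑ l ∈ Finset.range m,
      (timeScale f h m (x m) * (weight f h l (x l) (K l) ^ 2 * rarity f h l (x l) /
        refresh h (x l)) / spaceScale f h m (x m) (K m) ^ 2 +
      spaceScale f h l (x l) (K l) / spaceScale f h m (x m) (K m))) atTop (𝓝 0) := by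
  have h1 : Tendsto (fun m : ℕ => 5 * ((m : ℝ) * (1 / 4) ^ m)) atTop (𝓝 0) := by
    have h2 := (tendsto_self_mul_const_pow_of_lt_one (r := 1 / 4) (by norm_num)
      (by norm_num)).const_mul 5
    rwa [mul_zero] at h2
  refine squeeze_zero (fun m => Finset.sum_nonneg fun l _ => ?_) (fun m => ?_) h1
  · have h2 := (p.K_pos l).le.trans (p.le_variance_div_refresh d l)
    have h3 := spaceScale_pos (j := m) d (p.lt_x m) (p.K_pos m)
    have h4 := spaceScale_pos (j := l) d (p.lt_x l) (p.K_pos l)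
    positivity
  · refine (Finset.sum_le_sum fun l hl => p.low_components_le d (Finset.mem_range.1 hl)).trans_eq ?_
    rw [Finset.sum_const, Finset.card_range, nsmul_eq_mul]
    ring

/-- The ratios `K j / share j` at least double, so their sums are dominated by the last term. -/
lemma sum_K_div_share_le (p : Params f g h w x K) (k : ℕ) :
    ∑ j ∈ Finset.range (k + 1), K j / share j ≤ 2 * (K k / share k) := by
  have hnn : ∀ k, 0 < K k / share k := fun k => div_pos (p.K_pos k) (share_pos k)
  induction k with
  | zero => simpa using by linarith [hnn 0]
  | succ k ih =>
    rw [Finset.sum_range_succ]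
    have h1 : 2 * (K k / share k) ≤ K (k + 1) / share (k + 1) := by
      have h2 : share (k + 1) = share k / 2 := by unfold share; ring
      have h3 : K k ≤ K (k + 1) := p.monotone_K (Nat.le_succ k)
      have h4 := share_pos k
      rw [h2, div_div_eq_mul_div, mul_div_assoc', mul_comm]
      gcongr
    linarith

/-- The bound for the tail of the marginal law. A component `j` located to the left of `y` is
controlled through `f y`, one located to the right through its variance. -/
lemma sum_weight_sq_mul_min_le (p : Params f g h w x K) (d : RateData f h w)
    (hg1 : ∀ x ∈ Ici (1 : ℝ), 1 ≤ g x) {y : ℝ} (hy : x 0 ≤ y) (N : ℕ) :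
    ∑ j ∈ Finset.range N, weight f h j (x j) (K j) ^ 2 * min (rarity f h j (x j)) (f y) ≤
      3 * (h y * g y) := by
  classical
  have hwy : w < y := (p.lt_x 0).trans_le hy
  have hy1 : 1 < y := d.one_lt.trans hwy
  have hhy := d.pos_h hwy
  have hfy := d.pos y hy1.le
  have hex : ∃ k, y < x k := (p.tendsto_x.eventually_gt_atTop y).exists
  obtain ⟨k, hk1, hk2⟩ : ∃ k, x k ≤ y ∧ y < x (k + 1) := by
    rcases hfind : Nat.find hex with _ | k
    · have h1 := Nat.find_spec hex
      rw [hfind] at h1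
      exact absurd h1 (not_lt.2 hy)
    · have h1 := Nat.find_spec hex
      rw [hfind] at h1
      exact ⟨k, not_lt.1 (Nat.find_min hex (by omega)), h1⟩
  set T : ℕ → ℝ := fun j => weight f h j (x j) (K j) ^ 2 * min (rarity f h j (x j)) (f y) with hT
  have hT0 : ∀ j, 0 ≤ T j := fun j => by
    have := rarity_pos (j := j) d (p.lt_x j)
    positivity
  have hTv : ∀ j, T j ≤ h (x j) * K j := fun j => by
    rw [← weight_sq_mul_rarity (j := j) d (p.lt_x j) (p.K_pos j).le]
    exact mul_le_mul_of_nonneg_left (min_le_left _ _) (sq_nonneg _)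
  have hleft : ∀ j ∈ Finset.range (k + 1), T j ≤ K j / share j * h y := fun j hj => by
    have hxj : x j ≤ y := (p.monotone_x (Nat.lt_succ_iff.1 (Finset.mem_range.1 hj))).trans hk1
    have h1 := d.mul_div_height_le (p.lt_x j) hxj
    have h2 := d.height_pos (d.one_lt.trans (p.lt_x j)).le
    have h3 := p.K_pos j
    have h4 := share_pos j
    calc T j ≤ weight f h j (x j) (K j) ^ 2 * f y :=
          mul_le_mul_of_nonneg_left (min_le_right _ _) (sq_nonneg _)
      _ = K j / share j * (h (x j) * f y / RateData.height f h (x j)) := by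
          rw [weight_sq d (p.lt_x j) h3.le, rarity]
          field_simp
      _ ≤ _ := by gcongr
  have hmid : T (k + 1) ≤ h y * g y := (hTv _).trans (p.variance_le_g k y hk1 hk2.le)
  have hright : ∀ i, T (k + 2 + i) ≤ h y * ((1 / 2) * (1 / 2) ^ i) := fun i => by
    have h1 : T (k + 2 + i) ≤ (1 / 2) ^ (k + 1 + i + 1) * h (x (k + 1 + i)) := by
      rw [show k + 2 + i = k + 1 + i + 1 by ring]
      exact (hTv _).trans (p.variance_le (k + 1 + i))
    have h2 : h (x (k + 1 + i)) ≤ h y := by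
      have h3 : y ≤ x (k + 1 + i) := hk2.le.trans (p.monotone_x (Nat.le_add_right _ _))
      exact d.antitone_h hy1 (hy1.trans_le h3) h3
    refine h1.trans ?_
    rw [mul_comm]
    have h4 : (1 / 2 : ℝ) ^ (k + 1 + i + 1) ≤ 1 / 2 * (1 / 2) ^ i := by
      rw [← pow_succ']
      exact pow_le_pow_of_le_one (by norm_num) (by norm_num) (by omega)
    exact mul_le_mul h2 h4 (by positivity) hhy.le
  -- there is one component in neither class: `k + 1`, for which `variance_le_g` was imposed
  have hsplit : ∑ j ∈ Finset.range N, T j ≤ ∑ j ∈ Finset.range (k + 1), T j + T (k + 1) +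
      ∑ i ∈ Finset.range N, T (k + 2 + i) := by
    rw [← Finset.sum_range_succ, ← Finset.sum_range_add]
    exact Finset.sum_le_sum_of_subset_of_nonneg (Finset.range_mono (by omega)) fun j _ _ => hT0 j
  have hg := hg1 y hy1.le
  have hL : ∑ j ∈ Finset.range (k + 1), T j ≤ h y * g y := by
    refine (Finset.sum_le_sum hleft).trans ?_
    rw [← Finset.sum_mul, mul_comm]
    exact mul_le_mul_of_nonneg_left ((p.sum_K_div_share_le k).trans (p.le_g k y hk1)) hhy.le
  have hR : ∑ i ∈ Finset.range N, T (k + 2 + i) ≤ h y * g y := by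
    refine (Finset.sum_le_sum fun i _ => hright i).trans ?_
    rw [← Finset.mul_sum, ← Finset.mul_sum]
    have h1 : ∑ i ∈ Finset.range N, (1 / 2 : ℝ) ^ i ≤ 2 :=
      (summable_geometric_two.sum_le_tsum _ fun l _ => by positivity).trans_eq
        tsum_geometric_two
    exact mul_le_mul_of_nonneg_left (by linarith) hhy.le
  linarith

end Params

end

end MarkovCLT


theorem theorem5p5 (f g : ℝ → ℝ)
    (hf_range : ∀ x ∈ Ici (1 : ℝ), 0 < f x ∧ f x ≤ 1)
    (hf_cont : ContinuousOn f (Ici 1))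
    (hf_anti : StrictAntiOn f (Ici 1))
    (hf_lim : Tendsto f atTop (𝓝 0))
    (hf_smooth : ContDiffOn ℝ 2 f (Ioi 1))
    (hf_slow : ∀ c : ℝ, 0 < c → Tendsto (fun x => Real.exp (c * x) * f x) atTop atTop)
    (hf_mul : ∃ w : ℝ, 1 < w ∧ AntitoneOn (fun x => x * f x) (Ici w))
    (hf_logconvex : ConvexOn ℝ (Ici 1) (fun x => Real.log (f x)))
    (hg_range : ∀ x ∈ Ici (1 : ℝ), 1 ≤ g x)
    (hg_lim : Tendsto g atTop atTop) :
    ∃ (Ω : Type) (_ : MeasurableSpace Ω) (P : Measure Ω) (_ : IsProbabilityMeasure P)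
      (X : ℤ → Ω → ℝ) (S : Set ℝ),
      -- a strictly stationary, countable-state, irreducible, aperiodic, reversible Markov chain
      IsCountableMarkovChain P X S ∧ IsStrictlyStationary P X ∧
      IsIrreducibleOn P X S ∧ IsAperiodicOn P X S ∧ IsTimeReversible P X ∧
      -- `E[X₀²] < ∞` and `E[X₀] = 0`
      MemLp (X 0) 2 P ∧ (∫ ω, X 0 ω ∂P) = 0 ∧
      -- the tail condition
      IntegrableOn (fun u => upperQuantile P (fun ω => |X 0 ω|) u ^ 2) (Ioo 0 1) ∧
      (fun x => ∫ u in (0 : ℝ)..f x, upperQuantile P (fun ω => |X 0 ω|) u ^ 2) =O[atTop]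
        (fun x => -deriv f x / f x * g x) ∧
      -- the mixing rate
      (∀ n : ℕ, 1 ≤ n → alphaMix P X n ≤ betaMix P X n ∧ betaMix P X n ≤ f n) ∧
      -- superlinear growth of the variances and complete dissipation
      Tendsto (fun n : ℕ => (n : ℝ)⁻¹ * variance (partialSum X n) P) atTop atTop ∧
      IsCompletelyDissipated P X ∧
      -- the partial limiting distribution
      ∃ (J : ℕ → ℕ) (b : ℕ → ℝ), StrictMono J ∧ (∀ n, 1 ≤ J n) ∧ (∀ n, 0 < b n) ∧
        Tendsto b atTop atTop ∧
        TendstoInDistribution (fun n ω => (b n)⁻¹ * partialSum X (J n) ω) atTop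
          (id : ℝ → ℝ) (fun _ => P) muP1sL := by
  obtain ⟨w, hw, hmul⟩ := hf_mul
  set h : ℝ → ℝ := fun x => -deriv f x / f x
  have d : RateData f h w :=
    rateData_neg_deriv_div hf_range hf_smooth hf_slow hw hmul hf_logconvex
  obtain ⟨x, K, p⟩ := d.exists_params hg_range hg_lim
  -- weights, probabilities of keeping the state, and masses off `0` of the component chains
  set a : ℕ → ℝ := fun j => weight f h j (x j) (K j)
  set θ : ℕ → unitInterval := fun j => ⟨Real.exp (-h (x j)), (Real.exp_pos _).le,
    Real.exp_le_one_iff.2 (neg_nonpos.2 (d.pos_h (p.lt_x j)).le)⟩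
  set ε : ℕ → unitInterval := fun j => ⟨rarity f h j (x j), (rarity_pos d (p.lt_x j)).le,
    (rarity_le_one_eighth d (p.lt_x j) (p.h_le j)).trans (by norm_num)⟩
  have ha : FastWeights a := p.fastWeights d
  have hε : Summable fun j => (ε j : ℝ) := p.summable_rarity d
  have hε0 : ∀ j, 0 < (ε j : ℝ) := fun j => rarity_pos d (p.lt_x j)
  have hε1 : ∀ j, (ε j : ℝ) < 1 := fun j =>
    (rarity_le_one_eighth d (p.lt_x j) (p.h_le j)).trans_lt (by norm_num)
  have hθ : ∀ j, (θ j : ℝ) < 1 := fun j => sub_pos.1 (refresh_pos d (p.lt_x j))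
  have hs : Summable fun j => a j ^ 2 * (ε j : ℝ) := p.summable_variance d
  have hdiss : IsCompletelyDissipated (pathLaw θ ε) (proc a) :=
    isCompletelyDissipated_proc hε hθ (tendsto_atTop_mono (p.le_variance_div_refresh d) p.tendsto_K)
  refine ⟨PathSpace, inferInstance, pathLaw θ ε, inferInstance, proc a, stateSpace a,
    isCountableMarkovChain_proc ha hε, isStrictlyStationary_proc θ ε a,
    isIrreducibleOn_proc ha hε hε0 hε1 hθ, isAperiodicOn_proc ha hε hε0 hε1 hθ,
    isTimeReversible_proc θ ε a, memLp_proc_zero ha hs, integral_proc_zero θ ε a, ?_, ?_, ?_,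
    tendsto_variance_of_isCompletelyDissipated (memLp_partialSum_proc ha hs)
      (measurable_partialSum a) hdiss, hdiss,
    fun j => timeScale f h j (x j), fun j => spaceScale f h j (x j) (K j),
    p.strictMono_timeScale d, fun j => timeScale_pos d (p.lt_x j),
    fun j => spaceScale_pos d (p.lt_x j) (p.K_pos j), p.tendsto_spaceScale d,
    tendstoInDistribution_proc hε hθ ha.pos (p.tendsto_exp_neg_h_x d) (p.tendsto_spaceScale d)
      (p.tendsto_timeScale_mul d) (p.tendsto_sum_low_components d)
      fun _ _ hml => p.timeScale_mul_rarity_mul_weight_le d hml⟩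
  · refine IntegrableOn.mono_set (integral_sq_upperQuantile_proc_le (θ := θ) ha hε zero_le_one
      (C := ∑' j, a j ^ 2 * (ε j : ℝ)) fun N => ?_).1 Ioo_subset_Ioc_self
    refine (Finset.sum_le_sum fun j _ => ?_).trans
      (hs.sum_le_tsum (Finset.range N) fun j _ => mul_nonneg (sq_nonneg _) (hε0 j).le)
    exact mul_le_mul_of_nonneg_left (min_le_left _ _) (sq_nonneg _)
  -- the constant: `4` from the squared quantile, `3` from the three kinds of components
  · refine IsBigO.of_bound 12 ?_
    filter_upwards [eventually_ge_atTop (x 0)] with y hy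
    have hfy : 0 ≤ f y := (d.pos y (d.one_lt.trans ((p.lt_x 0).trans_le hy)).le).le
    have h1 := (integral_sq_upperQuantile_proc_le (θ := θ) ha hε hfy
      (p.sum_weight_sq_mul_min_le d hg_range hy)).2
    rw [Real.norm_of_nonneg (intervalIntegral.integral_nonneg hfy fun u _ => sq_nonneg _)]
    calc _ ≤ 4 * (3 * (h y * g y)) := h1
      _ = 12 * (h y * g y) := by ring
      _ ≤ _ := mul_le_mul_of_nonneg_left (le_abs_self _) (by norm_num)
  · refine fun n hn => mixing_proc θ ε a fun N => ?_
    have hfn : 0 ≤ f n := (d.pos n (by exact_mod_cast hn)).le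
    calc ∑ j ∈ Finset.range N, 2 * (ε j : ℝ) * (θ j : ℝ) ^ n
        ≤ ∑ j ∈ Finset.range N, 2 * share j * f n := Finset.sum_le_sum fun j _ => by
          have h1 := d.height_mul_exp_le (p.lt_x j) hn
          have h2 := share_pos j
          calc 2 * (share j * RateData.height f h (x j)) * Real.exp (-h (x j)) ^ n
              = 2 * share j * (RateData.height f h (x j) * Real.exp (-h (x j)) ^ n) := by ring
            _ ≤ 2 * share j * f n := by gcongr
      _ = (∑ j ∈ Finset.range N, 2 * share j) * f n := by rw [Finset.sum_mul]
      _ ≤ f n := mul_le_of_le_one_left hfn (sum_share_le N)
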